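/- **Theorem.** Fix a mass $m>0$. For $\nu\in[-1,0)$, $k\in\mathbb Z\setminus\{0\}$ and $N>0$ put $$\gamma=\sqrt{k^2-\nu^2},\qquad \alpha_N=\frac{\nu\sqrt{N^2+m^2}}{N},\qquad e^{2i\xi}=\frac{-k+\frac{i\nu m}{N}}{\gamma-i\alpha_N}$$ (the right-hand side of the last formula has modulus one, so $\xi\in\mathbb R$ is determined modulo $\pi$; any choice of $\xi$, independent of $\rho$, is allowed). For $\rho>0$ let $$\Phi_k(N,\rho)=iF_k(N,\rho)+G_k(N,\rho)=e^{\frac{\pi\alpha_N}{2}}\,\frac{|\Gamma(\gamma+1+i\alpha_N)|}{\Gamma(2\gamma+1)}\,\frac{(2\rho)^{\gamma}}{\rho}\,e^{i\rho+i\xi}\,{}_1F_1(\gamma-i\alpha_N,\,2\gamma+1,\,2i\rho),$$ where $F_k$ and $G_k$ are the imaginary and the real part of the right-hand side (they are used as rescaled radial components, without energy normalization factors, of generalized eigenfunctions for the massive repulsive Dirac–Coulomb equation). For each such $k,\nu,N,\xi$ the function $\rho\mapsto\Phi_k(N,\rho)$ is differentiable on $(0,\infty)$; let $\Phi_k'$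 denote its derivative in $\rho$. (i) There exist constants $C,D>0$ (depending on nothing but $m$) such that for all $\nu\in[-1,0)$, all $k\in\mathbb Z$ with $|k|\ge2$, all $N\in 2^{\mathbb Z}$ and all $\rho>0$ $$|\Phi_k(N,\rho)|\le C\begin{cases}(\min\{\rho/2,1\})^{\gamma-1}e^{-D|k|},&0<\rho\le\max\{|k|/2,2\},\\ |k|^{-3/4}\big(\big||k|-\rho\big|+|k|^{1/3}\big)^{-1/4},&|k|/2\le\rho\le2|k|,\\ \rho^{-1},&\rho\ge2|k|,\end{cases}$$ and $$|\Phi_k'(N,\rho)|\le C\begin{cases}(\min\{\rho/2,1\})^{\gamma-2}e^{-D|k|},&0<\rho\le\max\{|k|/2,2\},\\ |k|^{-3/4}\big(\big||k|-\rho\big|+|k|^{1/3}\big)^{-1/4},&|k|/2\le\rho\le2|k|,\\ \rho^{-1},&\rho\ge2|k|.\end{cases}$$ Where the ranges of $\rho$ overlap, every applicable bound holds. (ii) For every $\nu\in[-1,0)$ there is a constant $c>0$, depending only on $m$ and on $\gamma_1:=\sqrt{1-\nu^2}$, such that for $k=\pm1$, all $N\in2^{\mathbb Z}$ and all $\rho>0$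 $$|\Phi_{\pm1}(N,\rho)|\le c\begin{cases}\rho^{\gamma_1-1},&\rho\le1,\\ \rho^{-1},&\rho>1,\end{cases}\qquad |\Phi_{\pm1}'(N,\rho)|\le c\begin{cases}\rho^{\gamma_1-2},&\rho\le1,\\ \rho^{-1},&\rho>1.\end{cases}$$ -/

import Mathlib

open scoped Nat

namespace DiracCoulomb

noncomputable section

/-- Kummer's confluent hypergeometric function
`₁F₁(a; b; z) = ∑ₙ (a)ₙ / ((b)ₙ n!) zⁿ` for `b ∉ {0, -1, -2, …}`. Mathlib has the regularized
function `₁F₁(a; b; z) / Γ(b)`; see `kummer_eq_tsum` for the classical series. -/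
def kummer (a b z : ℂ) : ℂ :=
  Complex.Gamma b * Complex.regularizedHGFun {a} {b} z

theorem kummer_eq_tsum (a b z : ℂ) (hb : ∀ n : ℕ, b ≠ -n) :
    kummer a b z =
      ∑' n : ℕ, (ascPochhammer ℂ n).eval a / ((ascPochhammer ℂ n).eval b * (n ! : ℂ)) * z ^ n := by
  have hG : Complex.Gamma b ≠ 0 := Complex.Gamma_ne_zero hb
  unfold kummer Complex.regularizedHGFun Complex.regularizedHGFunSeries
  rw [← FormalMultilinearSeries.ofScalarsSum, FormalMultilinearSeries.ofScalarsSum_eq_tsum,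
    ← tsum_mul_left]
  refine tsum_congr fun n => ?_
  have h := Complex.Gamma_add_nat_div_Gamma_eq (n := n) b hb
  have h2 : Complex.Gamma (b + n) = (ascPochhammer ℂ n).eval b * Complex.Gamma b := by
    rw [← h]; field_simp
  simp only [Complex.regularizedHGFunCoeff, Multiset.map_singleton, Multiset.prod_singleton,
    smul_eq_mul, h2]
  field_simp

/-- `γ = √(k² - ν²)`. -/
def gam (ν : ℝ) (k : ℤ) : ℝ := √((k : ℝ) ^ 2 - ν ^ 2)

/-- `α_N = ν √(N² + m²) / N`. -/
def alpha (m ν N : ℝ) : ℝ := ν * √(N ^ 2 + m ^ 2) / N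

/-- The real number `ξ` is a phase shift `ξ(N)`:
`e^{2iξ} = (-k + iνm/N) / (γ - iα_N)`. It is determined modulo `π`. -/
def IsPhaseShift (m ν : ℝ) (k : ℤ) (N ξ : ℝ) : Prop :=
  Complex.exp (2 * Complex.I * ξ) =
    (-(k : ℂ) + Complex.I * ν * m / N) / (gam ν k - Complex.I * alpha m ν N)

/-- A phase shift exists, because the right hand side has modulus one. -/
theorem exists_isPhaseShift {m ν N : ℝ} {k : ℤ} (hN : 0 < N) (hk : 1 ≤ |k|)
    (hν : ν ∈ Set.Ico (-1 : ℝ) 0) : ∃ ξ : ℝ, IsPhaseShift m ν k N ξ := by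
  obtain ⟨h1, h2⟩ := hν
  have hk1 : (1 : ℝ) ≤ (k : ℝ) ^ 2 := by
    have : (1 : ℝ) ≤ |(k : ℝ)| := by exact_mod_cast hk
    rw [← sq_abs]; nlinarith
  have hg : gam ν k ^ 2 = (k : ℝ) ^ 2 - ν ^ 2 := Real.sq_sqrt (by nlinarith)
  have ha : alpha m ν N ^ 2 = ν ^ 2 * (N ^ 2 + m ^ 2) / N ^ 2 := by
    unfold alpha; rw [div_pow, mul_pow, Real.sq_sqrt (by positivity)]
  set w : ℂ := (-(k : ℂ) + Complex.I * ν * m / N) / (gam ν k - Complex.I * alpha m ν N) with hw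
  have hnum : Complex.normSq (-(k : ℂ) + Complex.I * ν * m / N) =
      (k : ℝ) ^ 2 + (ν * m / N) ^ 2 := by
    have : (-(k : ℂ) + Complex.I * ν * m / N) =
        ((-(k : ℝ) : ℝ) : ℂ) + ((ν * m / N : ℝ) : ℂ) * Complex.I := by push_cast; ring
    rw [this, Complex.normSq_add_mul_I]; ring
  have hden : Complex.normSq (gam ν k - Complex.I * alpha m ν N : ℂ) =
      (k : ℝ) ^ 2 + (ν * m / N) ^ 2 := by
    have : (gam ν k - Complex.I * alpha m ν N : ℂ) =
        ((gam ν k : ℝ) : ℂ) + ((-alpha m ν N : ℝ) : ℂ) * Complex.I := by push_cast; ring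
    rw [this, Complex.normSq_add_mul_I, neg_sq, hg, ha]; field_simp; ring
  have hpos : 0 < (k : ℝ) ^ 2 + (ν * m / N) ^ 2 := by positivity
  have hn : ‖w‖ = 1 := by
    have : ‖w‖ ^ 2 = 1 := by
      rw [← Complex.normSq_eq_norm_sq, hw, Complex.normSq_div, hnum, hden, div_self hpos.ne']
    nlinarith [norm_nonneg w]
  refine ⟨w.arg / 2, ?_⟩
  have := Complex.norm_mul_exp_arg_mul_I w
  rw [hn] at this
  unfold IsPhaseShift
  rw [← hw]
  push_cast
  rw [show (2 * Complex.I * (w.arg / 2) : ℂ) = w.arg * Complex.I by ring]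
  simpa using this

/-- The real prefactor `e^{πα_N/2} |Γ(γ+1+iα_N)| / Γ(2γ+1) · (2ρ)^γ / ρ`. -/
def pref (m ν : ℝ) (k : ℤ) (N ρ : ℝ) : ℝ :=
  Real.exp (Real.pi * alpha m ν N / 2) *
    (‖Complex.Gamma (gam ν k + 1 + Complex.I * alpha m ν N)‖ / Real.Gamma (2 * gam ν k + 1)) *
    ((2 * ρ) ^ gam ν k / ρ)

/-- The complex wave `e^{iρ + iξ} ₁F₁(γ - iα_N; 2γ + 1; 2iρ)`. -/
def wave (m ν : ℝ) (k : ℤ) (N ξ ρ : ℝ) : ℂ :=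
  Complex.exp (Complex.I * ρ + Complex.I * ξ) *
    kummer (gam ν k - Complex.I * alpha m ν N) (2 * gam ν k + 1) (2 * Complex.I * ρ)

/-- The rescaled radial component `F_k(N, ρ)`. -/
def radialF (m ν : ℝ) (k : ℤ) (N ξ ρ : ℝ) : ℝ := pref m ν k N ρ * (wave m ν k N ξ ρ).im

/-- The rescaled radial component `G_k(N, ρ)`. -/
def radialG (m ν : ℝ) (k : ℤ) (N ξ ρ : ℝ) : ℝ := pref m ν k N ρ * (wave m ν k N ξ ρ).re

/-- The rescaled generalized eigenfunction `Φ_k = i F_k + G_k`. -/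
def Phi (m ν : ℝ) (k : ℤ) (N ξ ρ : ℝ) : ℂ :=
  Complex.I * radialF m ν k N ξ ρ + radialG m ν k N ξ ρ

theorem Phi_eq (m ν : ℝ) (k : ℤ) (N ξ ρ : ℝ) :
    Phi m ν k N ξ ρ = pref m ν k N ρ * wave m ν k N ξ ρ := by
  conv_rhs => rw [← Complex.re_add_im (wave m ν k N ξ ρ)]
  simp only [Phi, radialF, radialG]
  push_cast
  ring

end

end DiracCoulomb

namespace DiracCoulomb

open Complex Filter Topology Set MeasureTheory

/-! ### Kummer's function -/

/-! Put `a = -α_N > 0`. Everything reduces to one real function, `h(ρ) = e^{-iρ} ₁F₁(γ+1+ia; 2γ+2;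
2iρ)`, which solves `ρh'' + (2γ+2)h' + (ρ+2a)h = 0` with `h(0) = 1`. A contiguous relation
(`kummer_eq_coulombH`) gives `|Φ| = e^{-πa} K ρ^{γ-1} |ρh' + (2γ+1)h - iρh|`, where `K =
coulombConst γ a` (`Phi_eq_diracY`, `norm_Phi_eq`). The phase `ξ` enters only through a unimodular
factor. For fixed `ν`, `a` tends to infinity as `N → 0`; uniformity holds because the estimates lose
only powers of `1 + a`, which the exponential factor absorbs.

Near the origin an energy identity gives `|h| ≤ 1` and `|ρh'| ≤ ρ + a`. What remains is the size of
`2^γ Γ(γ+1)/Γ(2γ+2)`: by the duplication formula and a crude Stirling bound it beats `(|k|/2)^γ` by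
an exponential in `|k|`.

Further out one studies `U = K ρ^{γ+1/2} h` and `W = ρU'`, which satisfy `ρ(ρU')' + DU = 0` with `D
= ρ² + 2aρ - l²` and `l = γ + 1/2`. A WKB energy is monotone where `D` is large and has a known
limit at infinity, so it bounds `U` and `W` from infinity inwards, down to the Airy scale `D = s²`,
`s³ = 4l²` (`wkb_bound`). An unweighted energy carries the bounds through the turning point, and
monotonicity of `U²` and `W²` carries them to the left of it (`amplitude_bound`). This yields the
factor `(||k|-ρ| + |k|^{1/3})^{-1/4}`; for `ρ ≥ 2|k|` the WKB bound alone gives `ρ^{-1}`.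

The limit at infinity is a connection formula: `K ρ^{γ+1} h` has asymptotic amplitude one. It is
read off the Laplace transform of `ρ^{2γ+1} e^{-iρ} h`, which satisfies a first-order equation and
is therefore explicit. Letting `t → ∞` fixes its constant by `h(0) = 1`; letting `t → 0+` shows the
amplitude at infinity (`laplaceConst_eq`, `connection_formula`). -/

/-- The coefficients `(a)ₙ / (n! Γ(b + n))`. -/
noncomputable def kcoeff (a b : ℂ) (n : ℕ) : ℂ := regularizedHGFunCoeff {a} {b} n

theorem kcoeff_eq (a b : ℂ) (n : ℕ) :
    kcoeff a b n = (ascPochhammer ℂ n).eval a / (n ! * Gamma (b + n)) := by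
  simp [kcoeff, regularizedHGFunCoeff]

theorem hasFPowerSeriesOnBall_regularizedHGFun (a b : ℂ) :
    HasFPowerSeriesOnBall (regularizedHGFun {a} {b}) (regularizedHGFunSeries {a} {b}) 0 ⊤ := by
  have h : (regularizedHGFunSeries {a} {b}).radius = ⊤ :=
    radius_regularizedHGFunSeries_eq_top (by simp)
  have := (regularizedHGFunSeries {a} {b}).hasFPowerSeriesOnBall (by simp [h])
  rw [h] at this
  exact this

theorem hasSum_regularizedHGFun (a b z : ℂ) :
    HasSum (fun n ↦ kcoeff a b n * z ^ n) (regularizedHGFun {a} {b} z) := by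
  have := (hasFPowerSeriesOnBall_regularizedHGFun a b).hasSum (y := z) (by simp)
  rw [zero_add] at this
  refine this.congr_fun fun n ↦ ?_
  rw [FormalMultilinearSeries.apply_eq_pow_smul_coeff, regularizedHGFunSeries_coeff, smul_eq_mul,
    mul_comm, kcoeff]

theorem succ_mul_kcoeff_succ (a b : ℂ) (n : ℕ) :
    (n + 1) * kcoeff a b (n + 1) = a * kcoeff (a + 1) (b + 1) n := by
  have h1 : (ascPochhammer ℂ (n + 1)).eval a = a * (ascPochhammer ℂ n).eval (a + 1) := by
    simp [ascPochhammer_succ_left]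
  have h2 : b + ((n + 1 : ℕ) : ℂ) = b + 1 + n := by push_cast; ring
  rw [kcoeff_eq, kcoeff_eq, h1, h2, Nat.factorial_succ]
  have h3 : (n : ℂ) + 1 ≠ 0 := by exact_mod_cast n.succ_ne_zero
  push_cast
  field_simp

theorem hasDerivAt_regularizedHGFun (a b z : ℂ) :
    HasDerivAt (regularizedHGFun {a} {b}) (a * regularizedHGFun {a + 1} {b + 1} z) z := by
  have hp := hasFPowerSeriesOnBall_regularizedHGFun a b
  have hd : DifferentiableAt ℂ (regularizedHGFun {a} {b}) z :=
    (hp.differentiableOn z (by simp)).differentiableAt (by simp)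
  have h1 := (hp.fderiv).hasSum (y := z) (by simp)
  rw [zero_add] at h1
  have h2 := h1.mapL (ContinuousLinearMap.apply ℂ ℂ (1 : ℂ))
  have h3 : HasSum (fun n ↦ a * (kcoeff (a + 1) (b + 1) n * z ^ n))
      (fderiv ℂ (regularizedHGFun {a} {b}) z 1) := by
    refine h2.congr_fun fun n ↦ ?_
    have := FormalMultilinearSeries.derivSeries_coeff_one (regularizedHGFunSeries {a} {b}) n
    rw [← mul_assoc, ← succ_mul_kcoeff_succ]
    simp only [ContinuousLinearMap.apply_apply]
    rw [FormalMultilinearSeries.apply_eq_pow_smul_coeff]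
    simp [this, kcoeff]
    ring
  have h4 := h3.unique ((hasSum_regularizedHGFun (a + 1) (b + 1) z).mul_left a)
  rw [← h4]
  exact hd.hasDerivAt

theorem kcoeff_contiguous (a b : ℂ) (hb : ∀ n : ℕ, b ≠ -n) (n : ℕ) :
    kcoeff a b (n + 1) = (b + (n + 1)) * kcoeff (a + 1) (b + 1) (n + 1)
      - kcoeff (a + 1) (b + 1) n := by
  have h1 : (ascPochhammer ℂ (n + 1)).eval a = a * (ascPochhammer ℂ n).eval (a + 1) := by
    simp [ascPochhammer_succ_left]
  have h2 : b + ((n + 1 : ℕ) : ℂ) = b + 1 + n := by push_cast; ring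
  have h3 : (n : ℂ) + 1 ≠ 0 := by exact_mod_cast n.succ_ne_zero
  have h4 : b + 1 + n ≠ 0 := by
    intro h; apply hb (n + 1); push_cast; linear_combination h
  have h5 : Gamma (b + 1 + ((n + 1 : ℕ) : ℂ)) = (b + 1 + n) * Gamma (b + 1 + n) := by
    rw [← Gamma_add_one _ h4]; push_cast; ring_nf
  have h6 : Gamma (b + 1 + n) ≠ 0 := by
    apply Gamma_ne_zero; intro m h
    apply hb (m + n + 1); push_cast; linear_combination h
  rw [kcoeff_eq, kcoeff_eq, kcoeff_eq, h1, h2, h5, Nat.factorial_succ, ascPochhammer_succ_eval]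
  have h7 : b + (n + 1) = b + 1 + (n : ℂ) := by ring
  rw [h7]
  have h8 : (n ! : ℂ) ≠ 0 := by exact_mod_cast n.factorial_ne_zero
  push_cast
  field_simp
  ring

/-- This is Kummer's differential equation with the common factor `a` removed, since differentiation
raises both parameters by one. It serves twice: as the equation of the profile and to lower the
parameters in `kummer_eq_coulombH`. -/
theorem regularizedHGFun_contiguous (a b z : ℂ) (hb : ∀ n : ℕ, b ≠ -n) :
    regularizedHGFun {a} {b} z = (b - z) * regularizedHGFun {a + 1} {b + 1} z
      + z * ((a + 1) * regularizedHGFun {a + 1 + 1} {b + 1 + 1} z) := by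
  have s0 := (hasSum_nat_add_iff' 1).mpr (hasSum_regularizedHGFun a b z)
  have s1 := (hasSum_nat_add_iff' 1).mpr (hasSum_regularizedHGFun (a + 1) (b + 1) z)
  have s1' := hasSum_regularizedHGFun (a + 1) (b + 1) z
  have s2 := hasSum_regularizedHGFun (a + 1 + 1) (b + 1 + 1) z
  have h := ((s1.mul_left b).sub (s1'.mul_left z)).add (s2.mul_left (z * (a + 1)))
  have h0 : kcoeff a b 0 = b * kcoeff (a + 1) (b + 1) 0 := by
    have hb0 : b ≠ 0 := by simpa using hb 0
    rw [kcoeff_eq, kcoeff_eq]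
    simp [Gamma_add_one b hb0]
    field_simp
  have h' := s0.unique (h.congr_fun fun n ↦ ?_)
  · simp only [Finset.range_one, Finset.sum_singleton, pow_zero, mul_one] at h'
    linear_combination h' + h0
  · have := succ_mul_kcoeff_succ (a + 1) (b + 1) n
    rw [kcoeff_contiguous a b hb]
    linear_combination (z ^ (n + 1)) * this
end DiracCoulomb

namespace DiracCoulomb

open Complex Filter Topology Set MeasureTheory

/-! ### The real profile of the Coulomb wave function -/

/-- `h` is a solution on `[0, ∞)`, regular at the origin and with derivative `h'`, of
`ρ h'' + (2γ + 2) h' + (ρ + 2a) h = 0`. -/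
structure IsCoulombProfile (γ a : ℝ) (h h' : ℝ → ℝ) : Prop where
  hasDerivAt : ∀ ρ, HasDerivAt h (h' ρ) ρ
  hasDerivAt' : ∀ ρ, 0 < ρ → HasDerivAt h' (-((2 * γ + 2) * h' ρ + (ρ + 2 * a) * h ρ) / ρ) ρ
  continuous' : Continuous h'

namespace IsCoulombProfile

variable {γ a : ℝ} {h h' : ℝ → ℝ}

theorem continuous (H : IsCoulombProfile γ a h h') : Continuous h :=
  continuous_iff_continuousAt.mpr fun ρ ↦ (H.hasDerivAt ρ).continuousAt

/-- Dividing the kinetic term by `ρ + 2a` gives `h²` the coefficient one, so the initial value does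
not see `a`. The energy decreases because the damping `4γ + 4` exceeds `2a/(ρ + 2a) ≤ 1`, the
contribution of the weight. -/
theorem energy_le (H : IsCoulombProfile γ a h h') (hγ : 0 ≤ γ) (ha : 0 < a) {ρ : ℝ} (hρ : 0 ≤ ρ) :
    h ρ ^ 2 + ρ * h' ρ ^ 2 / (ρ + 2 * a) ≤ h 0 ^ 2 := by
  have hanti : AntitoneOn (fun ρ ↦ h ρ ^ 2 + ρ * h' ρ ^ 2 / (ρ + 2 * a)) (Ici 0) := by
    have hd : ∀ x ∈ interior (Ici (0 : ℝ)), HasDerivAt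
        (fun ρ ↦ h ρ ^ 2 + ρ * h' ρ ^ 2 / (ρ + 2 * a))
        (h' x ^ 2 * (2 * a / (x + 2 * a) - (4 * γ + 4)) / (x + 2 * a)) x := by
      intro x hx
      rw [interior_Ici] at hx
      have hx0 : 0 < x := hx
      have h1 := (H.hasDerivAt x).fun_pow 2
      have h2 := (H.hasDerivAt' x hx).fun_pow 2
      have h3 := ((hasDerivAt_id x).fun_mul h2).fun_div ((hasDerivAt_id x).add_const (2 * a))
        (by simp; positivity)
      refine (h1.fun_add h3).congr_deriv ?_
      simp only [id]
      field_simp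
      ring
    refine antitoneOn_of_deriv_nonpos (convex_Ici 0) ?_
      (fun x hx ↦ (hd x hx).differentiableAt.differentiableWithinAt) fun x hx ↦ ?_
    · have h1 := H.continuous
      have h2 := H.continuous'
      refine (h1.continuousOn.pow 2).add (ContinuousOn.div (by fun_prop) (by fun_prop) ?_)
      intro x hx
      have : 0 ≤ x := hx
      positivity
    · rw [(hd x hx).deriv]
      rw [interior_Ici] at hx
      have hx0 : 0 < x := hx
      have : 2 * a / (x + 2 * a) ≤ 1 := by rw [div_le_one (by positivity)]; linarith
      refine div_nonpos_of_nonpos_of_nonneg (mul_nonpos_of_nonneg_of_nonpos (by positivity) ?_)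
        (by positivity)
      linarith
  simpa using hanti (mem_Ici.mpr le_rfl) (mem_Ici.mpr hρ) hρ

theorem abs_le (H : IsCoulombProfile γ a h h') (hγ : 0 ≤ γ) (ha : 0 < a) {ρ : ℝ} (hρ : 0 ≤ ρ) :
    |h ρ| ≤ |h 0| := by
  rw [← sq_le_sq]
  have := H.energy_le hγ ha hρ
  have : 0 ≤ ρ * h' ρ ^ 2 / (ρ + 2 * a) := by positivity
  linarith

theorem abs_mul_deriv_le (H : IsCoulombProfile γ a h h') (hγ : 0 ≤ γ) (ha : 0 < a) {ρ : ℝ}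
    (hρ : 0 ≤ ρ) : |ρ * h' ρ| ≤ (ρ + a) * |h 0| := by
  refine abs_le_of_sq_le_sq ?_ (by positivity)
  have h1 := H.energy_le hγ ha hρ
  have h2 : ρ * h' ρ ^ 2 ≤ h 0 ^ 2 * (ρ + 2 * a) := by
    rw [← div_le_iff₀ (by positivity)]
    nlinarith [sq_nonneg (h ρ)]
  -- The energy gives `(ρh')² ≤ (ρ² + 2aρ) h(0)²`; completing the square adds `a² h(0)²`.
  rw [mul_pow, mul_pow, sq_abs]
  nlinarith [mul_le_mul_of_nonneg_left h2 hρ, mul_nonneg (sq_nonneg a) (sq_nonneg (h 0))]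

end IsCoulombProfile

/-! ### The profile as a confluent hypergeometric function. -/

/-- The function `e^{-iρ} ₁F₁(γ + 1 + ia; 2γ + 2; 2iρ)`. -/
noncomputable def coulombC (γ a ρ : ℝ) : ℂ :=
  exp (-(I * ρ)) * (Gamma (2 * γ + 2) *
    regularizedHGFun {(γ : ℂ) + 1 + I * a} {2 * (γ : ℂ) + 2} (2 * I * ρ))

/-- The derivative of `coulombC`. -/
noncomputable def coulombC' (γ a ρ : ℝ) : ℂ :=
  exp (-(I * ρ)) * (Gamma (2 * γ + 2) *
    (2 * I * ((γ + 1 + I * a) *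
      regularizedHGFun {(γ : ℂ) + 1 + I * a + 1} {2 * (γ : ℂ) + 2 + 1} (2 * I * ρ))
      - I * regularizedHGFun {(γ : ℂ) + 1 + I * a} {2 * (γ : ℂ) + 2} (2 * I * ρ)))

theorem hasDerivAt_exp_neg_I_mul (ρ : ℝ) :
    HasDerivAt (fun ρ : ℝ ↦ exp (-(I * ρ))) (exp (-(I * ρ)) * -I) ρ := by
  have h1 : HasDerivAt (fun ρ : ℝ ↦ -(I * (ρ : ℂ))) (-I) ρ := by
    simpa using ((hasDerivAt_id ρ).ofReal_comp.const_mul I).fun_neg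
  exact h1.cexp

theorem hasDerivAt_regularizedHGFun_two_I_mul (a b : ℂ) (ρ : ℝ) :
    HasDerivAt (fun ρ : ℝ ↦ regularizedHGFun {a} {b} (2 * I * ρ))
      (a * regularizedHGFun {a + 1} {b + 1} (2 * I * ρ) * (2 * I)) ρ := by
  have h1 : HasDerivAt (fun ρ : ℝ ↦ 2 * I * (ρ : ℂ)) (2 * I) ρ := by
    simpa using (hasDerivAt_id ρ).ofReal_comp.const_mul (2 * I)
  exact (hasDerivAt_regularizedHGFun a b (2 * I * ρ)).comp ρ h1

theorem two_mul_add_ne_neg_nat {γ : ℝ} (hγ : 0 ≤ γ) {s : ℝ} (hs : 0 < s) (n : ℕ) :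
    2 * (γ : ℂ) + s ≠ -n := by
  intro h
  have := congrArg re h
  simp at this
  have h2 : (0 : ℝ) ≤ n := n.cast_nonneg
  linarith

theorem hasDerivAt_coulombC (γ a ρ : ℝ) :
    HasDerivAt (coulombC γ a) (coulombC' γ a ρ) ρ := by
  refine ((hasDerivAt_exp_neg_I_mul ρ).fun_mul
    ((hasDerivAt_regularizedHGFun_two_I_mul _ _ ρ).const_mul _)).congr_deriv ?_
  rw [coulombC']
  ring

theorem hasDerivAt_coulombC' {γ a ρ : ℝ} (hγ : 0 ≤ γ) (hρ : 0 < ρ) :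
    HasDerivAt (coulombC' γ a)
      (-((2 * γ + 2) * coulombC' γ a ρ + (ρ + 2 * a) * coulombC γ a ρ) / ρ) ρ := by
  refine ((hasDerivAt_exp_neg_I_mul ρ).fun_mul
    (((((hasDerivAt_regularizedHGFun_two_I_mul _ _ ρ).const_mul _).const_mul _).fun_sub
    ((hasDerivAt_regularizedHGFun_two_I_mul _ _ ρ).const_mul _)).const_mul _)).congr_deriv ?_
  -- At these parameters the contiguous relation is the second-order equation, conjugated by
  -- `e^{-iρ}`.
  have h := regularizedHGFun_contiguous ((γ : ℂ) + 1 + I * a) (2 * (γ : ℂ) + 2) (2 * I * ρ)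
    (by exact_mod_cast two_mul_add_ne_neg_nat hγ two_pos)
  have hρ' : (ρ : ℂ) ≠ 0 := by exact_mod_cast hρ.ne'
  rw [coulombC, coulombC', eq_div_iff hρ']
  linear_combination (-(2 * I) * exp (-(I * ρ)) * Gamma (2 * γ + 2) * (γ + 1 + I * a)) * h +
    (exp (-(I * ρ)) * Gamma (2 * γ + 2) * regularizedHGFun {(γ : ℂ) + 1 + I * a} {2 * (γ : ℂ) + 2} (2 * I * ρ) *
      (ρ + 2 * a)) * I_sq 

theorem coulombC_zero {γ a : ℝ} (hγ : 0 ≤ γ) : coulombC γ a 0 = 1 := by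
  have h := two_mul_add_ne_neg_nat hγ two_pos
  push_cast at h
  have h0 := (hasSum_regularizedHGFun ((γ : ℂ) + 1 + I * a) (2 * (γ : ℂ) + 2) 0).unique
    (hasSum_single 0 (by simp +contextual))
  rw [coulombC]
  simp only [ofReal_zero, mul_zero, neg_zero, exp_zero, one_mul]
  rw [h0, kcoeff_eq]
  simp [Gamma_ne_zero h]

theorem continuous_coulombC' (γ a : ℝ) : Continuous (coulombC' γ a) := by
  have h : ∀ a b : ℂ, Continuous fun ρ : ℝ ↦ regularizedHGFun {a} {b} (2 * I * ρ) := fun a b ↦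
    continuous_iff_continuousAt.mpr fun ρ ↦
      (hasDerivAt_regularizedHGFun_two_I_mul a b ρ).continuousAt
  have h1 := h ((γ : ℂ) + 1 + I * a + 1) (2 * (γ : ℂ) + 2 + 1)
  have h2 := h ((γ : ℂ) + 1 + I * a) (2 * (γ : ℂ) + 2)
  unfold coulombC'
  fun_prop

/-- The real part of `coulombC`; the imaginary part vanishes. -/
noncomputable def coulombH (γ a ρ : ℝ) : ℝ := (coulombC γ a ρ).re

/-- The derivative of `coulombH`. -/
noncomputable def coulombH' (γ a ρ : ℝ) : ℝ := (coulombC' γ a ρ).re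

theorem isCoulombProfile_re {γ : ℝ} (a : ℝ) (hγ : 0 ≤ γ) :
    IsCoulombProfile γ a (coulombH γ a) (coulombH' γ a) where
  hasDerivAt ρ := (reCLM.hasFDerivAt.comp_hasDerivAt ρ (hasDerivAt_coulombC γ a ρ))
  hasDerivAt' ρ hρ := by
    refine (reCLM.hasFDerivAt.comp_hasDerivAt ρ (hasDerivAt_coulombC' hγ hρ)).congr_deriv ?_
    rw [reCLM_apply, div_ofReal_re, coulombH, coulombH']
    simp
  continuous' := continuous_re.comp (continuous_coulombC' γ a)

theorem isCoulombProfile_im {γ : ℝ} (a : ℝ) (hγ : 0 ≤ γ) :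
    IsCoulombProfile γ a (fun ρ ↦ (coulombC γ a ρ).im) (fun ρ ↦ (coulombC' γ a ρ).im) where
  hasDerivAt ρ := (imCLM.hasFDerivAt.comp_hasDerivAt ρ (hasDerivAt_coulombC γ a ρ))
  hasDerivAt' ρ hρ := by
    refine (imCLM.hasFDerivAt.comp_hasDerivAt ρ (hasDerivAt_coulombC' hγ hρ)).congr_deriv ?_
    rw [imCLM_apply, div_ofReal_im]
    simp
  continuous' := continuous_im.comp (continuous_coulombC' γ a)

theorem coulombH_zero {γ : ℝ} (a : ℝ) (hγ : 0 ≤ γ) : coulombH γ a 0 = 1 := by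
  rw [coulombH, coulombC_zero hγ, one_re]

/-- The imaginary part solves the same real equation and vanishes at the origin, so the energy bound
makes it zero. This replaces Kummer's transformation. -/
theorem coulombC_eq {γ a ρ : ℝ} (hγ : 0 ≤ γ) (ha : 0 < a) (hρ : 0 ≤ ρ) :
    coulombC γ a ρ = coulombH γ a ρ := by
  have h := (isCoulombProfile_im a hγ).abs_le hγ ha hρ
  simp only [coulombC_zero hγ, one_im, abs_zero, abs_nonpos_iff] at h
  apply Complex.ext <;> simp [coulombH, h]

theorem coulombC'_eq {γ a ρ : ℝ} (hγ : 0 ≤ γ) (ha : 0 < a) (hρ : 0 < ρ) :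
    coulombC' γ a ρ = coulombH' γ a ρ := by
  have h := (isCoulombProfile_im a hγ).abs_mul_deriv_le hγ ha hρ.le
  simp only [coulombC_zero hγ, one_im, abs_zero, mul_zero, abs_nonpos_iff, mul_eq_zero,
    hρ.ne', false_or] at h
  apply Complex.ext <;> simp [coulombH', h]

/-- The contiguous relation writes `₁F₁(γ+ia; 2γ+1)` through the two functions with raised
parameters, and these are `h` and `h'` up to `e^{iρ}`. From here on `Φ` involves only a real
solution and its derivative. -/
theorem kummer_eq_coulombH {γ a ρ : ℝ} (hγ : 0 ≤ γ) (ha : 0 < a) (hρ : 0 < ρ) :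
    kummer (γ + I * a) (2 * γ + 1) (2 * I * ρ) = exp (I * ρ) / (2 * γ + 1) *
      (ρ * coulombH' γ a ρ + (2 * γ + 1) * coulombH γ a ρ - I * ρ * coulombH γ a ρ) := by
  have h0 := two_mul_add_ne_neg_nat hγ one_pos
  push_cast at h0
  have h1 : 2 * (γ : ℂ) + 1 ≠ 0 := by simpa using h0 0
  have h := regularizedHGFun_contiguous ((γ : ℂ) + I * a) (2 * (γ : ℂ) + 1) (2 * I * ρ) h0
  have hG : Gamma (2 * (γ : ℂ) + 2) = (2 * γ + 1) * Gamma (2 * γ + 1) := by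
    rw [← Gamma_add_one _ h1]; ring_nf
  have hE : exp (I * ρ) * exp (-(I * ρ)) = 1 := by rw [← exp_add]; simp
  rw [show (γ : ℂ) + I * a + 1 = γ + 1 + I * a by ring,
    show 2 * (γ : ℂ) + 1 + 1 = 2 * γ + 2 by ring] at h
  rw [kummer, h, ← coulombC_eq hγ ha hρ.le, ← coulombC'_eq hγ ha hρ, coulombC, coulombC', hG]
  rw [eq_comm, div_mul_eq_mul_div, div_eq_iff h1]
  generalize regularizedHGFun {(γ : ℂ) + 1 + I * a} {2 * (γ : ℂ) + 2} (2 * I * ρ) = R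
  generalize regularizedHGFun {(γ : ℂ) + 1 + I * a + 1} {2 * (γ : ℂ) + 2 + 1} (2 * I * ρ) = R'
  linear_combination ((2 * γ + 1) * Gamma (2 * γ + 1) *
    ((2 * γ + 1 - 2 * I * ρ) * R + 2 * I * ρ * ((γ + 1 + I * a) * R'))) * hE

end DiracCoulomb

namespace DiracCoulomb

open Complex Filter Topology Set MeasureTheory

/-! ### Amplitude bounds for a normalised Coulomb pair -/

/-- `D(ρ) = ρ² + 2aρ - l²`. -/
def disc (l a ρ : ℝ) : ℝ := ρ ^ 2 + 2 * a * ρ - l ^ 2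

/-- The pair `u`, `w = ρ u'` solves `ρ (ρ u')' + D u = 0`, is regular at the origin and has unit
amplitude at infinity. -/
structure IsCoulombPair (l a : ℝ) (u w : ℝ → ℝ) : Prop where
  hasDerivAt_fst : ∀ ρ, 0 < ρ → HasDerivAt u (w ρ / ρ) ρ
  hasDerivAt_snd : ∀ ρ, 0 < ρ → HasDerivAt w (-(disc l a ρ * u ρ) / ρ) ρ
  tendsto_fst : Tendsto u (𝓝[>] 0) (𝓝 0)
  tendsto_snd : Tendsto w (𝓝[>] 0) (𝓝 0)
  tendsto_atTop : Tendsto (fun ρ ↦ ρ * u ρ ^ 2 + w ρ ^ 2 / ρ) atTop (𝓝 1)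

/-! ### The WKB energy on the oscillating side. -/

theorem hasDerivAt_disc (l a ρ : ℝ) : HasDerivAt (disc l a) (2 * (ρ + a)) ρ := by
  have h := (((hasDerivAt_id ρ).fun_pow 2).fun_add ((hasDerivAt_id ρ).const_mul (2 * a))).sub_const
    (l ^ 2)
  refine h.congr_deriv ?_
  simp only [id]
  push_cast
  ring

theorem disc_mono {l a x y : ℝ} (ha : 0 ≤ a) (hx : 0 ≤ x) (hxy : x ≤ y) :
    disc l a x ≤ disc l a y := by
  unfold disc
  nlinarith [mul_le_mul_of_nonneg_left hxy ha, mul_le_mul hxy hxy hx (hx.trans hxy)]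

/-- The coefficient `D'ρ / (2 D^{3/2})` of the mixed term in the WKB energy. -/
noncomputable def wkbCoeff (l a ρ : ℝ) : ℝ := ρ * (ρ + a) / √(disc l a ρ) ^ 3

theorem hasDerivAt_sqrt_disc {l a ρ : ℝ} (hD : 0 < disc l a ρ) :
    HasDerivAt (fun ρ ↦ √(disc l a ρ)) ((ρ + a) / √(disc l a ρ)) ρ := by
  refine ((hasDerivAt_disc l a ρ).sqrt hD.ne').congr_deriv ?_
  have := Real.sqrt_pos.mpr hD
  field_simp

theorem hasDerivAt_wkbCoeff {l a ρ : ℝ} (hD : 0 < disc l a ρ) :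
    HasDerivAt (wkbCoeff l a) (-(ρ ^ 3 + a * ρ ^ 2 + a ^ 2 * ρ + 2 * l ^ 2 * ρ + a * l ^ 2) /
      √(disc l a ρ) ^ 5) ρ := by
  have hs := Real.sqrt_pos.mpr hD
  have h := ((hasDerivAt_id ρ).fun_mul ((hasDerivAt_id ρ).add_const a)).fun_div
    ((hasDerivAt_sqrt_disc hD).fun_pow 3) (by positivity)
  refine h.congr_deriv ?_
  have h2 : √(disc l a ρ) ^ 2 = ρ ^ 2 + 2 * a * ρ - l ^ 2 := Real.sq_sqrt hD.le
  simp only [id]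
  generalize √(disc l a ρ) = s at *
  field_simp
  push_cast
  linear_combination (2 * ρ + a) * s ^ 2 * h2

/-- The WKB energy. -/
noncomputable def wkbEnergy (l a : ℝ) (u w : ℝ → ℝ) (ρ : ℝ) : ℝ :=
  √(disc l a ρ) * u ρ ^ 2 + w ρ ^ 2 / √(disc l a ρ) + wkbCoeff l a ρ * (u ρ * w ρ)

namespace IsCoulombPair

variable {l a : ℝ} {u w : ℝ → ℝ}

/-- Write `c` for the WKB coefficient, `S` for the two squares and `E = S + c u w`. The mixed term
is chosen so that the derivatives of `√D` cancel, leaving `E' = c' u w`. Hence `((2-c)E)' = -c' (S -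
2(1-c) u w)`, which is nonnegative when `c' ≤ 0` and `0 ≤ c ≤ 1`, because `S ≥ 2|u w|`. -/
theorem hasDerivAt_wkbEnergy (H : IsCoulombPair l a u w) {ρ : ℝ} (hρ : 0 < ρ)
    (hD : 0 < disc l a ρ) :
    HasDerivAt (fun ρ ↦ (2 - wkbCoeff l a ρ) * wkbEnergy l a u w ρ)
      ((ρ ^ 3 + a * ρ ^ 2 + a ^ 2 * ρ + 2 * l ^ 2 * ρ + a * l ^ 2) / √(disc l a ρ) ^ 5 *
        (√(disc l a ρ) * u ρ ^ 2 + w ρ ^ 2 / √(disc l a ρ) -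
          2 * (1 - wkbCoeff l a ρ) * (u ρ * w ρ))) ρ := by
  have hs := Real.sqrt_pos.mpr hD
  have h1 := H.hasDerivAt_fst ρ hρ
  have h2 := H.hasDerivAt_snd ρ hρ
  have hc := hasDerivAt_wkbCoeff hD
  have h3 := (((hasDerivAt_sqrt_disc hD).fun_mul (h1.fun_pow 2)).fun_add ((h2.fun_pow 2).fun_div
    (hasDerivAt_sqrt_disc hD) hs.ne')).fun_add (hc.fun_mul (h1.fun_mul h2))
  have h4 := (hc.const_sub 2).fun_mul h3
  refine h4.congr_deriv ?_
  have h5 : disc l a ρ = √(disc l a ρ) ^ 2 := (Real.sq_sqrt hD.le).symm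
  have h6 : wkbCoeff l a ρ = ρ * (ρ + a) / √(disc l a ρ) ^ 3 := rfl
  rw [show -(disc l a ρ * u ρ) / ρ = -(√(disc l a ρ) ^ 2 * u ρ) / ρ by rw [← h5]]
  generalize √(disc l a ρ) = s at *
  rw [h6]
  push_cast
  field_simp
  ring

theorem tendsto_sqrt_disc_div (l a : ℝ) :
    Tendsto (fun ρ ↦ √(disc l a ρ) / ρ) atTop (𝓝 1) := by
  have h1 : Tendsto (fun ρ : ℝ ↦ √(1 + 2 * a * ρ⁻¹ - l ^ 2 * ρ⁻¹ ^ 2)) atTop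
      (𝓝 (√(1 + 2 * a * 0 - l ^ 2 * 0 ^ 2))) :=
    ((tendsto_const_nhds.add (tendsto_inv_atTop_zero.const_mul _)).sub
      ((tendsto_inv_atTop_zero.pow 2).const_mul _)).sqrt
  norm_num at h1
  refine h1.congr' ?_
  filter_upwards [eventually_gt_atTop 0] with ρ hρ
  rw [disc, show ρ ^ 2 + 2 * a * ρ - l ^ 2 = ρ ^ 2 * (1 + 2 * a * ρ⁻¹ - l ^ 2 * (ρ ^ 2)⁻¹) by
    field_simp, Real.sqrt_mul (by positivity), Real.sqrt_sq hρ.le]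
  field_simp

theorem tendsto_wkbCoeff (l a : ℝ) : Tendsto (wkbCoeff l a) atTop (𝓝 0) := by
  have h1 : Tendsto (fun ρ : ℝ ↦ ρ⁻¹ * (1 + a * ρ⁻¹) * ((√(disc l a ρ) / ρ) ^ 3)⁻¹) atTop
      (𝓝 (0 * (1 + a * 0) * (1 ^ 3)⁻¹)) :=
    (tendsto_inv_atTop_zero.mul (tendsto_const_nhds.add (tendsto_inv_atTop_zero.const_mul _))).mul
      (((tendsto_sqrt_disc_div l a).pow 3).inv₀ (by norm_num))
  rw [zero_mul, zero_mul] at h1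
  refine h1.congr' ?_
  filter_upwards [eventually_gt_atTop 0] with ρ hρ
  rw [wkbCoeff, div_pow]
  field_simp

theorem tendsto_wkbEnergy (H : IsCoulombPair l a u w) :
    Tendsto (fun ρ ↦ (2 - wkbCoeff l a ρ) * wkbEnergy l a u w ρ) atTop (𝓝 2) := by
  have hq := tendsto_sqrt_disc_div l a
  have hc := tendsto_wkbCoeff l a
  have hlim := H.tendsto_atTop
  have hE : Tendsto (wkbEnergy l a u w) atTop (𝓝 1) := by
    -- `E` differs from `ρu² + w²/ρ` by factors that tend to zero because `√D/ρ → 1` and `c → 0`.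
    have hz : Tendsto (fun ρ ↦ (|√(disc l a ρ) / ρ - 1| + |(√(disc l a ρ) / ρ)⁻¹ - 1| +
        |wkbCoeff l a ρ|) * (ρ * u ρ ^ 2 + w ρ ^ 2 / ρ)) atTop (𝓝 0) := by
      have h := ((((hq.sub_const 1).abs.add ((hq.inv₀ one_ne_zero).sub_const 1).abs)).add
        hc.abs).mul hlim
      simpa using h
    have hd : Tendsto (fun ρ ↦ wkbEnergy l a u w ρ - (ρ * u ρ ^ 2 + w ρ ^ 2 / ρ)) atTop (𝓝 0) := by
      refine squeeze_zero_norm' ?_ hz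
      filter_upwards [eventually_gt_atTop 0, hq.eventually (lt_mem_nhds zero_lt_one)] with ρ hρ hq0
      have e : wkbEnergy l a u w ρ - (ρ * u ρ ^ 2 + w ρ ^ 2 / ρ) =
          (√(disc l a ρ) / ρ - 1) * (ρ * u ρ ^ 2) + ((√(disc l a ρ) / ρ)⁻¹ - 1) * (w ρ ^ 2 / ρ) +
          wkbCoeff l a ρ * (u ρ * w ρ) := by
        rw [wkbEnergy]
        have : √(disc l a ρ) ≠ 0 := fun h ↦ by simp [h] at hq0
        field_simp
        ring
      have hA : 0 ≤ ρ * u ρ ^ 2 := by positivity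
      have hB : 0 ≤ w ρ ^ 2 / ρ := by positivity
      have hAB : |u ρ * w ρ| ≤ ρ * u ρ ^ 2 + w ρ ^ 2 / ρ := by
        have h1 : (ρ * u ρ ^ 2) * (w ρ ^ 2 / ρ) = (u ρ * w ρ) ^ 2 := by field_simp
        refine abs_le_of_sq_le_sq ?_ (by positivity)
        nlinarith
      rw [e, Real.norm_eq_abs]
      refine (abs_add_le _ _).trans ((add_le_add_left (abs_add_le _ _) _).trans ?_)
      rw [abs_mul _ (ρ * u ρ ^ 2), abs_mul _ (w ρ ^ 2 / ρ), abs_mul _ (u ρ * w ρ), abs_of_nonneg hA, abs_of_nonneg hB, add_mul, add_mul]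
      gcongr <;> linarith
    simpa using hd.add hlim
  simpa using (hc.const_sub 2).mul hE

/-- The coefficient decreases, so `c ≤ 1` persists to the right and `(2-c)E` increases to its limit
2. Since `|u w| ≤ S/2`, one has `E ≥ S/2`, and `2 - c ≥ 1` then gives `S ≤ 4`. -/
theorem wkb_bound (H : IsCoulombPair l a u w) (ha : 0 ≤ a) {ρ : ℝ} (hρ : 0 < ρ)
    (hD : 0 < disc l a ρ) (hc : wkbCoeff l a ρ ≤ 1) :
    √(disc l a ρ) * u ρ ^ 2 + w ρ ^ 2 / √(disc l a ρ) ≤ 4 := by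
  have hpos : ∀ x ∈ Ici ρ, 0 < x ∧ 0 < disc l a x := fun x hx ↦
    ⟨hρ.trans_le hx, hD.trans_le (disc_mono ha hρ.le hx)⟩
  have hcanti : AntitoneOn (wkbCoeff l a) (Ici ρ) := by
    refine antitoneOn_of_deriv_nonpos (convex_Ici ρ)
      (fun x hx ↦ (hasDerivAt_wkbCoeff (hpos x hx).2).continuousAt.continuousWithinAt) ?_ ?_
    · intro x hx
      exact (hasDerivAt_wkbCoeff (hpos x (interior_subset hx)).2).differentiableAt.differentiableWithinAt
    · intro x hx
      obtain ⟨hx0, hxD⟩ := hpos x (interior_subset hx)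
      rw [(hasDerivAt_wkbCoeff hxD).deriv, neg_div]
      exact neg_nonpos.mpr (by positivity)
  have hmono : MonotoneOn (fun ρ ↦ (2 - wkbCoeff l a ρ) * wkbEnergy l a u w ρ) (Ici ρ) := by
    have hd := fun x (hx : x ∈ Ici ρ) ↦ H.hasDerivAt_wkbEnergy (hpos x hx).1 (hpos x hx).2
    refine monotoneOn_of_deriv_nonneg (convex_Ici ρ)
      (fun x hx ↦ (hd x hx).continuousAt.continuousWithinAt)
      (fun x hx ↦ (hd x (interior_subset hx)).differentiableAt.differentiableWithinAt) ?_
    intro x hx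
    obtain ⟨hx0, hxD⟩ := hpos x (interior_subset hx)
    have hs := Real.sqrt_pos.mpr hxD
    rw [(hd x (interior_subset hx)).deriv]
    refine mul_nonneg (by positivity) ?_
    have h1 : wkbCoeff l a x ≤ 1 := (hcanti self_mem_Ici (interior_subset hx)
      (interior_subset hx)).trans hc
    have h0 : 0 ≤ wkbCoeff l a x := by unfold wkbCoeff; positivity
    have h2 : 0 ≤ √(disc l a x) * u x ^ 2 + w x ^ 2 / √(disc l a x) - 2 * (u x * w x) := by
      have : √(disc l a x) * u x ^ 2 + w x ^ 2 / √(disc l a x) - 2 * (u x * w x) =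
        (√(disc l a x) * u x - w x) ^ 2 / √(disc l a x) := by field_simp; ring
      rw [this]; positivity
    have h3 : 0 ≤ √(disc l a x) * u x ^ 2 + w x ^ 2 / √(disc l a x) := by positivity
    nlinarith
  have hle : (2 - wkbCoeff l a ρ) * wkbEnergy l a u w ρ ≤ 2 := by
    refine ge_of_tendsto H.tendsto_wkbEnergy ?_
    filter_upwards [eventually_ge_atTop ρ] with x hx
    exact hmono self_mem_Ici hx hx
  have hs := Real.sqrt_pos.mpr hD
  have h0 : 0 ≤ wkbCoeff l a ρ := by unfold wkbCoeff; positivity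
  rw [wkbEnergy] at hle
  have h2 : 0 ≤ √(disc l a ρ) * u ρ ^ 2 + w ρ ^ 2 / √(disc l a ρ) + 2 * (u ρ * w ρ) := by
    have : √(disc l a ρ) * u ρ ^ 2 + w ρ ^ 2 / √(disc l a ρ) + 2 * (u ρ * w ρ) =
      (√(disc l a ρ) * u ρ + w ρ) ^ 2 / √(disc l a ρ) := by field_simp; ring
    rw [this]; positivity
  have h3 : 0 ≤ √(disc l a ρ) * u ρ ^ 2 + w ρ ^ 2 / √(disc l a ρ) := by positivity
  generalize √(disc l a ρ) * u ρ ^ 2 + w ρ ^ 2 / √(disc l a ρ) = S at *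
  generalize wkbCoeff l a ρ = c at *
  generalize u ρ * w ρ = p at *
  have h4 : S / 2 ≤ S + c * p := by nlinarith
  nlinarith

theorem wkbCoeff_le_one (ha : 0 ≤ a) {ρ s : ℝ} (hρ : 0 < ρ) (hs : 2 ≤ s) (hsl : 2 * l ^ 2 ≤ s ^ 3)
    (hD : s ^ 2 ≤ disc l a ρ) : wkbCoeff l a ρ ≤ 1 := by
  have hD0 : 0 < disc l a ρ := lt_of_lt_of_le (by positivity) hD
  have h1 : s ≤ √(disc l a ρ) := Real.le_sqrt_of_sq_le hD
  have h2 : √(disc l a ρ) ^ 2 = ρ ^ 2 + 2 * a * ρ - l ^ 2 := Real.sq_sqrt hD0.le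
  rw [wkbCoeff, div_le_one (by positivity)]
  generalize √(disc l a ρ) = t at *
  have h3 : s ^ 3 ≤ t ^ 3 := by gcongr
  -- `ρ(ρ+a) ≤ t² + l²`, where `t² ≤ t³/2` because `t ≥ 2`, and `l² ≤ s³/2 ≤ t³/2`.
  nlinarith [mul_nonneg ha hρ.le, mul_nonneg (sq_nonneg t) (by linarith : 0 ≤ t - 2)]

/-! ### Monotone quantities near and left of the turning point. -/

theorem monotoneOn_energy (H : IsCoulombPair l a u w) (ha : 0 ≤ a) :
    MonotoneOn (fun ρ ↦ w ρ ^ 2 + disc l a ρ * u ρ ^ 2) (Ioi 0) := by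
  have hd : ∀ x ∈ Ioi (0 : ℝ), HasDerivAt (fun ρ ↦ w ρ ^ 2 + disc l a ρ * u ρ ^ 2)
      (2 * (x + a) * u x ^ 2) x := by
    intro x hx
    have hx0 : 0 < x := hx
    refine (((H.hasDerivAt_snd x hx).fun_pow 2).fun_add ((hasDerivAt_disc l a x).fun_mul
      ((H.hasDerivAt_fst x hx).fun_pow 2))).congr_deriv ?_
    push_cast
    field_simp
    ring
  refine monotoneOn_of_deriv_nonneg (convex_Ioi 0)
    (fun x hx ↦ (hd x hx).continuousAt.continuousWithinAt)
    (fun x hx ↦ (hd x (interior_subset hx)).differentiableAt.differentiableWithinAt) fun x hx ↦ ?_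
  have hx0 : 0 < x := interior_subset hx
  rw [(hd x hx0).deriv]
  positivity

theorem energy_nonneg (H : IsCoulombPair l a u w) (ha : 0 ≤ a) {ρ : ℝ} (hρ : 0 < ρ) :
    0 ≤ w ρ ^ 2 + disc l a ρ * u ρ ^ 2 := by
  have h1 : Tendsto (disc l a) (𝓝[>] 0) (𝓝 (disc l a 0)) :=
    (hasDerivAt_disc l a 0).continuousAt.tendsto.mono_left nhdsWithin_le_nhds
  have h2 := (H.tendsto_snd.pow 2).add (h1.mul (H.tendsto_fst.pow 2))
  have h3 := le_of_tendsto h2 (b := w ρ ^ 2 + disc l a ρ * u ρ ^ 2) (by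
    filter_upwards [Ioc_mem_nhdsGT hρ] with x hx
    exact H.monotoneOn_energy ha hx.1 hρ hx.2)
  simpa using h3

/-- The derivative of `u w` is `(w² - Du²)/ρ`, so this product grows from its limit 0 at the origin
as long as `D ≤ 0`. Its sign then makes both `u²` and `w²` increasing there. -/
theorem mul_nonneg_of_disc_nonpos (H : IsCoulombPair l a u w) (ha : 0 ≤ a) {ρ : ℝ} (hρ : 0 < ρ)
    (hD : disc l a ρ ≤ 0) : 0 ≤ u ρ * w ρ := by
  have hmono : MonotoneOn (fun x ↦ u x * w x) (Ioc 0 ρ) := by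
    have hd := fun x (hx : x ∈ Ioc 0 ρ) ↦ (H.hasDerivAt_fst x hx.1).fun_mul
      (H.hasDerivAt_snd x hx.1)
    refine monotoneOn_of_deriv_nonneg (convex_Ioc 0 ρ)
      (fun x hx ↦ (hd x hx).continuousAt.continuousWithinAt)
      (fun x hx ↦ (hd x (interior_subset hx)).differentiableAt.differentiableWithinAt) fun x hx ↦ ?_
    obtain ⟨hx0, hx1⟩ := interior_subset hx
    rw [(hd x (interior_subset hx)).deriv]
    have hDx : disc l a x ≤ 0 := (disc_mono ha hx0.le hx1).trans hD
    have : w x / x * w x + u x * (-(disc l a x * u x) / x) =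
      (w x ^ 2 + -disc l a x * u x ^ 2) / x := by ring
    rw [this]
    have : 0 ≤ -disc l a x := by linarith
    positivity
  have h2 := H.tendsto_fst.mul H.tendsto_snd
  have h3 := le_of_tendsto h2 (b := u ρ * w ρ) (by
    filter_upwards [Ioc_mem_nhdsGT hρ] with x hx
    exact hmono hx ⟨hρ, le_rfl⟩ hx.2)
  simpa using h3

theorem monotoneOn_sq_fst (H : IsCoulombPair l a u w) (ha : 0 ≤ a) {ρ : ℝ}
    (hD : disc l a ρ ≤ 0) : MonotoneOn (fun x ↦ u x ^ 2) (Ioc 0 ρ) := by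
  have hd := fun x (hx : x ∈ Ioc 0 ρ) ↦ (H.hasDerivAt_fst x hx.1).fun_pow 2
  refine monotoneOn_of_deriv_nonneg (convex_Ioc 0 ρ)
    (fun x hx ↦ (hd x hx).continuousAt.continuousWithinAt)
    (fun x hx ↦ (hd x (interior_subset hx)).differentiableAt.differentiableWithinAt) fun x hx ↦ ?_
  obtain ⟨hx0, hx1⟩ := interior_subset hx
  rw [(hd x (interior_subset hx)).deriv]
  have h := H.mul_nonneg_of_disc_nonpos ha hx0 ((disc_mono ha hx0.le hx1).trans hD)
  have : ((2 : ℕ) : ℝ) * u x ^ (2 - 1) * (w x / x) = 2 * (u x * w x) / x := by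
    push_cast; ring
  rw [this]
  positivity

theorem monotoneOn_sq_snd (H : IsCoulombPair l a u w) (ha : 0 ≤ a) {ρ : ℝ}
    (hD : disc l a ρ ≤ 0) : MonotoneOn (fun x ↦ w x ^ 2) (Ioc 0 ρ) := by
  have hd := fun x (hx : x ∈ Ioc 0 ρ) ↦ (H.hasDerivAt_snd x hx.1).fun_pow 2
  refine monotoneOn_of_deriv_nonneg (convex_Ioc 0 ρ)
    (fun x hx ↦ (hd x hx).continuousAt.continuousWithinAt)
    (fun x hx ↦ (hd x (interior_subset hx)).differentiableAt.differentiableWithinAt) fun x hx ↦ ?_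
  obtain ⟨hx0, hx1⟩ := interior_subset hx
  rw [(hd x (interior_subset hx)).deriv]
  have hDx := (disc_mono ha hx0.le hx1).trans hD
  have h := H.mul_nonneg_of_disc_nonpos ha hx0 hDx
  have : ((2 : ℕ) : ℝ) * w x ^ (2 - 1) * (-(disc l a x * u x) / x) =
      2 * (-disc l a x) * (u x * w x) / x := by
    push_cast; ring
  rw [this]
  have : 0 ≤ -disc l a x := by linarith
  positivity

/-- On the left of the point `ρ₁` with `D(ρ₁) = s²`. -/
theorem bound_of_disc_le (H : IsCoulombPair l a u w) (ha : 0 ≤ a) (hl : 0 < l) {ρ s : ℝ}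
    (hρ : 0 < ρ) (hs : 2 ≤ s) (hsl : s ^ 3 = 4 * l ^ 2) (hD : disc l a ρ ≤ s ^ 2) :
    s * u ρ ^ 2 ≤ 100 ∧ w ρ ^ 2 ≤ 4 * s := by
  have hs0 : 0 < s := by linarith
  -- The level sets of `D` are explicit: `t` is the turning point `D = 0`, and `r` is the matching
  -- point `D = s²` where the WKB bound stops.
  have hdisc : ∀ c, 0 ≤ c → disc l a (√(a ^ 2 + l ^ 2 + c) - a) = c := by
    intro c hc
    have h := Real.sq_sqrt (by positivity : 0 ≤ a ^ 2 + l ^ 2 + c)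
    rw [disc]; linear_combination h
  set t := √(a ^ 2 + l ^ 2 + 0) - a with ht
  set r := √(a ^ 2 + l ^ 2 + s ^ 2) - a with hr
  have hDt : disc l a t = 0 := hdisc 0 le_rfl
  have hDr : disc l a r = s ^ 2 := hdisc (s ^ 2) (by positivity)
  have ht0 : 0 < t := by
    rw [ht, sub_pos]
    exact Real.lt_sqrt_of_sq_lt (by nlinarith [sq_pos_of_pos hl])
  have htr : t ≤ r := by
    rw [ht, hr]; gcongr; positivity
  have hr0 : 0 < r := ht0.trans_le htr
  have hρr : ρ ≤ r := by
    by_contra! hlt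
    have : disc l a r < disc l a ρ := by
      unfold disc; nlinarith [mul_le_mul_of_nonneg_left hlt.le ha]
    linarith
  have hwkb := H.wkb_bound ha hr0 (by rw [hDr]; positivity)
    (wkbCoeff_le_one ha hr0 hs (by linarith [sq_nonneg l]) hDr.ge)
  rw [hDr, Real.sqrt_sq hs0.le] at hwkb
  have hur : s * u r ^ 2 ≤ 4 := by
    have : 0 ≤ w r ^ 2 / s := by positivity
    linarith
  have hE : ∀ x, 0 < x → x ≤ r → w x ^ 2 + disc l a x * u x ^ 2 ≤ 4 * s := by
    intro x hx hxr
    refine (H.monotoneOn_energy ha hx hr0 hxr).trans ?_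
    have h1 := mul_le_mul_of_nonneg_left hwkb hs0.le
    have h2 : s * (s * u r ^ 2 + w r ^ 2 / s) = w r ^ 2 + s ^ 2 * u r ^ 2 := by field_simp; ring
    simp only [hDr]
    linarith
  have hw : ∀ x ∈ Icc t r, w x ^ 2 ≤ 4 * s := by
    intro x hx
    have hx0 := ht0.trans_le hx.1
    have h1 := hE x hx0 hx.2
    have h2 := disc_mono (l := l) ha ht0.le hx.1
    have : 0 ≤ disc l a x * u x ^ 2 := mul_nonneg (hDt ▸ h2) (sq_nonneg _)
    linarith
  -- Between the turning and matching points `ρ` varies by at most the fraction `4/s`, so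
  -- integrating `u' = w/ρ` with `|w| ≤ 2√s` changes `u` by at most `8/√s`. Here the 4 in `s³ = 4l²`
  -- enters.
  have hgap : (r - t) * s ≤ 4 * t := by
    have h1 : (r - t) * (r + t + 2 * a) = s ^ 2 := by
      rw [disc] at hDt hDr; linear_combination hDr - hDt
    have h2 : t * (t + 2 * a) = l ^ 2 := by rw [disc] at hDt; linear_combination hDt
    have h3 : (r - t) * (t + 2 * a) ≤ s ^ 2 := by
      rw [← h1]
      exact mul_le_mul_of_nonneg_left (by linarith) (by linarith)
    have h4 : (r - t) * l ^ 2 ≤ t * s ^ 2 := by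
      rw [← h2]; nlinarith
    have h5 : ((r - t) * s) * s ^ 2 ≤ (4 * t) * s ^ 2 := by
      calc ((r - t) * s) * s ^ 2 = 4 * ((r - t) * l ^ 2) := by linear_combination (r - t) * hsl
        _ ≤ (4 * t) * s ^ 2 := by linarith
    exact le_of_mul_le_mul_right h5 (by positivity)
  have hu : ∀ x ∈ Icc t r, s * u x ^ 2 ≤ 100 := by
    intro x hx
    have h1 : ‖u r - u x‖ ≤ 2 * √s / t * ‖r - x‖ := by
      refine Convex.norm_image_sub_le_of_norm_hasDerivWithin_le (f' := fun y ↦ w y / y)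
        (s := Icc t r) (fun y hy ↦ (H.hasDerivAt_fst y (ht0.trans_le hy.1)).hasDerivWithinAt)
        (fun y hy ↦ ?_) (convex_Icc t r) hx ⟨htr, le_rfl⟩
      have hy0 := ht0.trans_le hy.1
      rw [norm_div, Real.norm_eq_abs, Real.norm_eq_abs, abs_of_pos hy0]
      have : |w y| ≤ 2 * √s := by
        refine abs_le_of_sq_le_sq ?_ (by positivity)
        rw [mul_pow, Real.sq_sqrt hs0.le]
        linarith [hw y hy]
      exact div_le_div₀ (by positivity) this ht0 hy.1
    have hss := Real.sq_sqrt hs0.le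
    have hsp : 0 < √s := Real.sqrt_pos.mpr hs0
    have h2 : √s * |u r - u x| ≤ 8 := by
      rw [Real.norm_eq_abs, Real.norm_eq_abs, abs_of_nonneg (show 0 ≤ r - x by linarith [hx.2])] at h1
      calc √s * |u r - u x| ≤ √s * (2 * √s / t * (r - x)) := by gcongr
        _ = 2 * (√s ^ 2 * (r - x)) / t := by ring
        _ ≤ 2 * (4 * t) / t := by
          rw [hss]
          refine div_le_div_of_nonneg_right ?_ ht0.le
          nlinarith [mul_nonneg hs0.le (sub_nonneg.mpr hx.1)]
        _ = 8 := by field_simp; norm_num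
    have h3 : √s * |u r| ≤ 2 := by
      refine (le_abs_self _).trans (abs_le_of_sq_le_sq ?_ (by norm_num))
      rw [mul_pow, hss, sq_abs]; linarith
    -- At `r` the WKB bound gives 2 and the variation adds 8; hence `100 = 10²`.
    have h4 : √s * |u x| ≤ 10 := by
      have : |u x| ≤ |u r| + |u r - u x| := by
        have := abs_sub_abs_le_abs_sub (u x) (u r)
        rw [abs_sub_comm] at this
        linarith
      nlinarith
    calc s * u x ^ 2 = (√s * |u x|) ^ 2 := by rw [mul_pow, hss, sq_abs]
      _ ≤ 10 ^ 2 := by gcongr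
      _ = 100 := by norm_num
  rcases le_total t ρ with h | h
  · exact ⟨hu ρ ⟨h, hρr⟩, hw ρ ⟨h, hρr⟩⟩
  · have h1 := H.monotoneOn_sq_fst ha hDt.le ⟨hρ, h⟩ ⟨ht0, le_rfl⟩ h
    have h2 := H.monotoneOn_sq_snd ha hDt.le ⟨hρ, h⟩ ⟨ht0, le_rfl⟩ h
    exact ⟨(mul_le_mul_of_nonneg_left h1 hs0.le).trans (hu t ⟨le_rfl, htr⟩),
      h2.trans (hw t ⟨le_rfl, htr⟩)⟩

/-- Uniform bounds through the turning point, with `s³ = 4l²`. -/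
theorem amplitude_bound (H : IsCoulombPair l a u w) (ha : 0 ≤ a) (hl : 0 < l) {ρ s : ℝ}
    (hρ : 0 < ρ) (hs : 2 ≤ s) (hsl : s ^ 3 = 4 * l ^ 2) :
    u ρ ^ 4 * (|disc l a ρ| + s ^ 2) ≤ 20000 ∧ w ρ ^ 4 ≤ 16 * (|disc l a ρ| + s ^ 2) := by
  have hs0 : 0 < s := by linarith
  rcases le_total (disc l a ρ) (s ^ 2) with hD | hD
  · obtain ⟨h1, h2⟩ := H.bound_of_disc_le ha hl hρ hs hsl hD
    have h3 : u ρ ^ 4 * s ^ 2 ≤ 10000 := by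
      calc u ρ ^ 4 * s ^ 2 = (s * u ρ ^ 2) ^ 2 := by ring
        _ ≤ 100 ^ 2 := by gcongr
        _ = 10000 := by norm_num
    have h4 : u ρ ^ 4 * |disc l a ρ| ≤ 10000 := by
      rcases le_total 0 (disc l a ρ) with h0 | h0
      · rw [abs_of_nonneg h0]
        exact (mul_le_mul_of_nonneg_left hD (by positivity)).trans h3
      · rw [abs_of_nonpos h0]
        -- Where `D < 0`, nonnegativity of the energy gives `|D| u² ≤ w² ≤ 4s`; this is what
        -- controls `u` far inside the forbidden region.
        have h5 := H.energy_nonneg ha hρ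
        calc u ρ ^ 4 * -disc l a ρ = u ρ ^ 2 * (-disc l a ρ * u ρ ^ 2) := by ring
          _ ≤ u ρ ^ 2 * (4 * s) := mul_le_mul_of_nonneg_left (by linarith [sq_nonneg (w ρ)]) (sq_nonneg _)
          _ = 4 * (s * u ρ ^ 2) := by ring
          _ ≤ 10000 := by linarith
    have h5 : w ρ ^ 4 ≤ 16 * s ^ 2 := by
      calc w ρ ^ 4 = (w ρ ^ 2) ^ 2 := by ring
        _ ≤ (4 * s) ^ 2 := by gcongr
        _ = 16 * s ^ 2 := by ring
    exact ⟨by rw [mul_add]; linarith, h5.trans (by linarith [abs_nonneg (disc l a ρ)])⟩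
  · have hD0 : 0 < disc l a ρ := lt_of_lt_of_le (by positivity) hD
    have h := H.wkb_bound ha hρ hD0 (wkbCoeff_le_one ha hρ hs (by linarith [sq_nonneg l]) hD)
    have hq := Real.sqrt_pos.mpr hD0
    have hqq := Real.sq_sqrt hD0.le
    rw [abs_of_pos hD0]
    generalize √(disc l a ρ) = q at *
    have h1 : q * u ρ ^ 2 ≤ 4 := by
      have : 0 ≤ w ρ ^ 2 / q := by positivity
      linarith
    have h2 : w ρ ^ 2 ≤ 4 * q := by
      rw [← div_le_iff₀ hq]
      have : 0 ≤ q * u ρ ^ 2 := by positivity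
      linarith
    have h3 : u ρ ^ 4 * disc l a ρ ≤ 16 := by
      calc u ρ ^ 4 * disc l a ρ = (q * u ρ ^ 2) ^ 2 := by rw [← hqq]; ring
        _ ≤ 4 ^ 2 := by gcongr
        _ = 16 := by norm_num
    have h4 : w ρ ^ 4 ≤ 16 * disc l a ρ := by
      calc w ρ ^ 4 = (w ρ ^ 2) ^ 2 := by ring
        _ ≤ (4 * q) ^ 2 := by gcongr
        _ = 16 * disc l a ρ := by rw [← hqq]; ring
    constructor
    · have := mul_le_mul_of_nonneg_left hD (by positivity : 0 ≤ u ρ ^ 4)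
      nlinarith
    · nlinarith [sq_nonneg s]

end IsCoulombPair

end DiracCoulomb

namespace DiracCoulomb

open Complex Filter Topology Set MeasureTheory

/-! ### Asymptotics at infinity of Coulomb waves -/

/-- `f` solves the radial Coulomb equation `f'' + (1 + 2a/ρ - γ(γ + 1)/ρ²) f = 0`. -/
structure IsCoulombWave (γ a : ℝ) (f f' : ℝ → ℝ) : Prop where
  hasDerivAt : ∀ ρ, 0 < ρ → HasDerivAt f (f' ρ) ρ
  hasDerivAt' : ∀ ρ, 0 < ρ →
    HasDerivAt f' (-((1 + 2 * a / ρ - γ * (γ + 1) / ρ ^ 2) * f ρ)) ρ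

namespace IsCoulombWave

variable {γ a : ℝ} {f f' : ℝ → ℝ}

/-- With `Q = 1 + 2a/ρ - γ(γ+1)/ρ²`, the energy `f'² + Q f²` decreases once `aρ ≥ γ(γ+1)`, and there
`Q ≥ 1`. The threshold depends on `a`, which is harmless: the bound serves only to obtain limits. -/
theorem exists_bound (H : IsCoulombWave γ a f f') (ha : 0 < a) :
    ∃ R M : ℝ, 1 ≤ R ∧ 0 ≤ M ∧ ∀ ρ, R ≤ ρ → |f ρ| ≤ M ∧ |f' ρ| ≤ M := by
  set R := max (γ * (γ + 1) / a) 1 with hR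
  have hR1 : 1 ≤ R := le_max_right _ _
  have hRa : ∀ ρ, R ≤ ρ → γ * (γ + 1) ≤ a * ρ := by
    intro ρ hρ
    have := (le_max_left (γ * (γ + 1) / a) 1).trans hρ
    rw [div_le_iff₀ ha] at this
    linarith
  have hd : ∀ x, R ≤ x → HasDerivAt
      (fun ρ ↦ f' ρ ^ 2 + (1 + 2 * a / ρ - γ * (γ + 1) / ρ ^ 2) * f ρ ^ 2)
      ((2 * (γ * (γ + 1)) - 2 * (a * x)) / x ^ 3 * f x ^ 2) x := by
    intro x hx
    have hx0 : 0 < x := by linarith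
    have h1 := H.hasDerivAt x hx0
    have h2 := H.hasDerivAt' x hx0
    have h3 := (((hasDerivAt_inv hx0.ne').const_mul (2 * a)).const_add 1).fun_sub
      ((((hasDerivAt_id x).fun_pow 2).fun_inv (by simp; positivity)).const_mul (γ * (γ + 1)))
    refine (((h2.fun_pow 2).fun_add (h3.fun_mul (h1.fun_pow 2)))).congr_deriv ?_
    simp only [id]
    push_cast
    field_simp
    ring
  have hanti : AntitoneOn
      (fun ρ ↦ f' ρ ^ 2 + (1 + 2 * a / ρ - γ * (γ + 1) / ρ ^ 2) * f ρ ^ 2) (Ici R) := by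
    refine antitoneOn_of_deriv_nonpos (convex_Ici R)
      (fun x hx ↦ (hd x hx).continuousAt.continuousWithinAt)
      (fun x hx ↦ (hd x (interior_subset hx)).differentiableAt.differentiableWithinAt) ?_
    intro x hx
    have hxR : R ≤ x := interior_subset hx
    have hx0 : 0 < x := by linarith
    rw [(hd x hxR).deriv]
    refine mul_nonpos_of_nonpos_of_nonneg (div_nonpos_of_nonpos_of_nonneg ?_ (by positivity))
      (sq_nonneg _)
    linarith [hRa x hxR]
  refine ⟨R, √(f' R ^ 2 + (1 + 2 * a / R - γ * (γ + 1) / R ^ 2) * f R ^ 2), hR1, by positivity,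
    fun ρ hρ ↦ ?_⟩
  have h1 := hanti self_mem_Ici hρ hρ
  have hρ0 : 0 < ρ := by linarith
  have hQ : 1 ≤ 1 + 2 * a / ρ - γ * (γ + 1) / ρ ^ 2 := by
    have h2 : γ * (γ + 1) / ρ ^ 2 ≤ a * ρ / ρ ^ 2 :=
      div_le_div_of_nonneg_right (hRa ρ hρ) (by positivity)
    have h3 : a * ρ / ρ ^ 2 = a / ρ := by field_simp
    have h4 : 0 ≤ a / ρ := by positivity
    rw [mul_div_assoc]
    linarith
  have h5 : f ρ ^ 2 ≤ (1 + 2 * a / ρ - γ * (γ + 1) / ρ ^ 2) * f ρ ^ 2 :=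
    le_mul_of_one_le_left (sq_nonneg _) hQ
  simp only at h1
  constructor <;> refine Real.abs_le_sqrt (le_trans ?_ h1) <;>
    linarith [sq_nonneg (f ρ), sq_nonneg (f' ρ)]

/-- The Coulomb wave divided by its logarithmically modified phase, with a first order
correction. -/
noncomputable def modulated (a : ℝ) (f f' : ℝ → ℝ) (ρ : ℝ) : ℂ :=
  exp (-(I * (ρ + a * Real.log ρ))) *
    ((1 + a / 2 * (ρ : ℂ)⁻¹) * f ρ - I * ((1 - a / 2 * (ρ : ℂ)⁻¹) * f' ρ))

/-- The derivative of `modulated`. -/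
noncomputable def modulated' (γ a : ℝ) (f f' : ℝ → ℝ) (ρ : ℝ) : ℂ :=
  ((ρ ^ 2)⁻¹ : ℝ) * (exp (-(I * (ρ + a * Real.log ρ))) *
    ((a ^ 2 - I * a) / 2 * f' ρ + (-a / 2 - I * (3 / 2 * a ^ 2 + γ * (γ + 1)) +
      I * (a * (γ * (γ + 1)) / 2 * (ρ : ℂ)⁻¹)) * f ρ))

theorem hasDerivAt_modulated (H : IsCoulombWave γ a f f') {ρ : ℝ} (hρ : 0 < ρ) :
    HasDerivAt (modulated a f f') (modulated' γ a f f' ρ) ρ := by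
  have h1 := (H.hasDerivAt ρ hρ).ofReal_comp
  have h2 := (H.hasDerivAt' ρ hρ).ofReal_comp
  have hi : HasDerivAt (fun ρ : ℝ ↦ (ρ : ℂ)⁻¹) (-((ρ : ℂ) ^ 2)⁻¹) ρ := by
    have := (hasDerivAt_inv hρ.ne').ofReal_comp
    push_cast at this
    exact this
  have hθ : HasDerivAt (fun ρ : ℝ ↦ -(I * ((ρ : ℂ) + a * (Real.log ρ : ℂ))))
      (-(I * (1 + a * (ρ : ℂ)⁻¹))) ρ := by
    have h3 := (Real.hasDerivAt_log hρ.ne').ofReal_comp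
    push_cast at h3
    have h4 := (hasDerivAt_id ρ).ofReal_comp
    simp only [id, ofReal_one] at h4
    exact ((h4.fun_add (h3.const_mul (a : ℂ))).const_mul I).fun_neg
  have h := hθ.cexp.fun_mul ((((hi.const_mul ((a : ℂ) / 2)).const_add 1).fun_mul h1).fun_sub
    ((((hi.const_mul ((a : ℂ) / 2)).const_sub 1).fun_mul h2).const_mul I))
  refine h.congr_deriv ?_
  have hρ' : (ρ : ℂ) ≠ 0 := by exact_mod_cast hρ.ne'
  rw [modulated']
  push_cast
  generalize exp (-(I * (ρ + a * (Real.log ρ : ℂ)))) = e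
  field_simp
  ring_nf
  simp only [I_sq]
  ring

/-- Without the correction the derivative has a non-resonant `1/ρ` term, which is not absolutely
integrable. The `a/(2ρ)` terms cancel it and leave `O(ρ^{-2})`, so the limit exists. -/
theorem exists_tendsto_modulated (H : IsCoulombWave γ a f f') (ha : 0 < a) :
    ∃ c : ℂ, Tendsto (modulated a f f') atTop (𝓝 c) := by
  obtain ⟨R, M, hR, hM, hb⟩ := H.exists_bound ha
  refine ⟨_, tendsto_limUnder_of_hasDerivAt_of_integrableOn_Ioi (a := R)
    (fun x hx ↦ H.hasDerivAt_modulated (by linarith [mem_Ioi.mp hx])) ?_⟩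
  have hcont : ContinuousOn (modulated' γ a f f') (Ioi R) := by
    have h0 : ∀ x ∈ Ioi R, 0 < x := fun x hx ↦ by linarith [mem_Ioi.mp hx]
    have hcf : ContinuousOn f (Ioi R) := fun x hx ↦
      (H.hasDerivAt x (h0 x hx)).continuousAt.continuousWithinAt
    have hcf' : ContinuousOn f' (Ioi R) := fun x hx ↦
      (H.hasDerivAt' x (h0 x hx)).continuousAt.continuousWithinAt
    have hlog : ContinuousOn Real.log (Ioi R) := fun x hx ↦
      (Real.continuousAt_log (h0 x hx).ne').continuousWithinAt
    have hinv : ContinuousOn (fun x : ℝ ↦ (x : ℂ)⁻¹) (Ioi R) :=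
      continuous_ofReal.continuousOn.inv₀ fun x hx ↦ by exact_mod_cast (h0 x hx).ne'
    have hinv2 : ContinuousOn (fun x : ℝ ↦ (x ^ 2)⁻¹) (Ioi R) :=
      (continuous_id.pow 2).continuousOn.inv₀ fun x hx ↦ pow_ne_zero 2 (h0 x hx).ne'
    unfold modulated'
    fun_prop
  have hint : IntegrableOn (fun x : ℝ ↦ x ^ (-2 : ℝ) *
      (‖((a : ℂ) ^ 2 - I * a) / 2‖ * M + (‖-(a : ℂ) / 2 - I * (3 / 2 * a ^ 2 + γ * (γ + 1))‖ +
      ‖(a : ℂ) * (γ * (γ + 1)) / 2‖) * M)) (Ioi R) :=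
    (integrableOn_Ioi_rpow_of_lt (by norm_num) (by linarith)).mul_const _
  refine hint.mono' (hcont.aestronglyMeasurable measurableSet_Ioi) ?_
  refine (ae_restrict_iff' measurableSet_Ioi).mpr (Eventually.of_forall fun x hx ↦ ?_)
  have hx1 : 1 ≤ x := by linarith [mem_Ioi.mp hx]
  have hx0 : 0 < x := by linarith
  obtain ⟨hb1, hb2⟩ := hb x (le_of_lt hx)
  have he : ‖exp (-(I * (x + a * (Real.log x : ℂ))))‖ = 1 := by
    rw [norm_exp]; simp [← ofReal_mul, ← ofReal_add]
  rw [modulated', norm_mul, norm_mul, he, one_mul, norm_real, Real.norm_eq_abs,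
    abs_of_nonneg (by positivity), Real.rpow_neg hx0.le, Real.rpow_two]
  gcongr
  refine (norm_add_le _ _).trans (add_le_add ?_ ?_)
  · rw [norm_mul, norm_real, Real.norm_eq_abs]
    gcongr
  · rw [norm_mul, norm_real, Real.norm_eq_abs]
    refine mul_le_mul ?_ hb1 (abs_nonneg _) (by positivity)
    refine (norm_add_le _ _).trans (add_le_add le_rfl ?_)
    rw [norm_mul, norm_I, one_mul, norm_mul, norm_inv, norm_real, Real.norm_eq_abs,
      abs_of_pos hx0]
    exact mul_le_of_le_one_right (norm_nonneg _) (inv_le_one_of_one_le₀ hx1)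

/-- Leading behaviour at infinity. -/
theorem exists_asymptotics (H : IsCoulombWave γ a f f') (ha : 0 < a) :
    ∃ c : ℂ, Tendsto (fun ρ : ℝ ↦ f ρ - (c * exp (I * (ρ + a * Real.log ρ))).re) atTop (𝓝 0) ∧
      Tendsto (fun ρ ↦ f ρ ^ 2 + f' ρ ^ 2) atTop (𝓝 (‖c‖ ^ 2)) := by
  obtain ⟨R, M, hR, hM, hb⟩ := H.exists_bound ha
  obtain ⟨c, hc⟩ := H.exists_tendsto_modulated ha
  have hlead : Tendsto (fun ρ : ℝ ↦ exp (-(I * (ρ + a * Real.log ρ))) * (f ρ - I * f' ρ))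
      atTop (𝓝 c) := by
    have hz : Tendsto (fun ρ : ℝ ↦ exp (-(I * (ρ + a * Real.log ρ))) * (f ρ - I * f' ρ) -
        modulated a f f' ρ) atTop (𝓝 0) := by
      -- At the level of limits the correction `a/(2ρ)` disappears, since `f` and `f'` are bounded.
      have hz' : Tendsto (fun ρ : ℝ ↦ ρ⁻¹ * (a * M)) atTop (𝓝 0) := by
        simpa using tendsto_inv_atTop_zero.mul_const (a * M)
      refine squeeze_zero_norm' ?_ hz'
      filter_upwards [eventually_ge_atTop R] with x hx
      have hx0 : 0 < x := by linarith
      obtain ⟨hb1, hb2⟩ := hb x hx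
      have he : ‖exp (-(I * (x + a * (Real.log x : ℂ))))‖ = 1 := by
        rw [norm_exp]; simp [← ofReal_mul, ← ofReal_add]
      have e : exp (-(I * (x + a * Real.log x))) * (f x - I * f' x) - modulated a f f' x =
          exp (-(I * (x + a * Real.log x))) * (((x⁻¹ * (a / 2) : ℝ) : ℂ) *
            (-(f x : ℂ) - I * f' x)) := by
        rw [modulated]; push_cast; ring
      rw [e, norm_mul, he, one_mul, norm_mul, norm_real, Real.norm_eq_abs,
        abs_of_nonneg (by positivity)]
      have h3 : ‖-(f x : ℂ) - I * f' x‖ ≤ M + M := by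
        refine (norm_sub_le _ _).trans (add_le_add ?_ ?_)
        · rwa [norm_neg, norm_real]
        · rwa [norm_mul, norm_I, one_mul, norm_real]
      calc x⁻¹ * (a / 2) * ‖-(f x : ℂ) - I * f' x‖ ≤ x⁻¹ * (a / 2) * (M + M) := by gcongr
        _ = x⁻¹ * (a * M) := by ring
    simpa using hz.add hc
  refine ⟨c, ?_, ?_⟩
  · have h1 : Tendsto (fun ρ : ℝ ↦ ‖exp (-(I * (ρ + a * Real.log ρ))) * (f ρ - I * f' ρ) - c‖)
        atTop (𝓝 0) := by simpa using (hlead.sub_const c).norm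
    refine squeeze_zero_norm (fun x ↦ ?_) h1
    have he : ‖exp (I * (x + a * (Real.log x : ℂ)))‖ = 1 := by
      rw [norm_exp]; simp [← ofReal_mul, ← ofReal_add]
    have hee : exp (I * (x + a * (Real.log x : ℂ))) * exp (-(I * (x + a * (Real.log x : ℂ)))) = 1 := by
      rw [← exp_add]; simp
    have e : f x - (c * exp (I * (x + a * Real.log x))).re = (exp (I * (x + a * Real.log x)) *
        (exp (-(I * (x + a * Real.log x))) * (f x - I * f' x) - c)).re := by
      rw [show exp (I * (x + a * Real.log x)) * (exp (-(I * (x + a * Real.log x))) *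
        (f x - I * f' x) - c) = (f x - I * f' x) - c * exp (I * (x + a * Real.log x)) by
        linear_combination ((f x : ℂ) - I * f' x) * hee]
      simp
    rw [e, Real.norm_eq_abs]
    refine (abs_re_le_norm _).trans ?_
    rw [norm_mul, he, one_mul]
  · refine (hlead.norm.pow 2).congr fun x ↦ ?_
    have he : ‖exp (-(I * (x + a * (Real.log x : ℂ))))‖ = 1 := by
      rw [norm_exp]; simp [← ofReal_mul, ← ofReal_add]
    rw [norm_mul, he, one_mul, ← normSq_eq_norm_sq, normSq_apply]
    simp
    ring

end IsCoulombWave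

end DiracCoulomb

namespace DiracCoulomb

open Complex Filter Topology Set MeasureTheory

/-! ### Laplace transforms -/

theorem integrableOn_rpow_mul_exp_neg_mul {p t : ℝ} (hp : -1 < p) (ht : 0 < t) :
    IntegrableOn (fun x : ℝ ↦ x ^ p * Real.exp (-(t * x))) (Ioi 0) := by
  have := integrableOn_rpow_mul_exp_neg_mul_rpow hp one_pos ht
  simpa using this

theorem integral_rpow_mul_exp_neg_mul_smul (p : ℝ) {t : ℝ} (ht : 0 < t) (F : ℝ → ℂ) :
    ∫ x in Ioi (0 : ℝ), (x ^ p * Real.exp (-(t * x))) • F x =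
      t ^ (-(p + 1)) • ∫ x in Ioi (0 : ℝ), (x ^ p * Real.exp (-x)) • F (x / t) := by
  have h := integral_comp_mul_left_Ioi
    (fun x : ℝ ↦ (x ^ p * Real.exp (-x)) • F (x / t)) 0 ht
  rw [mul_zero] at h
  have h2 : ∫ x in Ioi (0 : ℝ), ((t * x) ^ p * Real.exp (-(t * x))) • F (t * x / t) =
      t ^ p • ∫ x in Ioi (0 : ℝ), (x ^ p * Real.exp (-(t * x))) • F x := by
    rw [← integral_smul]
    refine setIntegral_congr_fun measurableSet_Ioi fun x hx ↦ ?_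
    rw [Real.mul_rpow ht.le (le_of_lt hx), mul_div_cancel_left₀ _ ht.ne', smul_smul, mul_assoc]
  rw [h2] at h
  have h3 : t ^ (-(p + 1)) = (t ^ p)⁻¹ * t⁻¹ := by
    rw [Real.rpow_neg ht.le, Real.rpow_add_one ht.ne', mul_inv]
  rw [h3, mul_smul, ← h, smul_smul, inv_mul_cancel₀ (Real.rpow_pos_of_pos ht p).ne', one_smul]

/-- An Abelian theorem for both ends: after rescaling, `t → ∞` sees `F` near the origin and `t → 0+`
sees it at infinity. -/
theorem tendsto_integral_rpow_mul_exp_neg_smul {p M : ℝ} (hp : -1 < p) {F : ℝ → ℂ}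
    (hF : ContinuousOn F (Ioi 0)) (hM : ∀ x, 0 < x → ‖F x‖ ≤ M) {l : Filter ℝ}
    [l.IsCountablyGenerated] (hl : ∀ᶠ t in l, 0 < t) {z : ℂ}
    (hz : ∀ s, 0 < s → Tendsto (fun t ↦ F (s / t)) l (𝓝 z)) :
    Tendsto (fun t ↦ ∫ x in Ioi (0 : ℝ), (x ^ p * Real.exp (-x)) • F (x / t)) l
      (𝓝 (Real.Gamma (p + 1) • z)) := by
  have hG : Real.Gamma (p + 1) • z = ∫ x in Ioi (0 : ℝ), (x ^ p * Real.exp (-x)) • z := by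
    rw [integral_smul_const, Real.Gamma_eq_integral (by linarith)]
    congr 1
    refine integral_congr_ae (Eventually.of_forall fun x ↦ ?_)
    simp [mul_comm]
  rw [hG]
  have hint : IntegrableOn (fun x : ℝ ↦ x ^ p * Real.exp (-x)) (Ioi 0) := by
    simpa using integrableOn_rpow_mul_exp_neg_mul hp one_pos
  refine tendsto_integral_filter_of_dominated_convergence
    (fun x ↦ (x ^ p * Real.exp (-x)) * M) ?_ ?_ (hint.mul_const M) ?_
  · filter_upwards [hl] with t ht
    refine hint.aestronglyMeasurable.smul (ContinuousOn.aestronglyMeasurable ?_ measurableSet_Ioi)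
    exact hF.comp (continuous_id.div_const t).continuousOn fun x hx ↦ div_pos hx ht
  · filter_upwards [hl] with t ht
    refine (ae_restrict_iff' measurableSet_Ioi).mpr (Eventually.of_forall fun x hx ↦ ?_)
    have hx0 : 0 < x := hx
    rw [norm_smul, Real.norm_eq_abs, abs_of_nonneg (by positivity)]
    exact mul_le_mul_of_nonneg_left (hM _ (div_pos hx ht)) (by positivity)
  · refine (ae_restrict_iff' measurableSet_Ioi).mpr (Eventually.of_forall fun x hx ↦ ?_)
    exact (hz x hx).const_smul _

/-- The Laplace transform of `ρ^p F`. -/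
noncomputable def laplace (p : ℝ) (F : ℝ → ℂ) (t : ℝ) : ℂ :=
  ∫ x in Ioi (0 : ℝ), (x ^ p * Real.exp (-(t * x))) • F x

theorem integrableOn_laplace {p t M : ℝ} (hp : -1 < p) (ht : 0 < t) {F : ℝ → ℂ}
    (hF : ContinuousOn F (Ioi 0)) (hM : ∀ x, 0 < x → ‖F x‖ ≤ M) :
    IntegrableOn (fun x : ℝ ↦ (x ^ p * Real.exp (-(t * x))) • F x) (Ioi 0) := by
  have hint := integrableOn_rpow_mul_exp_neg_mul hp ht
  refine (hint.mul_const M).mono' (hint.aestronglyMeasurable.smul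
    (hF.aestronglyMeasurable measurableSet_Ioi)) ?_
  refine (ae_restrict_iff' measurableSet_Ioi).mpr (Eventually.of_forall fun x hx ↦ ?_)
  have hx0 : 0 < x := hx
  rw [norm_smul, Real.norm_eq_abs, abs_of_nonneg (by positivity)]
  exact mul_le_mul_of_nonneg_left (hM _ hx) (by positivity)

theorem hasDerivAt_laplace {p t M : ℝ} (hp : -1 < p) (ht : 0 < t) {F : ℝ → ℂ}
    (hF : ContinuousOn F (Ioi 0)) (hM : ∀ x, 0 < x → ‖F x‖ ≤ M) :
    HasDerivAt (laplace p F) (-laplace (p + 1) F t) t := by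
  have hm : ∀ q y : ℝ, AEStronglyMeasurable
      (fun x : ℝ ↦ (x ^ q * Real.exp (-(y * x))) • F x) (volume.restrict (Ioi 0)) := fun q y ↦
    (((continuousOn_id.rpow_const fun x hx ↦ Or.inl (ne_of_gt hx)).mul
      (by fun_prop)).smul hF).aestronglyMeasurable measurableSet_Ioi
  have h := (hasDerivAt_integral_of_dominated_loc_of_deriv_le (μ := volume.restrict (Ioi (0 : ℝ)))
    (F := fun y x ↦ (x ^ p * Real.exp (-(y * x))) • F x) (x₀ := t)
    (F' := fun y x ↦ -((x ^ (p + 1) * Real.exp (-(y * x))) • F x))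
    (bound := fun x ↦ (x ^ (p + 1) * Real.exp (-(t / 2 * x))) * M)
    (Ioi_mem_nhds (half_lt_self ht)) (Eventually.of_forall fun y ↦ hm p y)
    (integrableOn_laplace hp ht hF hM) (hm (p + 1) t).neg ?_
    ((integrableOn_rpow_mul_exp_neg_mul (by linarith) (half_pos ht)).mul_const M) ?_).2
  · rw [integral_neg] at h
    exact h
  · refine (ae_restrict_iff' measurableSet_Ioi).mpr (Eventually.of_forall fun x hx y hy ↦ ?_)
    have hx0 : 0 < x := hx
    have hy0 : t / 2 < y := hy
    rw [norm_neg, norm_smul, Real.norm_eq_abs, abs_of_nonneg (by positivity)]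
    refine mul_le_mul ?_ (hM _ hx) (norm_nonneg _) (by positivity)
    gcongr
  · refine (ae_restrict_iff' measurableSet_Ioi).mpr (Eventually.of_forall fun x hx y _ ↦ ?_)
    have hx0 : 0 < x := hx
    have h1 : HasDerivAt (fun y ↦ x ^ p * Real.exp (-(y * x)))
        (x ^ p * (Real.exp (-(y * x)) * (-x))) y := by
      have := (((hasDerivAt_id y).mul_const x).fun_neg.exp).const_mul (x ^ p)
      simpa using this
    refine (h1.smul_const (F x)).congr_deriv ?_
    rw [Real.rpow_add_one hx0.ne', ← neg_smul]
    congr 1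
    ring

/-! ### The Laplace transform of a Coulomb wave -/

namespace IsCoulombProfile

variable {γ a : ℝ} {h h' : ℝ → ℝ}

/-- The function `e^{-iρ} h(ρ)`. -/
noncomputable def twist (h : ℝ → ℝ) (ρ : ℝ) : ℂ := exp (-(I * ρ)) * h ρ

theorem norm_exp_neg_I_mul (ρ : ℝ) : ‖exp (-(I * ρ))‖ = 1 := by
  rw [norm_exp]; simp

theorem continuous_twist (H : IsCoulombProfile γ a h h') : Continuous (twist h) := by
  have := H.continuous
  unfold twist
  fun_prop

theorem norm_twist_le (H : IsCoulombProfile γ a h h') (hγ : 0 ≤ γ) (ha : 0 < a) (h0 : h 0 = 1)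
    {ρ : ℝ} (hρ : 0 ≤ ρ) : ‖twist h ρ‖ ≤ 1 := by
  rw [twist, norm_mul, norm_exp_neg_I_mul, one_mul, norm_real, Real.norm_eq_abs]
  simpa [h0] using H.abs_le hγ ha hρ

/-- The coefficients of the profile equation are affine in `ρ`, so its Laplace transform satisfies
an equation of first order in `t`; the higher moment here is minus the derivative of the lower one.
-/
theorem laplace_twist_succ (H : IsCoulombProfile γ a h h') (hγ : 0 ≤ γ) (ha : 0 < a)
    (h0 : h 0 = 1) {t : ℝ} (ht : 0 < t) :
    t * (t + 2 * I) * laplace (2 * γ + 1 + 1) (twist h) t =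
      (2 * (γ + 1) * (t + I) - 2 * a) * laplace (2 * γ + 1) (twist h) t := by
  -- `J` collects the boundary terms of the integrations by parts: its derivative is the difference
  -- of the two integrands, and it vanishes at 0 and at infinity.
  set J : ℝ → ℂ := fun ρ ↦ (ρ ^ (2 * γ + 1 + 1) * Real.exp (-(t * ρ))) •
    (exp (-(I * ρ)) * (h' ρ - I * h ρ) + (t + 2 * I) * twist h ρ) with hJ
  have hcont : Continuous J := by
    have h1 := H.continuous'
    have h2 := H.continuous
    have h3 := H.continuous_twist
    have h4 : Continuous fun ρ : ℝ ↦ ρ ^ (2 * γ + 1 + 1) :=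
      Real.continuous_rpow_const (by positivity)
    rw [hJ]
    fun_prop
  have hderiv : ∀ ρ ∈ Ioi (0 : ℝ), HasDerivAt J
      ((2 * (γ + 1) * (t + I) - 2 * a) * ((ρ ^ (2 * γ + 1) * Real.exp (-(t * ρ))) • twist h ρ) -
        t * (t + 2 * I) * ((ρ ^ (2 * γ + 1 + 1) * Real.exp (-(t * ρ))) • twist h ρ)) ρ := by
    intro ρ hρ
    have hρ0 : 0 < ρ := hρ
    have hE := hasDerivAt_exp_neg_I_mul ρ
    have h1 := (H.hasDerivAt ρ).ofReal_comp
    have h2 := (H.hasDerivAt' ρ hρ0).ofReal_comp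
    have h3 : HasDerivAt (fun ρ : ℝ ↦ ρ ^ (2 * γ + 1 + 1) * Real.exp (-(t * ρ)))
        ((2 * γ + 1 + 1) * ρ ^ (2 * γ + 1) * Real.exp (-(t * ρ)) +
          ρ ^ (2 * γ + 1 + 1) * (Real.exp (-(t * ρ)) * -t)) ρ := by
      have h4 := Real.hasDerivAt_rpow_const (x := ρ) (p := 2 * γ + 1 + 1) (Or.inl hρ0.ne')
      have h5 := ((hasDerivAt_id ρ).const_mul t).fun_neg.exp
      simp only [id, mul_one, add_sub_cancel_right] at h4 h5
      exact h4.fun_mul h5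
    have h6 := h3.fun_smul ((hE.fun_mul (h2.fun_sub (h1.const_mul I))).fun_add
      ((hE.fun_mul h1).const_mul (t + 2 * I)))
    refine h6.congr_deriv ?_
    have hρ' : (ρ : ℂ) ≠ 0 := by exact_mod_cast hρ0.ne'
    simp only [twist, real_smul]
    rw [Real.rpow_add_one hρ0.ne']
    push_cast
    field_simp
    ring_nf
    simp only [I_sq]
    ring
  have hb : ∀ x, 0 < x → ‖twist h x‖ ≤ 1 := fun x hx ↦ H.norm_twist_le hγ ha h0 hx.le
  have hi1 := integrableOn_laplace (p := 2 * γ + 1) (by linarith) ht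
    H.continuous_twist.continuousOn hb
  have hi2 := integrableOn_laplace (p := 2 * γ + 1 + 1) (by linarith) ht
    H.continuous_twist.continuousOn hb
  have hlim : Tendsto J atTop (𝓝 0) := by
    have hz : Tendsto (fun ρ : ℝ ↦ ρ ^ (2 * γ + 1 + 1) * Real.exp (-t * ρ) *
        ((1 + a + 1) + ‖(t : ℂ) + 2 * I‖)) atTop (𝓝 0) := by
      simpa using (tendsto_rpow_mul_exp_neg_mul_atTop_nhds_zero (2 * γ + 1 + 1) t ht).mul_const
        ((1 + a + 1) + ‖(t : ℂ) + 2 * I‖)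
    refine squeeze_zero_norm' ?_ hz
    filter_upwards [eventually_ge_atTop 1] with ρ hρ
    have hρ0 : 0 < ρ := by linarith
    rw [hJ]
    simp only
    rw [norm_smul, Real.norm_eq_abs, abs_of_nonneg (by positivity), neg_mul]
    refine mul_le_mul_of_nonneg_left ((norm_add_le _ _).trans (add_le_add ?_ ?_)) (by positivity)
    · rw [norm_mul, norm_exp_neg_I_mul, one_mul]
      refine (norm_sub_le _ _).trans (add_le_add ?_ ?_)
      · have h1 := H.abs_mul_deriv_le hγ ha hρ0.le
        rw [h0, abs_one, mul_one, abs_mul, abs_of_pos hρ0] at h1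
        rw [norm_real, Real.norm_eq_abs]
        have h2 : ρ * |h' ρ| ≤ ρ * (1 + a) := by nlinarith
        exact le_of_mul_le_mul_left h2 hρ0
      · rw [norm_mul, norm_I, one_mul, norm_real, Real.norm_eq_abs]
        simpa [h0] using H.abs_le hγ ha hρ0.le
    · rw [norm_mul]
      exact mul_le_of_le_one_right (norm_nonneg _) (hb ρ hρ0)
  have hint := integral_Ioi_of_hasDerivAt_of_tendsto hcont.continuousWithinAt hderiv
    ((hi1.const_mul _).sub (hi2.const_mul _)) hlim
  rw [integral_sub (hi1.const_mul _) (hi2.const_mul _), integral_const_mul, integral_const_mul]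
    at hint
  have hJ0 : J 0 = 0 := by
    rw [hJ]; simp [Real.zero_rpow (by linarith : 2 * γ + 1 + 1 ≠ 0)]
  rw [hJ0, sub_zero, sub_eq_zero] at hint
  exact hint.symm

/-- `t^{γ+1+ia} (t+2i)^{γ+1-ia}` times the Laplace transform does not depend on `t`. -/
noncomputable def laplaceConst (γ a : ℝ) (h : ℝ → ℝ) (t : ℝ) : ℂ :=
  exp ((γ + 1 + I * a) * Real.log t + (γ + 1 - I * a) * log (t + 2 * I)) *
    laplace (2 * γ + 1) (twist h) t

theorem add_two_I_mem_slitPlane (t : ℝ) : (t : ℂ) + 2 * I ∈ slitPlane := by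
  rw [mem_slitPlane_iff]; right; simp

/-- The prefactor is the integrating factor of the first-order equation: `(γ+1+ia)/t +
(γ+1-ia)/(t+2i)` is exactly the ratio in `laplace_twist_succ`. -/
theorem hasDerivAt_laplaceConst (H : IsCoulombProfile γ a h h') (hγ : 0 ≤ γ) (ha : 0 < a)
    (h0 : h 0 = 1) {t : ℝ} (ht : 0 < t) : HasDerivAt (laplaceConst γ a h) 0 t := by
  have hb : ∀ x, 0 < x → ‖twist h x‖ ≤ 1 := fun x hx ↦ H.norm_twist_le hγ ha h0 hx.le
  have h1 := hasDerivAt_laplace (p := 2 * γ + 1) (by linarith) ht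
    H.continuous_twist.continuousOn hb
  have h2 := (Real.hasDerivAt_log ht.ne').ofReal_comp
  have h3 : HasDerivAt (fun t : ℝ ↦ log ((t : ℂ) + 2 * I)) (1 / (t + 2 * I)) t := by
    have h4 : HasDerivAt (fun t : ℝ ↦ (t : ℂ) + 2 * I) 1 t := by
      simpa using (hasDerivAt_id t).ofReal_comp.add_const (2 * I)
    exact h4.clog_real (add_two_I_mem_slitPlane t)
  have h5 := ((h2.const_mul ((γ : ℂ) + 1 + I * a)).fun_add
    (h3.const_mul ((γ : ℂ) + 1 - I * a))).cexp.fun_mul h1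
  refine h5.congr_deriv ?_
  have h6 := H.laplace_twist_succ hγ ha h0 ht
  have ht' : (t : ℂ) ≠ 0 := by exact_mod_cast ht.ne'
  have ht2 : (t : ℂ) + 2 * I ≠ 0 := slitPlane_ne_zero (add_two_I_mem_slitPlane t)
  push_cast
  generalize exp (((γ : ℂ) + 1 + I * a) * (Real.log t : ℂ) + (γ + 1 - I * a) * log (t + 2 * I)) = e
  generalize hw : (t : ℂ) + 2 * I = w at *
  field_simp
  linear_combination (-e) * h6 - (e * (γ + 1 + I * a) * laplace (2 * γ + 1) (twist h) t) * hw +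
    (2 * e * a * laplace (2 * γ + 1) (twist h) t) * I_sq

theorem tendsto_laplaceConst_atTop (H : IsCoulombProfile γ a h h') (hγ : 0 ≤ γ) (ha : 0 < a)
    (h0 : h 0 = 1) :
    Tendsto (laplaceConst γ a h) atTop (𝓝 (Real.Gamma (2 * γ + 2) : ℂ)) := by
  have hb : ∀ x, 0 < x → ‖twist h x‖ ≤ 1 := fun x hx ↦ H.norm_twist_le hγ ha h0 hx.le
  have h1 := tendsto_integral_rpow_mul_exp_neg_smul (p := 2 * γ + 1) (by linarith)
    H.continuous_twist.continuousOn hb (l := atTop) (eventually_gt_atTop 0) (z := 1) (by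
      intro s hs
      have : Tendsto (fun t ↦ s / t) atTop (𝓝 0) := tendsto_const_nhds.div_atTop tendsto_id
      have h2 := (H.continuous_twist.tendsto 0).comp this
      have h3 : twist h 0 = 1 := by simp [twist, h0]
      rwa [h3] at h2)
  have h2 : Tendsto (fun t : ℝ ↦ exp ((γ + 1 - I * a) * log (1 + 2 * I * ((t⁻¹ : ℝ) : ℂ))))
      atTop (𝓝 1) := by
    have h3 : Tendsto (fun t : ℝ ↦ 1 + 2 * I * ((t⁻¹ : ℝ) : ℂ)) atTop (𝓝 (1 + 2 * I * ((0 : ℝ) : ℂ))) :=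
      (((continuous_ofReal.tendsto 0).comp tendsto_inv_atTop_zero).const_mul (2 * I)).const_add 1
    have h4 := ((h3.clog (by simp)).const_mul ((γ : ℂ) + 1 - I * a)).cexp
    simpa using h4
  have h3 := h2.mul h1
  rw [one_mul, show 2 * γ + 1 + 1 = 2 * γ + 2 by ring, real_smul, mul_one] at h3
  refine h3.congr' ?_
  filter_upwards [eventually_gt_atTop 0] with t ht
  have ht' : (t : ℂ) ≠ 0 := by exact_mod_cast ht.ne'
  -- Extracting `log t` combines the two complex powers into `t^{2γ+2}`, which cancels the scaling
  -- of the integral.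
  have hlog : log ((t : ℂ) + 2 * I) = Real.log t + log (1 + 2 * I * ((t⁻¹ : ℝ) : ℂ)) := by
    rw [← log_ofReal_mul ht]
    · congr 1; push_cast; field_simp
    · intro h
      have := congrArg re h
      simp at this
  rw [laplaceConst, laplace, integral_rpow_mul_exp_neg_mul_smul _ ht, hlog, real_smul,
    Real.rpow_def_of_pos ht, ofReal_exp, ← mul_assoc, ← exp_add]
  congr 2
  push_cast
  ring

theorem laplaceConst_eq (H : IsCoulombProfile γ a h h') (hγ : 0 ≤ γ) (ha : 0 < a)
    (h0 : h 0 = 1) {t : ℝ} (ht : 0 < t) : laplaceConst γ a h t = Real.Gamma (2 * γ + 2) := by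
  refine tendsto_nhds_unique (tendsto_const_nhds.congr' ?_)
    (H.tendsto_laplaceConst_atTop hγ ha h0)
  filter_upwards [eventually_gt_atTop 0] with s hs
  exact isOpen_Ioi.is_const_of_deriv_eq_zero isPreconnected_Ioi
    (fun x hx ↦ (H.hasDerivAt_laplaceConst hγ ha h0 hx).differentiableAt.differentiableWithinAt)
    (fun x hx ↦ (H.hasDerivAt_laplaceConst hγ ha h0 hx).deriv) ht hs

end IsCoulombProfile

end DiracCoulomb

namespace DiracCoulomb

open Complex Filter Topology Set MeasureTheory

/-! ### The amplitude at infinity -/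

namespace IsCoulombProfile

variable {γ a : ℝ} {h h' : ℝ → ℝ}

theorem isCoulombWave (H : IsCoulombProfile γ a h h') :
    IsCoulombWave γ a (fun ρ ↦ ρ ^ (γ + 1) * h ρ)
      (fun ρ ↦ ρ ^ γ * ((γ + 1) * h ρ + ρ * h' ρ)) where
  hasDerivAt ρ hρ := by
    have h1 := Real.hasDerivAt_rpow_const (x := ρ) (p := γ + 1) (Or.inl hρ.ne')
    refine (h1.fun_mul (H.hasDerivAt ρ)).congr_deriv ?_
    rw [add_sub_cancel_right, Real.rpow_add_one hρ.ne']
    ring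
  hasDerivAt' ρ hρ := by
    have h1 := Real.hasDerivAt_rpow_const (x := ρ) (p := γ) (Or.inl hρ.ne')
    have h2 := ((H.hasDerivAt ρ).const_mul (γ + 1)).fun_add
      ((hasDerivAt_id ρ).fun_mul (H.hasDerivAt' ρ hρ))
    refine (h1.fun_mul h2).congr_deriv ?_
    rw [Real.rpow_sub_one hρ.ne', Real.rpow_add_one hρ.ne']
    simp only [id]
    field_simp
    ring

theorem exists_wave_bound (H : IsCoulombProfile γ a h h') (hγ : 0 ≤ γ) (ha : 0 < a) :
    ∃ M, ∀ ρ, 0 < ρ → |ρ ^ (γ + 1) * h ρ| ≤ M := by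
  obtain ⟨R, M, hR, hM, hb⟩ := H.isCoulombWave.exists_bound ha
  refine ⟨max M (R ^ (γ + 1) * |h 0|), fun ρ hρ ↦ ?_⟩
  rcases le_total R ρ with h1 | h1
  · exact (hb ρ h1).1.trans (le_max_left _ _)
  · refine le_trans ?_ (le_max_right _ _)
    rw [abs_mul, abs_of_nonneg (by positivity)]
    have := H.abs_le hγ ha hρ.le
    gcongr

/-- The Riemann–Lebesgue lemma at frequency `1/(πt)`. -/
theorem tendsto_integral_oscillating (F : ℝ → ℂ) :
    Tendsto (fun t : ℝ ↦ ∫ s in Ioi (0 : ℝ), exp (-(2 * I * ((s / t : ℝ) : ℂ))) * F s)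
      (𝓝[>] 0) (𝓝 0) := by
  have h1 : Tendsto (fun t : ℝ ↦ (Real.pi * t)⁻¹) (𝓝[>] 0) (cocompact ℝ) := by
    have h2 : Tendsto (fun t : ℝ ↦ Real.pi⁻¹ * t⁻¹) (𝓝[>] 0) atTop :=
      tendsto_inv_nhdsGT_zero.const_mul_atTop (by positivity)
    refine (h2.congr fun t ↦ by rw [mul_inv]).mono_right atTop_le_cocompact
  refine ((Real.tendsto_integral_exp_smul_cocompact ((Ioi (0 : ℝ)).indicator F)).comp h1).congr'
    ?_
  filter_upwards [self_mem_nhdsWithin] with t ht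
  have ht0 : 0 < t := ht
  rw [← integral_indicator measurableSet_Ioi]
  simp only [Function.comp]
  refine integral_congr_ae (Eventually.of_forall fun s ↦ ?_)
  by_cases hs : s ∈ Ioi (0 : ℝ)
  · simp only [indicator_of_mem hs]
    rw [Circle.smul_def, Real.fourierChar_apply, smul_eq_mul]
    congr 2
    have : (t : ℂ) ≠ 0 := by exact_mod_cast ht0.ne'
    have hπ : (Real.pi : ℂ) ≠ 0 := by exact_mod_cast Real.pi_ne_zero
    push_cast
    field_simp
  · simp only [indicator_of_notMem hs, smul_zero]

theorem integral_rpow_mul_exp_neg_smul_exp_log (hγ : 0 ≤ γ) (a : ℝ) :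
    ∫ s in Ioi (0 : ℝ), (s ^ γ * Real.exp (-s)) • exp (I * a * Real.log s) =
      Gamma (γ + 1 + I * a) := by
  rw [Gamma_eq_integral (by simp; linarith), GammaIntegral]
  refine setIntegral_congr_fun measurableSet_Ioi fun s hs ↦ ?_
  have hs0 : 0 < s := hs
  have hs' : (s : ℂ) ≠ 0 := by exact_mod_cast hs0.ne'
  rw [cpow_def_of_ne_zero hs', real_smul, Real.rpow_def_of_pos hs0, ← ofReal_log hs0.le]
  push_cast
  rw [mul_right_comm, mul_comm, ← exp_add]
  congr 2
  ring

/-- Splits `ρ^{γ+1} h` into `(c e^{iθ} + c̄ e^{-iθ})/2` with `θ = ρ + a log ρ`, plus a remainder.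
The factor `e^{-iρ}` cancels the oscillation of the first half, leaving `s^{ia}` and hence a Gamma
integral; the second half keeps the phase `e^{-2iρ}`. -/
theorem exp_mul_integral_twist (H : IsCoulombProfile γ a h h') (hγ : 0 ≤ γ) (ha : 0 < a)
    (c : ℂ) {t : ℝ} (ht : 0 < t) :
    exp (I * a * Real.log t) * ∫ s in Ioi (0 : ℝ), (s ^ γ * Real.exp (-s)) •
      (exp (-(I * ((s / t : ℝ) : ℂ))) * (((s / t) ^ (γ + 1) * h (s / t) : ℝ) : ℂ)) =
    c / 2 * Gamma (γ + 1 + I * a) +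
    exp (2 * I * a * Real.log t) * (starRingEnd ℂ c / 2) * (∫ s in Ioi (0 : ℝ),
      exp (-(2 * I * ((s / t : ℝ) : ℂ))) *
        ((s ^ γ * Real.exp (-s)) • exp (-(I * a * Real.log s)))) +
    exp (I * a * Real.log t) * ∫ s in Ioi (0 : ℝ), (s ^ γ * Real.exp (-s)) •
      (exp (-(I * ((s / t : ℝ) : ℂ))) * (((s / t) ^ (γ + 1) * h (s / t) -
        (c * exp (I * ((s / t : ℝ) + a * Real.log (s / t)))).re : ℝ) : ℂ)) := by
  obtain ⟨M, hM⟩ := H.exists_wave_bound hγ ha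
  have hint : ∀ {M : ℝ} {F : ℝ → ℂ}, ContinuousOn F (Ioi 0) → (∀ x, 0 < x → ‖F x‖ ≤ M) →
      IntegrableOn (fun s : ℝ ↦ (s ^ γ * Real.exp (-s)) • F s) (Ioi 0) := by
    intro M F h1 h2
    simpa using integrableOn_laplace (by linarith : -1 < γ) one_pos h1 h2
  have hlog : ContinuousOn Real.log (Ioi 0) := fun x hx ↦
    (Real.continuousAt_log (ne_of_gt hx)).continuousWithinAt
  have hlogt : ContinuousOn (fun s : ℝ ↦ Real.log (s / t)) (Ioi 0) :=
    hlog.comp (by fun_prop) fun s hs ↦ div_pos hs ht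
  have he : ∀ x : ℝ, ‖exp (I * (x : ℂ))‖ = 1 := fun x ↦ by rw [norm_exp]; simp
  have hw : Continuous fun s : ℝ ↦ (s / t) ^ (γ + 1) * h (s / t) := by
    have h1 := H.continuous
    have h2 : Continuous fun ρ : ℝ ↦ ρ ^ (γ + 1) := Real.continuous_rpow_const (by positivity)
    exact (h2.comp (continuous_id.div_const t)).mul (h1.comp (continuous_id.div_const t))
  have i1 : IntegrableOn (fun s : ℝ ↦ (s ^ γ * Real.exp (-s)) • exp (I * a * Real.log s))
      (Ioi 0) := by
    refine hint (M := 1) (by fun_prop) fun x _ ↦ ?_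
    have := he (a * Real.log x)
    push_cast at this
    rw [mul_assoc, this]
  have i2 : IntegrableOn (fun s : ℝ ↦ exp (-(2 * I * ((s / t : ℝ) : ℂ))) *
      ((s ^ γ * Real.exp (-s)) • exp (-(I * a * Real.log s)))) (Ioi 0) := by
    have := hint (M := 1)
      (F := fun s ↦ exp (-(2 * I * ((s / t : ℝ) : ℂ))) * exp (-(I * a * Real.log s)))
      (by fun_prop) fun x _ ↦ by
        have h1 := he (-(2 * (x / t)))
        have h2 := he (-(a * Real.log x))
        rw [show I * ((-(2 * (x / t)) : ℝ) : ℂ) = -(2 * I * ((x / t : ℝ) : ℂ)) by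
          push_cast; ring] at h1
        rw [show I * ((-(a * Real.log x) : ℝ) : ℂ) = -(I * a * Real.log x) by
          push_cast; ring] at h2
        rw [norm_mul, h1, h2, one_mul]
    refine this.congr_fun (fun s _ ↦ ?_) measurableSet_Ioi
    simp only [real_smul]
    ring
  have i3 : IntegrableOn (fun s : ℝ ↦ (s ^ γ * Real.exp (-s)) •
      (exp (-(I * ((s / t : ℝ) : ℂ))) * (((s / t) ^ (γ + 1) * h (s / t) -
        (c * exp (I * ((s / t : ℝ) + a * Real.log (s / t)))).re : ℝ) : ℂ))) (Ioi 0) := by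
    refine hint (M := M + ‖c‖) ?_ fun x hx ↦ ?_
    · have h3 : ContinuousOn (fun s : ℝ ↦
          (c * exp (I * ((s / t : ℝ) + a * Real.log (s / t)))).re) (Ioi 0) :=
        continuous_re.comp_continuousOn (by fun_prop)
      have h4 : Continuous fun s : ℝ ↦ exp (-(I * ((s / t : ℝ) : ℂ))) := by fun_prop
      exact h4.continuousOn.mul (continuous_ofReal.comp_continuousOn (hw.continuousOn.sub h3))
    · rw [norm_mul, norm_exp_neg_I_mul, one_mul, norm_real]
      refine (norm_sub_le _ _).trans (add_le_add (hM _ (div_pos hx ht)) ?_)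
      refine (abs_re_le_norm _).trans ?_
      have := he (x / t + a * Real.log (x / t))
      push_cast at this
      push_cast
      rw [norm_mul, this, mul_one]
  rw [← integral_rpow_mul_exp_neg_smul_exp_log hγ, ← integral_const_mul, ← integral_const_mul,
    ← integral_const_mul, ← integral_const_mul, ← integral_add (i1.const_mul _) (i2.const_mul _),
    ← integral_add (Integrable.fun_add (i1.const_mul _) (i2.const_mul _)) (i3.const_mul _)]
  refine setIntegral_congr_fun measurableSet_Ioi fun s hs ↦ ?_
  have hs0 : 0 < s := hs
  simp only [real_smul]
  generalize s ^ γ * Real.exp (-s) = K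
  generalize (s / t) ^ (γ + 1) * h (s / t) = f
  rw [Real.log_div hs0.ne' ht.ne']
  generalize Real.log s = u
  generalize Real.log t = w
  generalize s / t = x
  have hre : ((c * exp (I * (x + a * ((u - w : ℝ) : ℂ)))).re : ℂ) =
      (c * exp (I * (x + a * (u - w))) +
        starRingEnd ℂ c * exp (-(I * (x + a * (u - w))))) / 2 := by
    rw [re_eq_add_conj, map_mul, ← exp_conj]
    push_cast
    simp
  rw [ofReal_sub, hre]
  have e1 : exp (I * a * w) * exp (-(I * x)) * exp (I * (x + a * (u - w))) = exp (I * a * u) := by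
    rw [← exp_add, ← exp_add]; congr 1; ring
  have e2 : exp (I * a * w) * exp (-(I * x)) * exp (-(I * (x + a * (u - w)))) =
      exp (2 * I * a * w) * exp (-(2 * I * x)) * exp (-(I * a * u)) := by
    rw [← exp_add, ← exp_add, ← exp_add, ← exp_add]; congr 1; ring
  linear_combination (c / 2 * K) * e1 + (starRingEnd ℂ c / 2 * K) * e2

/-- Let `t → 0+` in the constant identity of `laplaceConst_eq`. The conjugate half vanishes by
Riemann–Lebesgue and the remainder by dominated convergence, so only the resonant half survives. -/
theorem connection_formula (H : IsCoulombProfile γ a h h') (hγ : 0 ≤ γ) (ha : 0 < a)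
    (h0 : h 0 = 1) {c : ℂ}
    (hc : Tendsto (fun ρ : ℝ ↦ ρ ^ (γ + 1) * h ρ - (c * exp (I * (ρ + a * Real.log ρ))).re)
      atTop (𝓝 0)) :
    exp ((γ + 1 - I * a) * log (2 * I)) * (c / 2 * Gamma (γ + 1 + I * a)) =
      Real.Gamma (2 * γ + 2) := by
  obtain ⟨M, hM⟩ := H.exists_wave_bound hγ ha
  have he : ∀ x : ℝ, ‖exp (I * (x : ℂ))‖ = 1 := fun x ↦ by rw [norm_exp]; simp
  have hlog : ContinuousOn Real.log (Ioi 0) := fun x hx ↦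
    (Real.continuousAt_log (ne_of_gt hx)).continuousWithinAt
  have l1 : Tendsto (fun t : ℝ ↦ exp ((γ + 1 - I * a) * log (t + 2 * I))) (𝓝[>] 0)
      (𝓝 (exp ((γ + 1 - I * a) * log (2 * I)))) := by
    have h1 : Tendsto (fun t : ℝ ↦ (t : ℂ) + 2 * I) (𝓝[>] 0) (𝓝 (((0 : ℝ) : ℂ) + 2 * I)) :=
      ((continuous_ofReal.tendsto 0).mono_left nhdsWithin_le_nhds).add_const _
    have h2 := ((h1.clog (add_two_I_mem_slitPlane 0)).const_mul ((γ : ℂ) + 1 - I * a)).cexp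
    simpa using h2
  have l2 : Tendsto (fun t : ℝ ↦ exp (2 * I * a * Real.log t) * (starRingEnd ℂ c / 2) *
      (∫ s in Ioi (0 : ℝ), exp (-(2 * I * ((s / t : ℝ) : ℂ))) *
        ((s ^ γ * Real.exp (-s)) • exp (-(I * a * Real.log s))))) (𝓝[>] 0) (𝓝 0) := by
    refine squeeze_zero_norm (a := fun t ↦ ‖starRingEnd ℂ c / 2‖ * ‖(∫ s in Ioi (0 : ℝ),
      exp (-(2 * I * ((s / t : ℝ) : ℂ))) *
        ((s ^ γ * Real.exp (-s)) • exp (-(I * a * Real.log s))))‖) (fun t ↦ ?_) ?_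
    · have h1 := he (2 * a * Real.log t)
      rw [show I * ((2 * a * Real.log t : ℝ) : ℂ) = 2 * I * a * Real.log t by
        push_cast; ring] at h1
      rw [norm_mul, norm_mul, h1, one_mul]
    · simpa using (tendsto_integral_oscillating _).norm.const_mul ‖starRingEnd ℂ c / 2‖
  have l3 : Tendsto (fun t : ℝ ↦ exp (I * a * Real.log t) * ∫ s in Ioi (0 : ℝ),
      (s ^ γ * Real.exp (-s)) • (exp (-(I * ((s / t : ℝ) : ℂ))) *
        (((s / t) ^ (γ + 1) * h (s / t) -
        (c * exp (I * ((s / t : ℝ) + a * Real.log (s / t)))).re : ℝ) : ℂ))) (𝓝[>] 0) (𝓝 0) := by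
    have h1 := tendsto_integral_rpow_mul_exp_neg_smul (p := γ) (M := M + ‖c‖) (by linarith)
      (F := fun x ↦ exp (-(I * (x : ℂ))) * ((x ^ (γ + 1) * h x -
        (c * exp (I * (x + a * Real.log x))).re : ℝ) : ℂ)) ?_ ?_ (l := 𝓝[>] 0)
      self_mem_nhdsWithin (z := 0) ?_
    · rw [smul_zero] at h1
      refine squeeze_zero_norm (fun t ↦ ?_) (tendsto_zero_iff_norm_tendsto_zero.mp h1)
      have h2 := he (a * Real.log t)
      rw [show I * ((a * Real.log t : ℝ) : ℂ) = I * a * Real.log t by push_cast; ring] at h2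
      rw [norm_mul, h2, one_mul]
    · have hw : ContinuousOn (fun s : ℝ ↦ s ^ (γ + 1) * h s) (Ioi 0) :=
        ((Real.continuous_rpow_const (by positivity)).mul H.continuous).continuousOn
      have h3 : ContinuousOn (fun s : ℝ ↦ (c * exp (I * (s + a * Real.log s))).re) (Ioi 0) :=
        continuous_re.comp_continuousOn (by fun_prop)
      fun_prop
    · intro x hx
      rw [norm_mul, norm_exp_neg_I_mul, one_mul, norm_real]
      refine (norm_sub_le _ _).trans (add_le_add (hM _ hx) ?_)
      refine (abs_re_le_norm _).trans ?_
      have := he (x + a * Real.log x)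
      push_cast at this
      rw [norm_mul, this, mul_one]
    · intro s hs
      have h2 : Tendsto (fun t : ℝ ↦ s / t) (𝓝[>] 0) atTop := by
        simp only [div_eq_mul_inv]
        exact tendsto_inv_nhdsGT_zero.const_mul_atTop hs
      refine squeeze_zero_norm (fun t ↦ ?_) ((hc.comp h2).norm.trans_eq (by simp))
      rw [norm_mul, norm_exp_neg_I_mul, one_mul, norm_real]
      rfl
  have l4 := l1.mul ((l2.const_add (c / 2 * Gamma (γ + 1 + I * a))).add l3)
  rw [add_zero, add_zero] at l4
  refine tendsto_nhds_unique l4 (tendsto_const_nhds.congr' ?_)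
  filter_upwards [self_mem_nhdsWithin] with t ht
  have ht0 : 0 < t := ht
  rw [← H.laplaceConst_eq hγ ha h0 ht, ← H.exp_mul_integral_twist hγ ha c ht, laplaceConst]
  have h1 : laplace (2 * γ + 1) (twist h) t =
      laplace γ (fun ρ ↦ exp (-(I * ρ)) * ((ρ ^ (γ + 1) * h ρ : ℝ) : ℂ)) t := by
    rw [laplace, laplace]
    refine setIntegral_congr_fun measurableSet_Ioi fun s hs ↦ ?_
    -- One power `ρ^{γ+1}` of the weight is moved onto `h` to form the bounded Coulomb wave.
    have hs0 : 0 < s := hs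
    simp only [twist, real_smul]
    rw [show 2 * γ + 1 = γ + (γ + 1) by ring, Real.rpow_add hs0]
    push_cast
    ring
  rw [h1, laplace, integral_rpow_mul_exp_neg_mul_smul _ ht0, real_smul, Real.rpow_def_of_pos ht0,
    ofReal_exp, ← mul_assoc, ← mul_assoc, ← exp_add, ← exp_add]
  congr 2
  push_cast
  ring

end IsCoulombProfile

/-! ### Normalisation to unit amplitude. -/

/-- The normalisation `2^γ e^{πa/2} |Γ(γ + 1 + ia)| / Γ(2γ + 2)`. -/
noncomputable def coulombConst (γ a : ℝ) : ℝ :=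
  2 ^ γ * Real.exp (Real.pi * a / 2) * ‖Gamma (γ + 1 + I * a)‖ / Real.Gamma (2 * γ + 2)

theorem norm_mul_coulombConst {γ a : ℝ} (hγ : 0 ≤ γ) {c : ℂ}
    (hc : exp ((γ + 1 - I * a) * log (2 * I)) * (c / 2 * Gamma (γ + 1 + I * a)) =
      Real.Gamma (2 * γ + 2)) : ‖c‖ * coulombConst γ a = 1 := by
  have hG : 0 < Real.Gamma (2 * γ + 2) := Real.Gamma_pos_of_pos (by linarith)
  have hlog : log (2 * I) = Real.log 2 + Real.pi / 2 * I := by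
    have := log_ofReal_mul two_pos I_ne_zero
    rw [log_I] at this
    exact_mod_cast this
  -- Since `log(2i) = log 2 + iπ/2`, the exponent `-ia` contributes the growth `e^{πa/2}`.
  have hn : ‖exp ((γ + 1 - I * a) * log (2 * I))‖ = 2 ^ γ * 2 * Real.exp (Real.pi * a / 2) := by
    have e : ((γ : ℂ) + 1 - I * a) * (Real.log 2 + Real.pi / 2 * I) =
        (((γ + 1) * Real.log 2 + a * Real.pi / 2 : ℝ) : ℂ) +
          (((γ + 1) * Real.pi / 2 - a * Real.log 2 : ℝ) : ℂ) * I := by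
      push_cast
      linear_combination (-(a * Real.pi / 2 : ℂ)) * I_sq
    rw [norm_exp, hlog, e, ← Real.rpow_add_one two_ne_zero, Real.rpow_def_of_pos two_pos,
      ← Real.exp_add]
    congr 1
    simp only [add_re, ofReal_re, re_ofReal_mul, I_re, mul_zero, add_zero]
    ring
  have h1 := congrArg norm hc
  rw [norm_mul, norm_mul, norm_div, hn, norm_real, Real.norm_eq_abs, abs_of_pos hG] at h1
  simp only [Complex.norm_ofNat] at h1
  rw [coulombConst, mul_div_assoc', div_eq_one_iff_eq hG.ne', ← h1]
  ring

theorem IsCoulombProfile.isCoulombPair {γ a : ℝ} {h h' : ℝ → ℝ} (H : IsCoulombProfile γ a h h')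
    (hγ : 0 ≤ γ) (ha : 0 < a) (h0 : h 0 = 1) :
    IsCoulombPair (γ + 1 / 2) a (fun ρ ↦ coulombConst γ a * (ρ ^ (γ + 1 / 2) * h ρ))
      (fun ρ ↦ coulombConst γ a * (ρ ^ (γ + 1 / 2) * ((γ + 1 / 2) * h ρ + ρ * h' ρ))) where
  hasDerivAt_fst ρ hρ := by
    have h1 := Real.hasDerivAt_rpow_const (x := ρ) (p := γ + 1 / 2) (Or.inl hρ.ne')
    refine ((h1.fun_mul (H.hasDerivAt ρ)).const_mul _).congr_deriv ?_
    rw [Real.rpow_sub_one hρ.ne']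
    field_simp
  hasDerivAt_snd ρ hρ := by
    have h1 := Real.hasDerivAt_rpow_const (x := ρ) (p := γ + 1 / 2) (Or.inl hρ.ne')
    have h2 := ((H.hasDerivAt ρ).const_mul (γ + 1 / 2)).fun_add
      ((hasDerivAt_id ρ).fun_mul (H.hasDerivAt' ρ hρ))
    refine ((h1.fun_mul h2).const_mul _).congr_deriv ?_
    rw [Real.rpow_sub_one hρ.ne', disc]
    simp only [id]
    field_simp
    ring
  tendsto_fst := by
    have h1 : Continuous fun ρ : ℝ ↦ coulombConst γ a * (ρ ^ (γ + 1 / 2) * h ρ) :=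
      ((Real.continuous_rpow_const (by positivity)).mul H.continuous).const_mul _
    have h2 := (h1.tendsto 0).mono_left (nhdsWithin_le_nhds (s := Ioi 0))
    simp only [Real.zero_rpow (by positivity : γ + 1 / 2 ≠ 0), zero_mul, mul_zero] at h2
    exact h2
  tendsto_snd := by
    have hc := H.continuous
    have hc' := H.continuous'
    have h1 : Continuous fun ρ : ℝ ↦
        coulombConst γ a * (ρ ^ (γ + 1 / 2) * ((γ + 1 / 2) * h ρ + ρ * h' ρ)) :=
      ((Real.continuous_rpow_const (by positivity)).mul (by fun_prop)).const_mul _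
    have h2 := (h1.tendsto 0).mono_left (nhdsWithin_le_nhds (s := Ioi 0))
    simp only [Real.zero_rpow (by positivity : γ + 1 / 2 ≠ 0), zero_mul, mul_zero] at h2
    exact h2
  tendsto_atTop := by
    obtain ⟨c, hc1, hc2⟩ := H.isCoulombWave.exists_asymptotics ha
    have hnorm := norm_mul_coulombConst hγ (H.connection_formula hγ ha h0 hc1)
    obtain ⟨R, M, hR, hM, hb⟩ := H.isCoulombWave.exists_bound ha
    have hz : Tendsto (fun ρ : ℝ ↦ ρ⁻¹ * (M * M + M * M)) atTop (𝓝 0) := by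
      simpa using tendsto_inv_atTop_zero.mul_const (M * M + M * M)
    set f : ℝ → ℝ := fun ρ ↦ ρ ^ (γ + 1) * h ρ with hf
    set f' : ℝ → ℝ := fun ρ ↦ ρ ^ γ * ((γ + 1) * h ρ + ρ * h' ρ) with hf'
    -- Passing from `f, f'` to `u = K ρ^{-1/2} f` and `w = ρu'` adds just these two terms, which are
    -- `O(1/ρ)`.
    have hdiff : Tendsto (fun ρ ↦ -(ρ⁻¹ * (f ρ * f' ρ)) + ρ⁻¹ * (ρ⁻¹ * (f ρ * f ρ) / 4)) atTop
        (𝓝 0) := by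
      refine squeeze_zero_norm' ?_ hz
      filter_upwards [eventually_ge_atTop R] with ρ hρ
      have hρ0 : 0 < ρ := by linarith
      obtain ⟨hb1, hb2⟩ := hb ρ hρ
      have hi : ρ⁻¹ ≤ 1 := inv_le_one_of_one_le₀ (by linarith)
      have hi0 : 0 < ρ⁻¹ := by positivity
      have h1 : |f ρ * f' ρ| ≤ M * M := by rw [abs_mul]; gcongr
      have h2 : |f ρ * f ρ| ≤ M * M := by rw [abs_mul]; gcongr
      rw [← mul_neg, ← mul_add, norm_mul, Real.norm_eq_abs, abs_of_pos hi0]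
      gcongr
      refine (norm_add_le _ _).trans (add_le_add (by rwa [norm_neg]) ?_)
      rw [norm_div, norm_mul, Real.norm_eq_abs, abs_of_pos hi0, Real.norm_eq_abs, Real.norm_eq_abs]
      rw [abs_of_pos (by norm_num : (0 : ℝ) < 4)]
      nlinarith [abs_nonneg (f ρ * f ρ)]
    have hlim := (hc2.add hdiff).const_mul (coulombConst γ a ^ 2)
    rw [add_zero, ← mul_pow, mul_comm, hnorm, one_pow] at hlim
    refine hlim.congr' ?_
    filter_upwards [eventually_gt_atTop 0] with ρ hρ
    have h1 : ρ ^ (γ + 1 / 2) = ρ ^ γ * √ρ := by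
      rw [Real.rpow_add hρ, Real.sqrt_eq_rpow]
    have h2 := Real.sq_sqrt hρ.le
    have h3 : 0 < √ρ := Real.sqrt_pos.mpr hρ
    simp only [hf, hf']
    rw [h1, Real.rpow_add_one hρ.ne']
    generalize √ρ = q at *
    subst h2
    field_simp
    ring

end DiracCoulomb

namespace DiracCoulomb

open Complex Filter Topology Set MeasureTheory

/-! ### The eigenfunction in terms of the Coulomb profile -/

/-- The combination `ρ h' + (2γ + 1) h - iρ h`. -/
noncomputable def diracZ (γ a ρ : ℝ) : ℂ :=
  ρ * coulombH' γ a ρ + (2 * γ + 1) * coulombH γ a ρ - I * ρ * coulombH γ a ρ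

/-- The function `ρ^(γ-1) (ρ h' + (2γ + 1) h - iρ h)`. -/
noncomputable def diracY (γ a ρ : ℝ) : ℂ := (ρ ^ (γ - 1) : ℝ) * diracZ γ a ρ

/-- The derivative of `diracY`. -/
noncomputable def diracY' (γ a ρ : ℝ) : ℂ :=
  (ρ ^ (γ - 1) : ℝ) * ((γ - 1) / ρ * diracZ γ a ρ - (ρ + 2 * a + I) * coulombH γ a ρ -
    I * ρ * coulombH' γ a ρ)

theorem hasDerivAt_diracY {γ a ρ : ℝ} (hγ : 0 ≤ γ) (hρ : 0 < ρ) :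
    HasDerivAt (diracY γ a) (diracY' γ a ρ) ρ := by
  have H := isCoulombProfile_re a hγ
  have h0 := (hasDerivAt_id ρ).ofReal_comp
  have h1 := (H.hasDerivAt ρ).ofReal_comp
  have h2 := (H.hasDerivAt' ρ hρ).ofReal_comp
  have h3 := (Real.hasDerivAt_rpow_const (x := ρ) (p := γ - 1) (Or.inl hρ.ne')).ofReal_comp
  have h4 := h3.fun_mul (((h0.fun_mul h2).fun_add (h1.const_mul (2 * (γ : ℂ) + 1))).fun_sub
    ((h0.const_mul I).fun_mul h1))
  refine h4.congr_deriv ?_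
  have hρ' : (ρ : ℂ) ≠ 0 := by exact_mod_cast hρ.ne'
  rw [Real.rpow_sub_one hρ.ne' (γ - 1), diracY', diracZ]
  simp only [id]
  push_cast
  field_simp
  ring

theorem norm_Gamma_add_I_mul_le {γ : ℝ} (hγ : 0 ≤ γ) (a : ℝ) :
    ‖Gamma (γ + 1 + I * a)‖ ≤ Real.Gamma (γ + 1) := by
  rw [← IsCoulombProfile.integral_rpow_mul_exp_neg_smul_exp_log hγ a,
    Real.Gamma_eq_integral (by linarith)]
  refine (norm_integral_le_integral_norm _).trans_eq (setIntegral_congr_fun measurableSet_Ioi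
    fun s hs ↦ ?_)
  have hs0 : 0 < s := hs
  have h1 : ‖exp (I * a * Real.log s)‖ = 1 := by
    rw [norm_exp, show I * a * (Real.log s : ℂ) = ((a * Real.log s : ℝ) : ℂ) * I by
      push_cast; ring]
    simp [-ofReal_mul]
  rw [norm_smul, h1, mul_one, Real.norm_eq_abs, abs_of_nonneg (by positivity),
    add_sub_cancel_right, mul_comm]

/-- The `a`-independent bound `2^γ Γ(γ + 1) / Γ(2γ + 2)` of the normalisation. -/
noncomputable def coulombBound (γ : ℝ) : ℝ :=
  2 ^ γ * Real.Gamma (γ + 1) / Real.Gamma (2 * γ + 2)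

theorem coulombBound_pos {γ : ℝ} (hγ : 0 ≤ γ) : 0 < coulombBound γ := by
  have h1 : 0 < Real.Gamma (2 * γ + 2) := Real.Gamma_pos_of_pos (by linarith)
  have h2 : 0 < Real.Gamma (γ + 1) := Real.Gamma_pos_of_pos (by linarith)
  unfold coulombBound
  positivity

theorem coulombConst_nonneg {γ : ℝ} (hγ : 0 ≤ γ) (a : ℝ) : 0 ≤ coulombConst γ a := by
  have h1 : 0 < Real.Gamma (2 * γ + 2) := Real.Gamma_pos_of_pos (by linarith)
  unfold coulombConst
  positivity

/-- The constant in front of `diracY`. -/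
noncomputable def diracConst (γ a : ℝ) : ℝ := Real.exp (-(Real.pi * a)) * coulombConst γ a

theorem diracConst_nonneg {γ : ℝ} (hγ : 0 ≤ γ) (a : ℝ) : 0 ≤ diracConst γ a :=
  mul_nonneg (Real.exp_pos _).le (coulombConst_nonneg hγ a)

/-- The net exponential is `e^{-πa/2}`, and `1 + a ≤ e^a` with `π/2 > 1`. Thus one factor `1 + a`
costs nothing and the remaining constant is free of `a`. -/
theorem diracConst_mul_le {γ a : ℝ} (hγ : 0 ≤ γ) (ha : 0 < a) :
    diracConst γ a * (1 + a) ≤ coulombBound γ := by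
  have h1 : 0 < Real.Gamma (2 * γ + 2) := Real.Gamma_pos_of_pos (by linarith)
  have h2 := norm_Gamma_add_I_mul_le hγ a
  have h3 : Real.exp (-(Real.pi * a)) * Real.exp (Real.pi * a / 2) * (1 + a) ≤ 1 := by
    have h4 : 1 + a ≤ Real.exp a := by linarith [Real.add_one_le_exp a]
    calc Real.exp (-(Real.pi * a)) * Real.exp (Real.pi * a / 2) * (1 + a)
        ≤ Real.exp (-(Real.pi * a)) * Real.exp (Real.pi * a / 2) * Real.exp a := by gcongr
      _ = Real.exp (-((Real.pi / 2 - 1) * a)) := by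
        rw [← Real.exp_add, ← Real.exp_add]; congr 1; ring
      _ ≤ 1 := by
        rw [Real.exp_le_one_iff]
        nlinarith [Real.pi_gt_three]
  calc diracConst γ a * (1 + a)
      = (Real.exp (-(Real.pi * a)) * Real.exp (Real.pi * a / 2) * (1 + a)) *
        (2 ^ γ * ‖Gamma (γ + 1 + I * a)‖ / Real.Gamma (2 * γ + 2)) := by
        rw [diracConst, coulombConst]; ring
    _ ≤ 1 * (2 ^ γ * Real.Gamma (γ + 1) / Real.Gamma (2 * γ + 2)) := by gcongr
    _ = coulombBound γ := by rw [one_mul, coulombBound]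

/-- `Φ` carries `e^{πα_N/2} = e^{-πa/2}`, whereas the unit-amplitude constant carries `e^{+πa/2}`.
The quotient `e^{-πa}` is the gain that pays for all losses in `a`. -/
theorem Phi_eq_diracY {m ν N ξ ρ : ℝ} {k : ℤ} (ha : alpha m ν N < 0) (hρ : 0 < ρ) :
    Phi m ν k N ξ ρ = diracConst (gam ν k) (-alpha m ν N) *
      exp (I * (2 * ρ + ξ)) * diracY (gam ν k) (-alpha m ν N) ρ := by
  have hγ : 0 ≤ gam ν k := Real.sqrt_nonneg _
  have ha' : 0 < -alpha m ν N := by linarith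
  have h1 : (gam ν k : ℂ) - I * alpha m ν N = gam ν k + I * ((-alpha m ν N : ℝ) : ℂ) := by
    push_cast; ring
  have h2 : ‖Gamma ((gam ν k : ℂ) + 1 + I * alpha m ν N)‖ =
      ‖Gamma ((gam ν k : ℂ) + 1 + I * ((-alpha m ν N : ℝ) : ℂ))‖ := by
    rw [← norm_conj (Gamma ((gam ν k : ℂ) + 1 + I * alpha m ν N)), ← Gamma_conj]
    simp
  rw [Phi_eq, wave, h1, kummer_eq_coulombH hγ ha' hρ, pref, h2, diracConst, coulombConst, diracY,
    diracZ]
  generalize alpha m ν N = α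
  generalize gam ν k = γ at *
  have hG : Real.Gamma (2 * γ + 2) = (2 * γ + 1) * Real.Gamma (2 * γ + 1) := by
    rw [← Real.Gamma_add_one (by linarith)]; ring_nf
  have hG0 : (Real.Gamma (2 * γ + 1) : ℂ) ≠ 0 := by
    exact_mod_cast (Real.Gamma_pos_of_pos (by linarith)).ne'
  have hγ1 : (2 * (γ : ℂ) + 1) ≠ 0 := by
    exact_mod_cast (by linarith : 0 < 2 * γ + 1).ne'
  have hE : Real.exp (-(Real.pi * -α)) * Real.exp (Real.pi * -α / 2) =
      Real.exp (Real.pi * α / 2) := by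
    rw [← Real.exp_add]; congr 1; ring
  have hE2 : exp (I * ρ + I * ξ) * exp (I * ρ) = exp (I * (2 * ρ + ξ)) := by
    rw [← exp_add]; congr 1; ring
  have hρ' : (ρ : ℂ) ≠ 0 := by exact_mod_cast hρ.ne'
  rw [← hE, ← hE2, hG, Real.mul_rpow two_pos.le hρ.le, Real.rpow_sub_one hρ.ne']
  push_cast
  field_simp

theorem norm_exp_I_mul_add (ρ ξ : ℝ) : ‖exp (I * (2 * ρ + ξ))‖ = 1 := by
  rw [norm_exp]; simp

theorem hasDerivAt_Phi {m ν N ξ ρ : ℝ} {k : ℤ} (ha : alpha m ν N < 0) (hρ : 0 < ρ) :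
    HasDerivAt (Phi m ν k N ξ) (diracConst (gam ν k) (-alpha m ν N) * exp (I * (2 * ρ + ξ)) *
      (2 * I * diracY (gam ν k) (-alpha m ν N) ρ + diracY' (gam ν k) (-alpha m ν N) ρ)) ρ := by
  have hγ : 0 ≤ gam ν k := Real.sqrt_nonneg _
  have h1 : HasDerivAt (fun ρ : ℝ ↦ I * (2 * (ρ : ℂ) + ξ)) (I * 2) ρ := by
    have := (((hasDerivAt_id ρ).ofReal_comp.const_mul 2).add_const (ξ : ℂ)).const_mul I
    simpa using this
  have h2 := ((h1.cexp.const_mul (diracConst (gam ν k) (-alpha m ν N) : ℂ)).fun_mul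
    (hasDerivAt_diracY (a := -alpha m ν N) hγ hρ))
  refine (h2.congr_of_eventuallyEq ?_).congr_deriv (by ring)
  filter_upwards [Ioi_mem_nhds hρ] with x hx
  exact Phi_eq_diracY ha hx

theorem norm_Phi_eq {m ν N ξ ρ : ℝ} {k : ℤ} (ha : alpha m ν N < 0) (hρ : 0 < ρ) :
    ‖Phi m ν k N ξ ρ‖ = diracConst (gam ν k) (-alpha m ν N) *
      ‖diracY (gam ν k) (-alpha m ν N) ρ‖ := by
  have hγ : 0 ≤ gam ν k := Real.sqrt_nonneg _
  rw [Phi_eq_diracY ha hρ, norm_mul, norm_mul, norm_exp_I_mul_add, mul_one, norm_real,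
    Real.norm_eq_abs, abs_of_nonneg (diracConst_nonneg hγ _)]

theorem norm_deriv_Phi_le {m ν N ξ ρ : ℝ} {k : ℤ} (ha : alpha m ν N < 0) (hρ : 0 < ρ) :
    ‖deriv (Phi m ν k N ξ) ρ‖ ≤ diracConst (gam ν k) (-alpha m ν N) *
      (2 * ‖diracY (gam ν k) (-alpha m ν N) ρ‖ + ‖diracY' (gam ν k) (-alpha m ν N) ρ‖) := by
  have hγ : 0 ≤ gam ν k := Real.sqrt_nonneg _
  have h0 := diracConst_nonneg hγ (-alpha m ν N)
  rw [(hasDerivAt_Phi ha hρ).deriv, norm_mul, norm_mul, norm_exp_I_mul_add, mul_one, norm_real,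
    Real.norm_eq_abs, abs_of_nonneg h0]
  refine mul_le_mul_of_nonneg_left ((norm_add_le _ _).trans (add_le_add ?_ le_rfl)) h0
  rw [norm_mul, norm_mul, norm_I, mul_one, Complex.norm_ofNat]

/-! ### Bounds near the origin -/

theorem norm_diracZ_le (γ a ρ : ℝ) :
    ‖diracZ γ a ρ‖ ≤ |ρ * coulombH' γ a ρ + (2 * γ + 1) * coulombH γ a ρ| +
      |ρ| * |coulombH γ a ρ| := by
  rw [diracZ]
  refine (norm_sub_le _ _).trans (add_le_add ?_ ?_)
  · rw [← Real.norm_eq_abs, ← norm_real]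
    push_cast
    rfl
  · rw [norm_mul, norm_mul, norm_I, one_mul, norm_real, norm_real, Real.norm_eq_abs,
      Real.norm_eq_abs]

theorem norm_diracY_le {γ a ρ : ℝ} (hγ : 0 ≤ γ) (ha : 0 < a) (hρ : 0 < ρ) :
    ‖diracZ γ a ρ‖ ≤ (1 + a) * (2 * (γ + ρ + 1)) ∧
    ‖diracY γ a ρ‖ ≤ ρ ^ (γ - 1) * ((1 + a) * (2 * (γ + ρ + 1))) := by
  have H := isCoulombProfile_re a hγ
  have h0 : |coulombH γ a 0| = 1 := by rw [coulombH_zero a hγ, abs_one]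
  have h1 := H.abs_le hγ ha hρ.le
  have h2 := H.abs_mul_deriv_le hγ ha hρ.le
  rw [h0] at h1 h2
  have h3 : ‖diracZ γ a ρ‖ ≤ (1 + a) * (2 * (γ + ρ + 1)) := by
    refine (norm_diracZ_le _ _ _).trans ?_
    have h4 : |(2 * γ + 1) * coulombH γ a ρ| ≤ 2 * γ + 1 := by
      rw [abs_mul, abs_of_nonneg (by linarith : 0 ≤ 2 * γ + 1)]
      exact mul_le_of_le_one_right (by linarith) h1
    have h5 : |ρ| * |coulombH γ a ρ| ≤ ρ := by
      rw [abs_of_pos hρ]; exact mul_le_of_le_one_right hρ.le h1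
    have h6 := abs_add_le (ρ * coulombH' γ a ρ) ((2 * γ + 1) * coulombH γ a ρ)
    nlinarith [mul_nonneg ha.le hγ, mul_pos ha hρ]
  refine ⟨h3, ?_⟩
  rw [diracY, norm_mul, norm_real, Real.norm_eq_abs, abs_of_nonneg (by positivity)]
  gcongr

theorem norm_diracY'_le {γ a ρ : ℝ} (hγ : 0 ≤ γ) (ha : 0 < a) (hρ : 0 < ρ) :
    2 * ‖diracY γ a ρ‖ + ‖diracY' γ a ρ‖ ≤
      ρ ^ (γ - 2) * ((1 + a) * (9 * (γ + ρ + 1) ^ 2)) := by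
  have H := isCoulombProfile_re a hγ
  have h0 : |coulombH γ a 0| = 1 := by rw [coulombH_zero a hγ, abs_one]
  have h1 := H.abs_le hγ ha hρ.le
  have h2 := H.abs_mul_deriv_le hγ ha hρ.le
  rw [h0] at h1 h2
  obtain ⟨hZ, hY⟩ := norm_diracY_le hγ ha hρ
  have hp : ρ ^ (γ - 1) = ρ ^ (γ - 2) * ρ := by
    rw [← Real.rpow_add_one hρ.ne']; congr 1; ring
  have e1 : ‖((γ : ℂ) - 1) / ρ * diracZ γ a ρ‖ ≤ (γ + 1) / ρ * ((1 + a) * (2 * (γ + ρ + 1))) := by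
    have h3 : ‖((γ : ℂ) - 1) / ρ‖ ≤ (γ + 1) / ρ := by
      rw [norm_div, norm_real, Real.norm_eq_abs, abs_of_pos hρ]
      refine div_le_div_of_nonneg_right ?_ hρ.le
      refine (norm_sub_le _ _).trans ?_
      rw [norm_real, Real.norm_eq_abs, abs_of_nonneg hγ, norm_one]
    rw [norm_mul]
    gcongr
  have e2 : ‖((ρ : ℂ) + 2 * a + I) * coulombH γ a ρ‖ ≤ ρ + 2 * a + 1 := by
    have h3 : ‖(ρ : ℂ) + 2 * a + I‖ ≤ ρ + 2 * a + 1 := by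
      refine (norm_add_le _ _).trans ?_
      rw [norm_I, ← ofReal_ofNat, ← ofReal_mul, ← ofReal_add, norm_real, Real.norm_eq_abs,
        abs_of_pos (by positivity)]
    rw [norm_mul, norm_real, Real.norm_eq_abs]
    calc _ ≤ (ρ + 2 * a + 1) * 1 := by gcongr
      _ = _ := mul_one _
  have e3 : ‖I * ρ * coulombH' γ a ρ‖ ≤ ρ + a := by
    rw [mul_assoc, norm_mul, norm_I, one_mul, ← ofReal_mul, norm_real, Real.norm_eq_abs]
    linarith
  have hY' : ‖diracY' γ a ρ‖ ≤ ρ ^ (γ - 1) * ((γ + 1) / ρ * ((1 + a) * (2 * (γ + ρ + 1))) +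
      (ρ + 2 * a + 1) + (ρ + a)) := by
    rw [diracY', norm_mul, norm_real, Real.norm_eq_abs, abs_of_nonneg (by positivity)]
    gcongr
    exact (norm_sub_le _ _).trans (add_le_add ((norm_sub_le _ _).trans (add_le_add e1 e2)) e3)
  calc 2 * ‖diracY γ a ρ‖ + ‖diracY' γ a ρ‖
      ≤ 2 * (ρ ^ (γ - 1) * ((1 + a) * (2 * (γ + ρ + 1)))) +
        ρ ^ (γ - 1) * ((γ + 1) / ρ * ((1 + a) * (2 * (γ + ρ + 1))) +
      (ρ + 2 * a + 1) + (ρ + a)) := by gcongr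
    _ = ρ ^ (γ - 2) * (4 * ρ * ((1 + a) * (γ + ρ + 1)) +
        2 * (γ + 1) * ((1 + a) * (γ + ρ + 1)) + ρ * (2 * ρ + 3 * a + 1)) := by
      rw [hp]; field_simp; ring
    _ ≤ ρ ^ (γ - 2) * ((1 + a) * (9 * (γ + ρ + 1) ^ 2)) := by
      gcongr
      -- The constant is `9 = 4 + 2 + 3`, one summand for each of the three terms.
      have hS : 0 ≤ (1 + a) * (γ + ρ + 1) := by positivity
      have h5 : 4 * ρ * ((1 + a) * (γ + ρ + 1)) ≤ 4 * (γ + ρ + 1) * ((1 + a) * (γ + ρ + 1)) := by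
        gcongr; linarith
      have h6 : 2 * (γ + 1) * ((1 + a) * (γ + ρ + 1)) ≤
          2 * (γ + ρ + 1) * ((1 + a) * (γ + ρ + 1)) := by gcongr; linarith
      have h7 : ρ * (2 * ρ + 3 * a + 1) ≤ (γ + ρ + 1) * (3 * ((1 + a) * (γ + ρ + 1))) := by
        gcongr
        · linarith
        · nlinarith [mul_nonneg ha.le hγ, mul_pos ha hρ]
      nlinarith

theorem norm_Phi_near {m ν N ξ ρ : ℝ} {k : ℤ} (ha : alpha m ν N < 0) (hρ : 0 < ρ) :
    ‖Phi m ν k N ξ ρ‖ ≤ coulombBound (gam ν k) * (ρ ^ (gam ν k - 1) * (2 * (gam ν k + ρ + 1))) ∧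
    ‖deriv (Phi m ν k N ξ) ρ‖ ≤
      coulombBound (gam ν k) * (ρ ^ (gam ν k - 2) * (9 * (gam ν k + ρ + 1) ^ 2)) := by
  have hγ : 0 ≤ gam ν k := Real.sqrt_nonneg _
  have ha' : 0 < -alpha m ν N := by linarith
  have h0 := diracConst_nonneg hγ (-alpha m ν N)
  have h1 := diracConst_mul_le hγ ha'
  constructor
  · rw [norm_Phi_eq ha hρ]
    calc _ ≤ diracConst (gam ν k) (-alpha m ν N) * (ρ ^ (gam ν k - 1) *
          ((1 + -alpha m ν N) * (2 * (gam ν k + ρ + 1)))) := by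
          gcongr; exact (norm_diracY_le hγ ha' hρ).2
      _ = (diracConst (gam ν k) (-alpha m ν N) * (1 + -alpha m ν N)) *
          (ρ ^ (gam ν k - 1) * (2 * (gam ν k + ρ + 1))) := by ring
      _ ≤ _ := by gcongr
  · refine (norm_deriv_Phi_le ha hρ).trans ?_
    calc _ ≤ diracConst (gam ν k) (-alpha m ν N) * (ρ ^ (gam ν k - 2) *
          ((1 + -alpha m ν N) * (9 * (gam ν k + ρ + 1) ^ 2))) := by
          gcongr; exact norm_diracY'_le hγ ha' hρ
      _ = (diracConst (gam ν k) (-alpha m ν N) * (1 + -alpha m ν N)) *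
          (ρ ^ (gam ν k - 2) * (9 * (gam ν k + ρ + 1) ^ 2)) := by ring
      _ ≤ _ := by gcongr

/-! ### Bounds away from the origin -/

/-- The normalised amplitude. -/
noncomputable def coulombU (γ a ρ : ℝ) : ℝ := coulombConst γ a * (ρ ^ (γ + 1 / 2) * coulombH γ a ρ)

/-- The logarithmic derivative `ρ U'` of the normalised amplitude. -/
noncomputable def coulombW (γ a ρ : ℝ) : ℝ :=
  coulombConst γ a * (ρ ^ (γ + 1 / 2) * ((γ + 1 / 2) * coulombH γ a ρ + ρ * coulombH' γ a ρ))

theorem isCoulombPair_coulombU {γ a : ℝ} (hγ : 0 ≤ γ) (ha : 0 < a) :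
    IsCoulombPair (γ + 1 / 2) a (coulombU γ a) (coulombW γ a) :=
  (isCoulombProfile_re a hγ).isCoulombPair hγ ha (coulombH_zero a hγ)

/-- For `γ ≤ 2ρ` and `ρ ≥ 1`, both `γ + 1/2` and `γ + 1` are `O(ρ)`, so `h` and `ρh'` can be
exchanged for `U` and `W`. Only the coefficient `ρ + 2a` of `h` in the derivative costs a factor `1
+ a`. -/
theorem coulombConst_mul_norm_diracY_le {γ a ρ : ℝ} (hγ : 0 ≤ γ) (ha : 0 < a) (hρ : 1 ≤ ρ)
    (hγρ : γ ≤ 2 * ρ) :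
    coulombConst γ a * (2 * ‖diracY γ a ρ‖ + ‖diracY' γ a ρ‖) ≤
      22 * (1 + a) * (ρ ^ (-(3 / 2) : ℝ) * (|coulombW γ a ρ| + ρ * |coulombU γ a ρ|)) := by
  have hρ0 : 0 < ρ := by linarith
  have hC := coulombConst_nonneg hγ a
  have hp : ρ ^ (γ - 1) = ρ ^ (-(3 / 2) : ℝ) * ρ ^ (γ + 1 / 2) := by
    rw [← Real.rpow_add hρ0]; congr 1; ring
  set P := coulombConst γ a * ρ ^ (γ + 1 / 2) with hP
  have hP0 : 0 ≤ P := by positivity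
  have hU : coulombU γ a ρ = P * coulombH γ a ρ := by rw [coulombU, hP]; ring
  have hW : coulombW γ a ρ = P * ((γ + 1 / 2) * coulombH γ a ρ + ρ * coulombH' γ a ρ) := by
    rw [coulombW, hP]; ring
  have hZ : P * ‖diracZ γ a ρ‖ ≤ |coulombW γ a ρ| + 7 / 2 * ρ * |coulombU γ a ρ| := by
    calc P * ‖diracZ γ a ρ‖ ≤ P * (|ρ * coulombH' γ a ρ + (2 * γ + 1) * coulombH γ a ρ| +
          |ρ| * |coulombH γ a ρ|) := by gcongr; exact norm_diracZ_le _ _ _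
      _ = |coulombW γ a ρ + (γ + 1 / 2) * coulombU γ a ρ| + ρ * |coulombU γ a ρ| := by
        rw [hU, hW, abs_mul P, abs_of_nonneg hP0, abs_of_pos hρ0]
        rw [show P * ((γ + 1 / 2) * coulombH γ a ρ + ρ * coulombH' γ a ρ) +
          (γ + 1 / 2) * (P * coulombH γ a ρ) =
          P * (ρ * coulombH' γ a ρ + (2 * γ + 1) * coulombH γ a ρ) by ring, abs_mul P,
          abs_of_nonneg hP0]
        ring
      _ ≤ |coulombW γ a ρ| + 5 / 2 * ρ * |coulombU γ a ρ| + ρ * |coulombU γ a ρ| := by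
        gcongr
        refine (abs_add_le _ _).trans ?_
        rw [abs_mul, abs_of_nonneg (by linarith : 0 ≤ γ + 1 / 2)]
        gcongr
        linarith
      _ = _ := by ring
  have hZ' : P * ‖((γ : ℂ) - 1) / ρ * diracZ γ a ρ - (ρ + 2 * a + I) * coulombH γ a ρ -
      I * ρ * coulombH' γ a ρ‖ ≤ 4 * |coulombW γ a ρ| + 15 * (1 + a) * ρ * |coulombU γ a ρ| := by
    have e1 : P * ‖((γ : ℂ) - 1) / ρ * diracZ γ a ρ‖ ≤
        3 * (|coulombW γ a ρ| + 7 / 2 * ρ * |coulombU γ a ρ|) := by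
      have h3 : ‖((γ : ℂ) - 1) / ρ‖ ≤ 3 := by
        rw [norm_div, norm_real, Real.norm_eq_abs, abs_of_pos hρ0, div_le_iff₀ hρ0]
        refine (norm_sub_le _ _).trans ?_
        rw [norm_real, Real.norm_eq_abs, abs_of_nonneg hγ, norm_one]
        linarith
      rw [norm_mul, mul_left_comm]
      gcongr
    have e2 : P * ‖((ρ : ℂ) + 2 * a + I) * coulombH γ a ρ‖ ≤ (ρ + 2 * a + 1) * |coulombU γ a ρ| := by
      have h3 : ‖(ρ : ℂ) + 2 * a + I‖ ≤ ρ + 2 * a + 1 := by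
        refine (norm_add_le _ _).trans ?_
        rw [norm_I, ← ofReal_ofNat, ← ofReal_mul, ← ofReal_add, norm_real, Real.norm_eq_abs,
          abs_of_pos (by positivity)]
      rw [norm_mul, norm_real, Real.norm_eq_abs, hU, abs_mul P, abs_of_nonneg hP0, mul_left_comm]
      gcongr
    have e3 : P * ‖I * ρ * coulombH' γ a ρ‖ ≤ |coulombW γ a ρ| + 5 / 2 * ρ * |coulombU γ a ρ| := by
      rw [mul_assoc I, norm_mul, norm_I, one_mul, ← ofReal_mul, norm_real, Real.norm_eq_abs,
        ← abs_of_nonneg hP0, ← abs_mul,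
        show P * (ρ * coulombH' γ a ρ) = coulombW γ a ρ - (γ + 1 / 2) * coulombU γ a ρ by
          rw [hU, hW]; ring]
      refine (abs_sub _ _).trans ?_
      rw [abs_mul, abs_of_nonneg (by linarith : 0 ≤ γ + 1 / 2)]
      gcongr
      linarith
    have h4 : P * ‖((γ : ℂ) - 1) / ρ * diracZ γ a ρ - (ρ + 2 * a + I) * coulombH γ a ρ -
      I * ρ * coulombH' γ a ρ‖ ≤ P * (‖((γ : ℂ) - 1) / ρ * diracZ γ a ρ‖ +
      ‖((ρ : ℂ) + 2 * a + I) * coulombH γ a ρ‖ + ‖I * ρ * coulombH' γ a ρ‖) := by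
      gcongr
      exact (norm_sub_le _ _).trans (add_le_add (norm_sub_le _ _) le_rfl)
    have h5 : (ρ + 2 * a + 1) * |coulombU γ a ρ| ≤ (2 + 2 * a) * ρ * |coulombU γ a ρ| := by
      gcongr; nlinarith
    have h6 : 0 ≤ a * ρ * |coulombU γ a ρ| := by positivity
    linarith
  have hY : coulombConst γ a * ‖diracY γ a ρ‖ = ρ ^ (-(3 / 2) : ℝ) * (P * ‖diracZ γ a ρ‖) := by
    rw [diracY, norm_mul, norm_real, Real.norm_eq_abs, abs_of_nonneg (by positivity), hp, hP]
    ring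
  have hY' : coulombConst γ a * ‖diracY' γ a ρ‖ = ρ ^ (-(3 / 2) : ℝ) *
      (P * ‖((γ : ℂ) - 1) / ρ * diracZ γ a ρ - (ρ + 2 * a + I) * coulombH γ a ρ -
      I * ρ * coulombH' γ a ρ‖) := by
    rw [diracY', norm_mul, norm_real, Real.norm_eq_abs, abs_of_nonneg (by positivity), hp, hP]
    ring
  calc coulombConst γ a * (2 * ‖diracY γ a ρ‖ + ‖diracY' γ a ρ‖)
      = 2 * (coulombConst γ a * ‖diracY γ a ρ‖) + coulombConst γ a * ‖diracY' γ a ρ‖ := by ring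
    _ ≤ 2 * (ρ ^ (-(3 / 2) : ℝ) * (|coulombW γ a ρ| + 7 / 2 * ρ * |coulombU γ a ρ|)) +
        ρ ^ (-(3 / 2) : ℝ) * (4 * |coulombW γ a ρ| + 15 * (1 + a) * ρ * |coulombU γ a ρ|) := by
      rw [hY, hY']; gcongr
    _ = ρ ^ (-(3 / 2) : ℝ) * (6 * |coulombW γ a ρ| + (7 + 15 * (1 + a)) * (ρ * |coulombU γ a ρ|)) := by
      ring
    _ ≤ ρ ^ (-(3 / 2) : ℝ) * (22 * (1 + a) * |coulombW γ a ρ| +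
        22 * (1 + a) * (ρ * |coulombU γ a ρ|)) := by
      gcongr <;> linarith
    _ = _ := by ring

/-- If the scaled amplitude is bounded by `(1 + a)^{1/4}`, then the eigenfunction and its derivative
are bounded, because of the factor `e^{-πa}`. -/
theorem norm_Phi_pow_four_le {m ν N ξ ρ B : ℝ} {k : ℤ} (ha : alpha m ν N < 0) (hρ : 1 ≤ ρ)
    (hγρ : gam ν k ≤ 2 * ρ) (hB : 0 ≤ B)
    (h : coulombW (gam ν k) (-alpha m ν N) ρ ^ 4 + ρ ^ 4 * coulombU (gam ν k) (-alpha m ν N) ρ ^ 4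
      ≤ ρ ^ 6 * (B * (1 + -alpha m ν N))) :
    ‖Phi m ν k N ξ ρ‖ ^ 4 ≤ 22 ^ 4 * 8 * B ∧ ‖deriv (Phi m ν k N ξ) ρ‖ ^ 4 ≤ 22 ^ 4 * 8 * B := by
  have hγ : 0 ≤ gam ν k := Real.sqrt_nonneg _
  have hρ0 : 0 < ρ := by linarith
  have ha' : 0 < -alpha m ν N := by linarith
  have hd := norm_deriv_Phi_le (ξ := ξ) (k := k) ha hρ0
  have hn : ‖Phi m ν k N ξ ρ‖ ≤ diracConst (gam ν k) (-alpha m ν N) *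
      (2 * ‖diracY (gam ν k) (-alpha m ν N) ρ‖ + ‖diracY' (gam ν k) (-alpha m ν N) ρ‖) := by
    rw [norm_Phi_eq ha hρ0]
    refine mul_le_mul_of_nonneg_left ?_ (diracConst_nonneg hγ _)
    linarith [norm_nonneg (diracY (gam ν k) (-alpha m ν N) ρ),
      norm_nonneg (diracY' (gam ν k) (-alpha m ν N) ρ)]
  have hmain := coulombConst_mul_norm_diracY_le hγ ha' hρ hγρ
  rw [diracConst, mul_assoc] at hd hn
  generalize gam ν k = γ at *
  generalize -alpha m ν N = a at *
  generalize coulombW γ a ρ = w at *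
  generalize coulombU γ a ρ = u at *
  have hQ : (ρ ^ (-(3 / 2) : ℝ)) ^ 4 = (ρ ^ 6)⁻¹ := by
    rw [← Real.rpow_natCast, ← Real.rpow_mul hρ0.le, ← Real.rpow_natCast ρ 6, ← Real.rpow_neg hρ0.le]
    norm_num
  have hsum : (|w| + ρ * |u|) ^ 4 ≤ 8 * (ρ ^ 6 * (B * (1 + a))) := by
    have h1 : (|w| + ρ * |u|) ^ 4 ≤ 8 * (|w| ^ 4 + (ρ * |u|) ^ 4) :=
      (add_pow_le (abs_nonneg w) (by positivity) 4).trans_eq (by norm_num)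
    rw [mul_pow, Even.pow_abs (by decide), Even.pow_abs (by decide)] at h1
    linarith
  -- Four factors `1 + a` come from the passage to `U, W` and one from the hypothesis; `4π > 5`
  -- absorbs all five.
  have hexp : Real.exp (-(Real.pi * a)) ^ 4 * (1 + a) ^ 5 ≤ 1 := by
    have h4 : 1 + a ≤ Real.exp a := by linarith [Real.add_one_le_exp a]
    calc Real.exp (-(Real.pi * a)) ^ 4 * (1 + a) ^ 5
        ≤ Real.exp (-(Real.pi * a)) ^ 4 * Real.exp a ^ 5 := by gcongr
      _ = Real.exp (-((4 * Real.pi - 5) * a)) := by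
        rw [← Real.exp_nat_mul, ← Real.exp_nat_mul, ← Real.exp_add]; congr 1; push_cast; ring
      _ ≤ 1 := by
        rw [Real.exp_le_one_iff]
        nlinarith [Real.pi_gt_three]
  have hfin : (Real.exp (-(Real.pi * a)) * (22 * (1 + a) * (ρ ^ (-(3 / 2) : ℝ) *
      (|w| + ρ * |u|)))) ^ 4 ≤ 22 ^ 4 * 8 * B := by
    calc _ = 22 ^ 4 * (Real.exp (-(Real.pi * a)) ^ 4 * (1 + a) ^ 4) *
          ((ρ ^ (-(3 / 2) : ℝ)) ^ 4 * (|w| + ρ * |u|) ^ 4) := by ring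
      _ ≤ 22 ^ 4 * (Real.exp (-(Real.pi * a)) ^ 4 * (1 + a) ^ 4) *
          ((ρ ^ 6)⁻¹ * (8 * (ρ ^ 6 * (B * (1 + a))))) := by rw [hQ]; gcongr
      _ = 22 ^ 4 * 8 * B * (Real.exp (-(Real.pi * a)) ^ 4 * (1 + a) ^ 5) := by
        field_simp
      _ ≤ 22 ^ 4 * 8 * B * 1 := by gcongr
      _ = _ := mul_one _
  constructor
  · exact (pow_le_pow_left₀ (norm_nonneg _) (hn.trans (by gcongr)) 4).trans hfin
  · exact (pow_le_pow_left₀ (norm_nonneg _) (hd.trans (by gcongr)) 4).trans hfin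

end DiracCoulomb

namespace DiracCoulomb

open Complex Filter Topology Set MeasureTheory

/-! ### The size of the normalisation -/

/-- The part of Euler's integral over `(x, x+1]` alone gives this crude Stirling bound. -/
theorem rpow_self_mul_exp_le_Gamma {x : ℝ} (hx : 0 < x) :
    x ^ x * Real.exp (-(x + 1)) ≤ Real.Gamma (x + 1) := by
  rw [Real.Gamma_eq_integral (by linarith), add_sub_cancel_right]
  have hint := Real.GammaIntegral_convergent (s := x + 1) (by linarith)
  rw [add_sub_cancel_right] at hint
  have hsub : Ioc x (x + 1) ⊆ Ioi (0 : ℝ) := fun t ht ↦ hx.trans ht.1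
  calc x ^ x * Real.exp (-(x + 1))
      = ∫ _ in Ioc x (x + 1), x ^ x * Real.exp (-(x + 1)) := by simp
    _ ≤ ∫ t in Ioc x (x + 1), Real.exp (-t) * t ^ x := by
      refine setIntegral_mono_on (integrableOn_const (by simp)) (hint.mono_set hsub) measurableSet_Ioc fun t ht ↦ ?_
      have h1 : x ≤ t := ht.1.le
      have h2 : t ≤ x + 1 := ht.2
      rw [mul_comm]
      gcongr
    _ ≤ _ := by
      refine setIntegral_mono_set hint ?_ (Eventually.of_forall hsub)
      filter_upwards [self_mem_ae_restrict measurableSet_Ioi] with t ht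
      have : (0 : ℝ) < t := ht
      simp only [Pi.zero_apply]
      positivity

/-- By duplication, `coulombBound γ · 2^γ · Γ(γ+3/2) = √π/2 ≤ 1`; then apply Stirling from below at
`γ + 1/2`. -/
theorem coulombBound_mul_le {γ : ℝ} (hγ : 0 ≤ γ) :
    coulombBound γ * (2 ^ γ * (γ + 1 / 2) ^ (γ + 1 / 2)) ≤ Real.exp (γ + 3 / 2) := by
  have h1 := Real.Gamma_mul_Gamma_add_half (γ + 1)
  have h2 := rpow_self_mul_exp_le_Gamma (x := γ + 1 / 2) (by linarith)
  have hG : 0 < Real.Gamma (2 * γ + 2) := Real.Gamma_pos_of_pos (by linarith)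
  have hG' : 0 < Real.Gamma (γ + 1 / 2 + 1) := Real.Gamma_pos_of_pos (by linarith)
  have hpi : √Real.pi ≤ 2 := by
    rw [Real.sqrt_le_left two_pos.le]; linarith [Real.pi_le_four]
  rw [show γ + 1 + 1 / 2 = γ + 1 / 2 + 1 by ring, show 2 * (γ + 1) = 2 * γ + 2 by ring] at h1
  have h3 : (2 : ℝ) ^ γ * 2 ^ γ * 2 ^ (1 - (2 * γ + 2)) = 1 / 2 := by
    rw [← Real.rpow_add two_pos, ← Real.rpow_add two_pos,
      show γ + γ + (1 - (2 * γ + 2)) = -1 by ring, Real.rpow_neg_one]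
    norm_num
  have h4 : coulombBound γ * 2 ^ γ * Real.Gamma (γ + 1 / 2 + 1) ≤ 1 := by
    calc coulombBound γ * 2 ^ γ * Real.Gamma (γ + 1 / 2 + 1)
        = 2 ^ γ * 2 ^ γ * (Real.Gamma (γ + 1) * Real.Gamma (γ + 1 / 2 + 1)) /
          Real.Gamma (2 * γ + 2) := by rw [coulombBound]; ring
      _ = (2 ^ γ * 2 ^ γ * 2 ^ (1 - (2 * γ + 2))) * √Real.pi := by rw [h1]; field_simp
      _ ≤ 1 := by rw [h3]; linarith
  have hb := (coulombBound_pos hγ).le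
  calc coulombBound γ * (2 ^ γ * (γ + 1 / 2) ^ (γ + 1 / 2))
      = coulombBound γ * 2 ^ γ * ((γ + 1 / 2) ^ (γ + 1 / 2) * Real.exp (-(γ + 1 / 2 + 1))) *
        Real.exp (γ + 3 / 2) := by
        rw [mul_assoc (coulombBound γ * 2 ^ γ), mul_assoc ((γ + 1 / 2) ^ (γ + 1 / 2)),
          ← Real.exp_add, show -(γ + 1 / 2 + 1) + (γ + 3 / 2) = 0 by ring, Real.exp_zero]
        ring
    _ ≤ coulombBound γ * 2 ^ γ * Real.Gamma (γ + 1 / 2 + 1) * Real.exp (γ + 3 / 2) := by gcongr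
    _ ≤ 1 * Real.exp (γ + 3 / 2) := by gcongr
    _ = _ := one_mul _

theorem coulombBound_mul_max_rpow_le {γ K : ℝ} (hγ : 0 ≤ γ) (hK : 2 ≤ K) (h1 : K - 1 / 2 ≤ γ)
    (h2 : γ ≤ K) :
    coulombBound γ * max (K / 2) 2 ^ γ ≤ Real.exp 7 * Real.exp (-(K / 4)) := by
  have hK0 : 0 < K := by linarith
  have hb := (coulombBound_pos hγ).le
  have hR : 0 < max (K / 2) 2 := lt_max_of_lt_right two_pos
  have h3 := coulombBound_mul_le hγ
  have h4 : K ^ γ ≤ (γ + 1 / 2) ^ (γ + 1 / 2) :=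
    (Real.rpow_le_rpow hK0.le (by linarith) hγ).trans
      (Real.rpow_le_rpow_of_exponent_le (by linarith) (by linarith))
  have h5 : coulombBound γ * (2 * K) ^ γ ≤ Real.exp (γ + 3 / 2) := by
    rw [Real.mul_rpow two_pos.le hK0.le]
    refine le_trans ?_ h3
    gcongr
  have h6 : Real.exp γ * (max (K / 2) 2 / (2 * K)) ^ γ ≤ Real.exp 5 * Real.exp (-(K / 4)) := by
    rw [← Real.exp_add]
    rcases le_total K 4 with h | h
    · rw [max_eq_right (by linarith)]
      have : (2 / (2 * K)) ^ γ ≤ 1 := Real.rpow_le_one (by positivity)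
        (by rw [div_le_one (by linarith)]; linarith) hγ
      calc Real.exp γ * (2 / (2 * K)) ^ γ ≤ Real.exp γ * 1 := by gcongr
        _ ≤ _ := by rw [mul_one]; gcongr; linarith
    · rw [max_eq_left (by linarith), show K / 2 / (2 * K) = 1 / 4 by field_simp; norm_num]
      -- At `ρ = K/2` the quotient is `1/4`, and `e^{5/4} < 4` leaves the decay `e^{-γ/4}`. It is
      -- checked by fourth powers as `e⁵ < 4⁴`.
      have h7 : (1 / 4 : ℝ) ≤ Real.exp (-(5 / 4)) := by
        rw [Real.exp_neg, one_div]
        refine inv_anti₀ (Real.exp_pos _) ?_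
        refine le_of_pow_le_pow_left₀ (n := 4) (by norm_num) (by norm_num) ?_
        rw [← Real.exp_nat_mul]
        calc Real.exp ((4 : ℕ) * (5 / 4)) = Real.exp 1 ^ 5 := by
              rw [← Real.exp_nat_mul]; norm_num
          _ ≤ 2.7182818286 ^ 5 := by gcongr; exact Real.exp_one_lt_d9.le
          _ ≤ 4 ^ 4 := by norm_num
      calc Real.exp γ * (1 / 4) ^ γ ≤ Real.exp γ * Real.exp (-(5 / 4)) ^ γ := by gcongr
        _ = Real.exp (-(γ / 4)) := by rw [← Real.exp_mul, ← Real.exp_add]; congr 1; ring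
        _ ≤ _ := by gcongr; linarith
  calc coulombBound γ * max (K / 2) 2 ^ γ
      = coulombBound γ * (2 * K) ^ γ * (max (K / 2) 2 / (2 * K)) ^ γ := by
        rw [mul_assoc, ← Real.mul_rpow (by positivity) (by positivity),
          mul_div_cancel₀ _ (by positivity)]
    _ ≤ Real.exp (γ + 3 / 2) * (max (K / 2) 2 / (2 * K)) ^ γ := by gcongr
    _ = Real.exp (3 / 2) * (Real.exp γ * (max (K / 2) 2 / (2 * K)) ^ γ) := by
      rw [Real.exp_add]; ring
    _ ≤ Real.exp (3 / 2) * (Real.exp 5 * Real.exp (-(K / 4))) := by gcongr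
    _ = Real.exp (3 / 2 + 5) * Real.exp (-(K / 4)) := by rw [Real.exp_add]; ring
    _ ≤ _ := by gcongr; norm_num

theorem rpow_sub_le_min_rpow_mul {γ ρ R c : ℝ} (hρ : 0 < ρ) (hR : 2 ≤ R) (hρR : ρ ≤ R)
    (hγ : 0 ≤ γ) (hc : 0 ≤ c) : ρ ^ (γ - c) ≤ min (ρ / 2) 1 ^ (γ - c) * R ^ γ := by
  have hn : 0 < min (ρ / 2) 1 := lt_min (by linarith) one_pos
  have hM : 1 ≤ max 2 ρ := one_le_two.trans (le_max_left _ _)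
  -- The truncated factor keeps the exponent `γ - c`, which may be negative; the other factor is at
  -- least 1, so its exponent may be raised to `γ`.
  have h1 : ρ = min (ρ / 2) 1 * max 2 ρ := by
    rcases le_total ρ 2 with h | h
    · rw [max_eq_left h, min_eq_left (by linarith)]; ring
    · rw [max_eq_right h, min_eq_right (by linarith)]; ring
  calc ρ ^ (γ - c) = min (ρ / 2) 1 ^ (γ - c) * max 2 ρ ^ (γ - c) := by
        rw [← Real.mul_rpow hn.le (by linarith), ← h1]
    _ ≤ min (ρ / 2) 1 ^ (γ - c) * max 2 ρ ^ γ := by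
      gcongr
      linarith
    _ ≤ _ := by gcongr; exact max_le hR hρR

/-! ### The parameters -/

theorem alpha_neg {m ν N : ℝ} (hν : ν < 0) (hN : 0 < N) : alpha m ν N < 0 := by
  have : 0 < √(N ^ 2 + m ^ 2) := Real.sqrt_pos.mpr (by positivity)
  exact div_neg_of_neg_of_pos (mul_neg_of_neg_of_pos hν this) hN

/-- The lower bound gives `l = γ + 1/2 ≥ |k|`, placing `l` between `|k|` and `|k| + 1/2`. It fails
at `|k| = 1`, `ν = -1`, where `γ = 0`. -/
theorem gam_bounds {ν : ℝ} {k : ℤ} (hν : ν ∈ Ico (-1 : ℝ) 0) (hk : 2 ≤ |(k : ℝ)|) :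
    |(k : ℝ)| - 1 / 2 ≤ gam ν k ∧ gam ν k ≤ |(k : ℝ)| := by
  have hν2 : ν ^ 2 ≤ 1 := by nlinarith [hν.1, hν.2]
  rw [gam, ← sq_abs (k : ℝ)]
  constructor
  · refine Real.le_sqrt_of_sq_le ?_
    nlinarith
  · rw [Real.sqrt_le_left (abs_nonneg _)]
    nlinarith [sq_nonneg ν]

/-! ### The three regions -/

theorem norm_Phi_inner {m ν N ξ ρ : ℝ} {k : ℤ} (hν : ν ∈ Ico (-1 : ℝ) 0) (hN : 0 < N)
    (hk : 2 ≤ |(k : ℝ)|) (hρ : 0 < ρ) (hρk : ρ ≤ max (|(k : ℝ)| / 2) 2) :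
    ‖Phi m ν k N ξ ρ‖ ≤ 81 * 128 * Real.exp 7 *
      (min (ρ / 2) 1 ^ (gam ν k - 1) * Real.exp (-(1 / 8) * |(k : ℝ)|)) ∧
    ‖deriv (Phi m ν k N ξ) ρ‖ ≤ 81 * 128 * Real.exp 7 *
      (min (ρ / 2) 1 ^ (gam ν k - 2) * Real.exp (-(1 / 8) * |(k : ℝ)|)) := by
  have hγ : 0 ≤ gam ν k := Real.sqrt_nonneg _
  obtain ⟨h1, h2⟩ := norm_Phi_near (ξ := ξ) (k := k) (alpha_neg (m := m) hν.2 hN) hρ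
  obtain ⟨hg1, hg2⟩ := gam_bounds hν hk
  generalize gam ν k = γ at *
  generalize |(k : ℝ)| = K at *
  have hb := coulombBound_pos hγ
  have hB := coulombBound_mul_max_rpow_le hγ hk hg1 hg2
  have hR : 2 ≤ max (K / 2) 2 := le_max_right _ _
  have hRK : max (K / 2) 2 ≤ K := max_le (by linarith) hk
  have hn : 0 < min (ρ / 2) 1 := lt_min (by linarith) one_pos
  have hS : γ + ρ + 1 ≤ 3 * K := by linarith
  -- Half of the decay absorbs the polynomial factor: `K²/128 ≤ e^{K/8}` turns the rate `1/4` into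
  -- `1/8`.
  have hexp : 81 * K ^ 2 * Real.exp (-(K / 4)) ≤ 81 * 128 * Real.exp (-(1 / 8) * K) := by
    have h3 := Real.quadratic_le_exp_of_nonneg (x := K / 8) (by linarith)
    calc 81 * K ^ 2 * Real.exp (-(K / 4)) ≤ 81 * (128 * Real.exp (K / 8)) * Real.exp (-(K / 4)) := by
          gcongr; nlinarith
      _ = 81 * 128 * (Real.exp (K / 8) * Real.exp (-(K / 4))) := by ring
      _ = _ := by rw [← Real.exp_add]; congr 2; ring
  have key : ∀ c x y : ℝ, 0 ≤ c → 0 ≤ y → y ≤ 81 * K ^ 2 →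
      x ≤ coulombBound γ * (ρ ^ (γ - c) * y) →
      x ≤ 81 * 128 * Real.exp 7 * (min (ρ / 2) 1 ^ (γ - c) * Real.exp (-(1 / 8) * K)) := by
    intro c x y hc hy hyK hx
    have h4 := rpow_sub_le_min_rpow_mul hρ hR hρk hγ hc
    calc x ≤ coulombBound γ * (ρ ^ (γ - c) * y) := hx
      _ ≤ coulombBound γ * (min (ρ / 2) 1 ^ (γ - c) * max (K / 2) 2 ^ γ * (81 * K ^ 2)) := by gcongr
      _ = min (ρ / 2) 1 ^ (γ - c) * (coulombBound γ * max (K / 2) 2 ^ γ) * (81 * K ^ 2) := by ring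
      _ ≤ min (ρ / 2) 1 ^ (γ - c) * (Real.exp 7 * Real.exp (-(K / 4))) * (81 * K ^ 2) := by gcongr
      _ = Real.exp 7 * min (ρ / 2) 1 ^ (γ - c) * (81 * K ^ 2 * Real.exp (-(K / 4))) := by ring
      _ ≤ Real.exp 7 * min (ρ / 2) 1 ^ (γ - c) * (81 * 128 * Real.exp (-(1 / 8) * K)) := by gcongr
      _ = _ := by ring
  refine ⟨key 1 _ _ one_pos.le (by positivity) (by nlinarith) h1,
    key 2 _ _ two_pos.le (by positivity) ?_ h2⟩
  calc 9 * (γ + ρ + 1) ^ 2 ≤ 9 * (3 * K) ^ 2 := by gcongr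
    _ = 81 * K ^ 2 := by ring

/-- Compares `|D| + s²` with the scale in the theorem. The Coulomb term displaces `D` from `ρ² - l²`
by `2aρ ≤ 4aK`, and `K ≤ q⁴ ≤ s²`; so ignoring the resulting shift of the turning point costs only a
factor `1 + a`. -/
theorem disc_bounds_of_turning {K l a ρ q s : ℝ} (hK : 2 ≤ K) (ha : 0 ≤ a) (hlK : K ≤ l)
    (hlK' : l ≤ K + 1 / 2) (h1 : K / 2 ≤ ρ) (h2 : ρ ≤ 2 * K) (hq1 : 1 ≤ q) (hq3 : q ^ 3 = K)
    (hs2 : 2 ≤ s) (hs3 : s ^ 3 = 4 * l ^ 2) :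
    K * (|K - ρ| + q) ≤ 4 * (1 + a) * (|disc l a ρ| + s ^ 2) ∧
      |disc l a ρ| + s ^ 2 ≤ 10 * (1 + a) * K ^ 2 := by
  have hK0 : 0 < K := by linarith
  have hρ : 0 < ρ := by linarith
  have haK : a * ρ ≤ a * (2 * K) := by gcongr
  have haρ : 0 ≤ a * ρ := by positivity
  have hlK2 : K ^ 2 ≤ l ^ 2 := by gcongr
  have hl2 : l ^ 2 ≤ K ^ 2 + K + 1 / 4 := by
    calc l ^ 2 ≤ (K + 1 / 2) ^ 2 := pow_le_pow_left₀ (by linarith) hlK' 2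
      _ = _ := by ring
  constructor
  · have hsq : q ^ 2 ≤ s := by
      refine le_of_pow_le_pow_left₀ (n := 3) (by norm_num) (by linarith) ?_
      calc (q ^ 2) ^ 3 = K ^ 2 := by rw [← hq3]; ring
        _ ≤ s ^ 3 := by rw [hs3]; linarith [sq_nonneg K]
    have hq4 : q ^ 4 ≤ s ^ 2 := by
      calc q ^ 4 = (q ^ 2) ^ 2 := by ring
        _ ≤ s ^ 2 := by gcongr
    have hKq4 : K ≤ q ^ 4 := by
      calc K = q ^ 3 := hq3.symm
        _ ≤ q ^ 4 := pow_le_pow_right₀ hq1 (by norm_num)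
    have hdle : |ρ ^ 2 - l ^ 2| ≤ |disc l a ρ| + 4 * a * K := by
      rw [show ρ ^ 2 - l ^ 2 = disc l a ρ - 2 * (a * ρ) by rw [disc]; ring]
      refine (abs_sub _ _).trans ?_
      rw [abs_of_nonneg (by positivity : 0 ≤ 2 * (a * ρ))]
      linarith
    have h3 : K * |K - ρ| ≤ |ρ ^ 2 - l ^ 2| + 2 * K := by
      calc K * |K - ρ| ≤ (K + ρ) * |K - ρ| := by gcongr; linarith
        _ = |K + ρ| * |K - ρ| := by rw [abs_of_pos (by linarith : 0 < K + ρ)]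
        _ = |-((l ^ 2 - K ^ 2) + (ρ ^ 2 - l ^ 2))| := by rw [← abs_mul]; congr 1; ring
        _ ≤ |l ^ 2 - K ^ 2| + |ρ ^ 2 - l ^ 2| := by rw [abs_neg]; exact abs_add_le _ _
        _ ≤ _ := by rw [abs_of_nonneg (by linarith)]; linarith
    have h4 : K * q = q ^ 4 := by rw [← hq3]; ring
    have h5 : a * K ≤ a * s ^ 2 := by gcongr; linarith
    have h6 : 0 ≤ a * |disc l a ρ| := by positivity
    rw [mul_add, h4]
    linarith [abs_nonneg (disc l a ρ)]
  · have h3 : 2 * s ^ 2 ≤ s ^ 3 := by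
      calc 2 * s ^ 2 ≤ s * s ^ 2 := by gcongr
        _ = s ^ 3 := by ring
    have hKK : 2 * K ≤ K ^ 2 := by nlinarith
    have h5 : a * (2 * K) ≤ a * K ^ 2 := by gcongr
    have hρ2 : ρ ^ 2 ≤ (2 * K) ^ 2 := by gcongr
    have hdge : |disc l a ρ| ≤ 4 * K ^ 2 + 4 * a * K := by
      rw [disc, abs_le]
      constructor <;> nlinarith
    nlinarith

theorem norm_Phi_turning {m ν N ξ ρ : ℝ} {k : ℤ} (hν : ν ∈ Ico (-1 : ℝ) 0) (hN : 0 < N)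
    (hk : 2 ≤ |(k : ℝ)|) (h1 : |(k : ℝ)| / 2 ≤ ρ) (h2 : ρ ≤ 2 * |(k : ℝ)|) :
    ‖Phi m ν k N ξ ρ‖ ≤ 1000 * (|(k : ℝ)| ^ (-(3 / 4) : ℝ) *
      (|(|(k : ℝ)| - ρ)| + |(k : ℝ)| ^ (1 / 3 : ℝ)) ^ (-(1 / 4) : ℝ)) ∧
    ‖deriv (Phi m ν k N ξ) ρ‖ ≤ 1000 * (|(k : ℝ)| ^ (-(3 / 4) : ℝ) *
      (|(|(k : ℝ)| - ρ)| + |(k : ℝ)| ^ (1 / 3 : ℝ)) ^ (-(1 / 4) : ℝ)) := by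
  have hγ : 0 ≤ gam ν k := Real.sqrt_nonneg _
  obtain ⟨hg1, hg2⟩ := gam_bounds hν hk
  have ha : alpha m ν N < 0 := alpha_neg hν.2 hN
  have ha' : 0 < -alpha m ν N := by linarith
  have hmain := fun B ↦ norm_Phi_pow_four_le (B := B) (ξ := ξ) (k := k) ha (by linarith : 1 ≤ ρ)
    (by linarith)
  generalize |(k : ℝ)| = K at *
  have hK0 : 0 < K := by linarith
  have hρ : 0 < ρ := by linarith
  set q : ℝ := K ^ (1 / 3 : ℝ) with hq
  have hq3 : q ^ 3 = K := by rw [hq, ← Real.rpow_natCast, ← Real.rpow_mul hK0.le]; norm_num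
  have hq1 : 1 ≤ q := Real.one_le_rpow (by linarith) (by norm_num)
  have hqK : q ≤ K := by rw [← hq3]; exact le_self_pow₀ hq1 (by norm_num)
  set Z := |K - ρ| + q with hZ
  have hZ0 : 0 < Z := by positivity
  have hZK : Z ≤ 2 * K := by
    have : |K - ρ| ≤ K := by rw [abs_le]; constructor <;> linarith
    linarith
  -- `340480 = 20480 + 320000` collects the `W` and `U` contributions; with `22⁴ · 8` it stays below
  -- `1000⁴`.
  have hfin : ∀ x : ℝ, x ^ 4 ≤ 22 ^ 4 * 8 * (340480 / (K ^ 3 * Z)) →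
      x ≤ 1000 * (K ^ (-(3 / 4) : ℝ) * Z ^ (-(1 / 4) : ℝ)) := by
    intro x hx
    refine le_of_pow_le_pow_left₀ (n := 4) (by norm_num) (by positivity) (hx.trans ?_)
    have e1 : (K ^ (-(3 / 4) : ℝ)) ^ 4 = (K ^ 3)⁻¹ := by
      rw [← Real.rpow_natCast, ← Real.rpow_mul hK0.le, ← Real.rpow_natCast K 3,
        ← Real.rpow_neg hK0.le]
      norm_num
    have e2 : (Z ^ (-(1 / 4) : ℝ)) ^ 4 = Z⁻¹ := by
      rw [← Real.rpow_natCast, ← Real.rpow_mul hZ0.le, ← Real.rpow_neg_one]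
      norm_num
    rw [mul_pow, mul_pow, e1, e2, ← mul_inv, ← div_eq_mul_inv, ← mul_div_assoc]
    gcongr
    norm_num
  suffices hs : coulombW (gam ν k) (-alpha m ν N) ρ ^ 4 +
      ρ ^ 4 * coulombU (gam ν k) (-alpha m ν N) ρ ^ 4
      ≤ ρ ^ 6 * (340480 / (K ^ 3 * Z) * (1 + -alpha m ν N)) by
    obtain ⟨h3, h4⟩ := hmain _ (by positivity) hs
    exact ⟨hfin _ h3, hfin _ h4⟩
  have H := isCoulombPair_coulombU hγ ha'
  generalize -alpha m ν N = a at *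
  generalize gam ν k = γ at *
  set l := γ + 1 / 2 with hl
  have hlK : K ≤ l := by linarith
  have hl0 : 0 < l := by linarith
  set s : ℝ := (4 * l ^ 2) ^ (1 / 3 : ℝ) with hs
  have hs0 : 0 < s := by positivity
  have hs3 : s ^ 3 = 4 * l ^ 2 := by
    rw [hs, ← Real.rpow_natCast, ← Real.rpow_mul (by positivity)]; norm_num
  have hs2 : 2 ≤ s := le_of_pow_le_pow_left₀ (n := 3) (by norm_num) hs0.le (by nlinarith)
  obtain ⟨hU, hW⟩ := H.amplitude_bound ha'.le hl0 hρ hs2 hs3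
  obtain ⟨hKZ, hXK⟩ := disc_bounds_of_turning hk ha'.le hlK (by linarith) h1 h2 hq1 hq3 hs2 hs3
  set X := |disc l a ρ| + s ^ 2 with hX
  have hX0 : 0 < X := by positivity
  have hρ2 : K ^ 2 / 4 ≤ ρ ^ 2 := by
    calc K ^ 2 / 4 = (K / 2) ^ 2 := by ring
      _ ≤ ρ ^ 2 := by gcongr
  have hρ6 : K ^ 6 / 64 ≤ ρ ^ 6 := by
    calc K ^ 6 / 64 = (K / 2) ^ 6 := by ring
      _ ≤ ρ ^ 6 := by gcongr
  have hW' : coulombW γ a ρ ^ 4 ≤ ρ ^ 6 * (20480 / (K ^ 3 * Z) * (1 + a)) := by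
    calc coulombW γ a ρ ^ 4 ≤ 16 * X := hW
      _ ≤ 16 * (10 * (1 + a) * K ^ 2) := by gcongr
      _ = K ^ 6 / 64 * (20480 / (K ^ 3 * (2 * K)) * (1 + a)) := by field_simp; norm_num
      _ ≤ _ := by gcongr
  have hU' : coulombU γ a ρ ^ 4 ≤ 80000 * (1 + a) / (K * Z) := by
    rw [le_div_iff₀ (by positivity)]
    calc coulombU γ a ρ ^ 4 * (K * Z) ≤ coulombU γ a ρ ^ 4 * (4 * (1 + a) * X) := by gcongr
      _ = 4 * (1 + a) * (coulombU γ a ρ ^ 4 * X) := by ring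
      _ ≤ 4 * (1 + a) * 20000 := by gcongr
      _ = _ := by ring
  have hU'' : ρ ^ 4 * coulombU γ a ρ ^ 4 ≤ ρ ^ 6 * (320000 / (K ^ 3 * Z) * (1 + a)) := by
    calc ρ ^ 4 * coulombU γ a ρ ^ 4 ≤ ρ ^ 4 * (80000 * (1 + a) / (K * Z)) := by gcongr
      _ = ρ ^ 4 * (K ^ 2 / 4) * (320000 / (K ^ 3 * Z) * (1 + a)) := by field_simp; norm_num
      _ ≤ ρ ^ 4 * ρ ^ 2 * (320000 / (K ^ 3 * Z) * (1 + a)) := by gcongr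
      _ = _ := by ring
  calc _ ≤ _ := add_le_add hW' hU''
    _ = _ := by ring

/-- With `l ≤ 5ρ/8`, `D` is comparable to `ρ²` up to a factor `1 + a`, so the WKB bound applies
directly. The same statement serves `|k| ≥ 2` and `k = ±1`. -/
theorem norm_Phi_far {m ν N ξ ρ : ℝ} {k : ℤ} (hν : ν ∈ Ico (-1 : ℝ) 0) (hN : 0 < N)
    (hρ : 4 ≤ ρ) (hγρ : gam ν k + 1 / 2 ≤ 5 / 8 * ρ) :
    ‖Phi m ν k N ξ ρ‖ ≤ 1000 * ρ⁻¹ ∧ ‖deriv (Phi m ν k N ξ) ρ‖ ≤ 1000 * ρ⁻¹ := by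
  have hγ : 0 ≤ gam ν k := Real.sqrt_nonneg _
  have ha : alpha m ν N < 0 := alpha_neg hν.2 hN
  have ha' : 0 < -alpha m ν N := by linarith
  have hρ0 : 0 < ρ := by linarith
  have hmain := fun B ↦ norm_Phi_pow_four_le (B := B) (ξ := ξ) (k := k) ha (by linarith : 1 ≤ ρ)
    (by linarith)
  have hfin : ∀ x : ℝ, x ^ 4 ≤ 22 ^ 4 * 8 * (43 / ρ ^ 4) → x ≤ 1000 * ρ⁻¹ := by
    intro x hx
    refine le_of_pow_le_pow_left₀ (n := 4) (by norm_num) (by positivity) (hx.trans ?_)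
    rw [mul_pow, inv_pow, ← div_eq_mul_inv, ← mul_div_assoc]
    gcongr
    norm_num
  suffices hs : coulombW (gam ν k) (-alpha m ν N) ρ ^ 4 +
      ρ ^ 4 * coulombU (gam ν k) (-alpha m ν N) ρ ^ 4
      ≤ ρ ^ 6 * (43 / ρ ^ 4 * (1 + -alpha m ν N)) by
    obtain ⟨h3, h4⟩ := hmain _ (by positivity) hs
    exact ⟨hfin _ h3, hfin _ h4⟩
  have H := isCoulombPair_coulombU hγ ha'
  generalize -alpha m ν N = a at *
  generalize gam ν k = γ at *
  set l := γ + 1 / 2 with hl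
  have hl0 : 0 < l := by linarith
  have hl2 : l ^ 2 ≤ 25 / 64 * ρ ^ 2 := by
    calc l ^ 2 ≤ (5 / 8 * ρ) ^ 2 := by gcongr
      _ = _ := by ring
  have haρ := mul_pos ha' hρ0
  have hD1 : 39 / 64 * ρ ^ 2 ≤ disc l a ρ := by rw [disc]; linarith
  have hD2 : disc l a ρ ≤ (1 + a) * ρ ^ 2 := by
    rw [disc]; nlinarith [sq_nonneg l]
  have hD0 : 0 < disc l a ρ := lt_of_lt_of_le (by positivity) hD1
  have hc : wkbCoeff l a ρ ≤ 1 := by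
    -- `s = 3ρ/4` works: `s² = 36ρ²/64 ≤ 39ρ²/64 ≤ D`, and `ρ ≥ 4` gives both `s ≥ 2` and `2l² ≤
    -- s³`.
    refine IsCoulombPair.wkbCoeff_le_one ha'.le hρ0 (s := 3 / 4 * ρ) (by linarith) ?_ (by nlinarith)
    nlinarith [sq_nonneg ρ]
  have h := H.wkb_bound ha'.le hρ0 hD0 hc
  have hq := Real.sqrt_pos.mpr hD0
  have hqq := Real.sq_sqrt hD0.le
  have hu : √(disc l a ρ) * coulombU γ a ρ ^ 2 ≤ 4 := by
    have : 0 ≤ coulombW γ a ρ ^ 2 / √(disc l a ρ) := by positivity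
    linarith
  have hw : coulombW γ a ρ ^ 2 ≤ 4 * √(disc l a ρ) := by
    rw [← div_le_iff₀ hq]
    have : 0 ≤ √(disc l a ρ) * coulombU γ a ρ ^ 2 := by positivity
    linarith
  have hw4 : coulombW γ a ρ ^ 4 ≤ 16 * ((1 + a) * ρ ^ 2) := by
    calc coulombW γ a ρ ^ 4 = (coulombW γ a ρ ^ 2) ^ 2 := by ring
      _ ≤ (4 * √(disc l a ρ)) ^ 2 := by gcongr
      _ = 16 * disc l a ρ := by rw [mul_pow, hqq]; norm_num
      _ ≤ _ := by gcongr
  have hu4 : 39 / 64 * ρ ^ 2 * coulombU γ a ρ ^ 4 ≤ 16 := by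
    calc 39 / 64 * ρ ^ 2 * coulombU γ a ρ ^ 4 ≤ disc l a ρ * coulombU γ a ρ ^ 4 := by gcongr
      _ = (√(disc l a ρ) * coulombU γ a ρ ^ 2) ^ 2 := by rw [mul_pow, hqq]; ring
      _ ≤ 4 ^ 2 := by gcongr
      _ = 16 := by norm_num
  have hu4' : ρ ^ 4 * coulombU γ a ρ ^ 4 ≤ 27 * ρ ^ 2 := by
    nlinarith [mul_le_mul_of_nonneg_left hu4 (sq_nonneg ρ)]
  calc _ ≤ 16 * ((1 + a) * ρ ^ 2) + 27 * ρ ^ 2 := add_le_add hw4 hu4'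
    _ ≤ 43 * ((1 + a) * ρ ^ 2) := by nlinarith [mul_nonneg ha'.le (sq_nonneg ρ)]
    _ = _ := by field_simp

theorem norm_Phi_one {m ν N ξ ρ : ℝ} {k : ℤ} (hν : ν ∈ Ico (-1 : ℝ) 0) (hN : 0 < N)
    (hk : (k : ℝ) ^ 2 = 1) (hρ : 0 < ρ) {c : ℝ}
    (hc : c = 1000 + 1296 * coulombBound √(1 - ν ^ 2)) :
    ((ρ ≤ 1 → ‖Phi m ν k N ξ ρ‖ ≤ c * ρ ^ (√(1 - ν ^ 2) - 1)) ∧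
      (1 < ρ → ‖Phi m ν k N ξ ρ‖ ≤ c * ρ⁻¹)) ∧
    (ρ ≤ 1 → ‖deriv (Phi m ν k N ξ) ρ‖ ≤ c * ρ ^ (√(1 - ν ^ 2) - 2)) ∧
      (1 < ρ → ‖deriv (Phi m ν k N ξ) ρ‖ ≤ c * ρ⁻¹) := by
  have hg : gam ν k = √(1 - ν ^ 2) := by rw [gam, hk]
  have hγ : 0 ≤ gam ν k := Real.sqrt_nonneg _
  have hγ1 : gam ν k ≤ 1 := by
    rw [hg, Real.sqrt_le_left one_pos.le]; nlinarith [sq_nonneg ν]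
  obtain ⟨h1, h2⟩ := norm_Phi_near (ξ := ξ) (k := k) (alpha_neg (m := m) hν.2 hN) hρ
  have hfar := fun h : 4 ≤ ρ ↦ norm_Phi_far (m := m) (ξ := ξ) (k := k) hν hN h (by linarith)
  rw [← hg] at hc ⊢
  generalize gam ν k = γ at *
  have hb := coulombBound_pos hγ
  have near : ∀ x y e : ℝ, 0 ≤ y → y ≤ 81 → x ≤ coulombBound γ * (ρ ^ e * y) → x ≤ c * ρ ^ e := by
    intro x y e hy hy' hx
    have h0 : 0 ≤ ρ ^ e := by positivity
    calc x ≤ coulombBound γ * (ρ ^ e * y) := hx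
      _ ≤ coulombBound γ * (ρ ^ e * 81) := by gcongr
      _ = 81 * coulombBound γ * ρ ^ e := by ring
      _ ≤ c * ρ ^ e := by gcongr; linarith
  -- On `1 < ρ ≤ 4` the bound near the origin is reused: `ρ^e ≤ 1 ≤ 4/ρ`, `324 = 9 · 6²` and `1296 =
  -- 4 · 324`.
  have mid : ∀ x y e : ℝ, 0 ≤ y → y ≤ 324 → 1 < ρ → ρ ≤ 4 → e ≤ 0 →
      x ≤ coulombBound γ * (ρ ^ e * y) → x ≤ c * ρ⁻¹ := by
    intro x y e hy hy' hρ1 hρ4 he hx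
    have h0 : ρ ^ e ≤ 4 * ρ⁻¹ := by
      refine (Real.rpow_le_one_of_one_le_of_nonpos hρ1.le he).trans ?_
      rw [← div_eq_mul_inv, le_div_iff₀ hρ]; linarith
    calc x ≤ coulombBound γ * (ρ ^ e * y) := hx
      _ ≤ coulombBound γ * (4 * ρ⁻¹ * 324) := by gcongr
      _ = 1296 * coulombBound γ * ρ⁻¹ := by ring
      _ ≤ c * ρ⁻¹ := by gcongr; linarith
  have far : ∀ x : ℝ, x ≤ 1000 * ρ⁻¹ → x ≤ c * ρ⁻¹ := by
    intro x hx
    refine hx.trans ?_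
    gcongr
    linarith
  refine ⟨⟨fun h ↦ near _ _ _ (by positivity) (by linarith) h1, fun h ↦ ?_⟩,
    fun h ↦ near _ _ _ (by positivity) (by nlinarith) h2, fun h ↦ ?_⟩
  · rcases le_total ρ 4 with h4 | h4
    · exact mid _ _ _ (by positivity) (by linarith) h h4 (by linarith) h1
    · exact far _ (hfar h4).1
  · rcases le_total ρ 4 with h4 | h4
    · exact mid _ _ _ (by positivity) (by nlinarith) h h4 (by linarith) h2
    · exact far _ (hfar h4).2

end DiracCoulomb

/-! ### Assembly of the regional bounds. -/

theorem theoremA2 (m : ℝ) (hm : 0 < m) :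
    (∃ C D : ℝ, 0 < C ∧ 0 < D ∧
      ∀ ν : ℝ, ν ∈ Set.Ico (-1 : ℝ) 0 → ∀ k : ℤ, 2 ≤ |k| →
      ∀ (n : ℤ) (N : ℝ), N = (2 : ℝ) ^ n →
      ∀ ξ : ℝ, DiracCoulomb.IsPhaseShift m ν k N ξ →
      ∀ ρ : ℝ, 0 < ρ →
        ((ρ ≤ max (|(k : ℝ)| / 2) 2 →
            ‖DiracCoulomb.Phi m ν k N ξ ρ‖ ≤
              C * ((min (ρ / 2) 1) ^ (DiracCoulomb.gam ν k - 1) * Real.exp (-D * |(k : ℝ)|))) ∧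
          (|(k : ℝ)| / 2 ≤ ρ → ρ ≤ 2 * |(k : ℝ)| →
            ‖DiracCoulomb.Phi m ν k N ξ ρ‖ ≤
              C * (|(k : ℝ)| ^ (-(3 / 4) : ℝ) *
                (|(|(k : ℝ)| - ρ)| + |(k : ℝ)| ^ (1 / 3 : ℝ)) ^ (-(1 / 4) : ℝ))) ∧
          (2 * |(k : ℝ)| ≤ ρ →
            ‖DiracCoulomb.Phi m ν k N ξ ρ‖ ≤ C * ρ⁻¹)) ∧
        (DifferentiableAt ℝ (DiracCoulomb.Phi m ν k N ξ) ρ ∧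
          (ρ ≤ max (|(k : ℝ)| / 2) 2 →
            ‖deriv (DiracCoulomb.Phi m ν k N ξ) ρ‖ ≤
              C * ((min (ρ / 2) 1) ^ (DiracCoulomb.gam ν k - 2) * Real.exp (-D * |(k : ℝ)|))) ∧
          (|(k : ℝ)| / 2 ≤ ρ → ρ ≤ 2 * |(k : ℝ)| →
            ‖deriv (DiracCoulomb.Phi m ν k N ξ) ρ‖ ≤
              C * (|(k : ℝ)| ^ (-(3 / 4) : ℝ) *
                (|(|(k : ℝ)| - ρ)| + |(k : ℝ)| ^ (1 / 3 : ℝ)) ^ (-(1 / 4) : ℝ))) ∧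
          (2 * |(k : ℝ)| ≤ ρ →
            ‖deriv (DiracCoulomb.Phi m ν k N ξ) ρ‖ ≤ C * ρ⁻¹))) ∧
    (∀ ν : ℝ, ν ∈ Set.Ico (-1 : ℝ) 0 → ∃ c : ℝ, 0 < c ∧
      ∀ k : ℤ, (k = 1 ∨ k = -1) →
      ∀ (n : ℤ) (N : ℝ), N = (2 : ℝ) ^ n →
      ∀ ξ : ℝ, DiracCoulomb.IsPhaseShift m ν k N ξ →
      ∀ ρ : ℝ, 0 < ρ →
        ((ρ ≤ 1 → ‖DiracCoulomb.Phi m ν k N ξ ρ‖ ≤ c * ρ ^ (√(1 - ν ^ 2) - 1)) ∧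
          (1 < ρ → ‖DiracCoulomb.Phi m ν k N ξ ρ‖ ≤ c * ρ⁻¹)) ∧
        (DifferentiableAt ℝ (DiracCoulomb.Phi m ν k N ξ) ρ ∧
          (ρ ≤ 1 → ‖deriv (DiracCoulomb.Phi m ν k N ξ) ρ‖ ≤ c * ρ ^ (√(1 - ν ^ 2) - 2)) ∧
          (1 < ρ → ‖deriv (DiracCoulomb.Phi m ν k N ξ) ρ‖ ≤ c * ρ⁻¹))) := by
  constructor
  · refine ⟨81 * 128 * Real.exp 7, 1 / 8, by positivity, by norm_num, ?_⟩
    rintro ν hν k hk n N rfl ξ - ρ hρ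
    have hN : (0 : ℝ) < 2 ^ n := by positivity
    have hk' : 2 ≤ |(k : ℝ)| := by exact_mod_cast hk
    have hC : (1000 : ℝ) ≤ 81 * 128 * Real.exp 7 := by
      have : 1 ≤ Real.exp 7 := Real.one_le_exp (by norm_num)
      linarith
    have hinner := DiracCoulomb.norm_Phi_inner (m := m) (ξ := ξ) hν hN hk' hρ
    have hturn := DiracCoulomb.norm_Phi_turning (m := m) (ξ := ξ) hν hN (ρ := ρ) hk'
    -- `ρ ≥ 2|k| ≥ 4` gives `γ + 1/2 ≤ ρ/2 + ρ/8`, the source of the `5/8`.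
    have hfar : 2 * |(k : ℝ)| ≤ ρ → _ := fun h ↦
      DiracCoulomb.norm_Phi_far (m := m) (ξ := ξ) (k := k) hν hN (by linarith : 4 ≤ ρ)
        (by linarith [(DiracCoulomb.gam_bounds hν hk').2])
    have hdiff := (DiracCoulomb.hasDerivAt_Phi (m := m) (ξ := ξ) (k := k)
      (DiracCoulomb.alpha_neg hν.2 hN) hρ).differentiableAt
    refine ⟨⟨fun h ↦ (hinner h).1, fun h h' ↦ (hturn h h').1.trans (by gcongr),
      fun h ↦ (hfar h).1.trans (by gcongr)⟩, hdiff, fun h ↦ (hinner h).2,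
      fun h h' ↦ (hturn h h').2.trans (by gcongr), fun h ↦ (hfar h).2.trans (by gcongr)⟩
  · intro ν hν
    have hb := DiracCoulomb.coulombBound_pos (Real.sqrt_nonneg (1 - ν ^ 2))
    refine ⟨1000 + 1296 * DiracCoulomb.coulombBound √(1 - ν ^ 2), by positivity, ?_⟩
    rintro k hk n N rfl ξ - ρ hρ
    have hN : (0 : ℝ) < 2 ^ n := by positivity
    have hk' : (k : ℝ) ^ 2 = 1 := by rcases hk with rfl | rfl <;> norm_num
    obtain ⟨h1, h2⟩ := DiracCoulomb.norm_Phi_one (m := m) (ξ := ξ) hν hN hk' hρ rfl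
    exact ⟨h1, (DiracCoulomb.hasDerivAt_Phi (DiracCoulomb.alpha_neg hν.2 hN) hρ).differentiableAt,
      h2⟩
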